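/- Let $H$ be a real separable Hilbert space. Assume: (i) $A:D(A)\subset H\to H$ is the infinitesimal generator of a strongly continuous semigroup $(e^{tA})_{t\ge 0}$; (ii) $Q$ is a bounded nonnegative self-adjoint operator on $H$ with $\operatorname{Ker}Q=\{0\}$, and for every $t>0$ the operator $Q_t=\int_0^t e^{sA}Qe^{sA^*}\,ds$ (strong integral) is of trace class; (iii) $e^{tA}(H)\subset Q_t^{1/2}(H)$ for every $t>0$; (iv) with $\Lambda(t)=Q_t^{-1/2}e^{tA}$, there are $\delta\in(0,1)$ and $C_\delta>0$ such that $\|\Lambda(t)\|_{\mathcal L(H)}\le C_\delta t^{-\delta}$ for all $t>0$. Let $W_t=\sum_k W^k_t e_k$ be a cylindrical Brownian motion on $H$ (with $(e_k)$ an orthonormal basis of $H$ and $(W^k)$ independent standard real Brownian motions on a probability space $(\Omega,\mathcal F,\mathbb P)$), and let $$Z^x_t=e^{tA}x+W_A(t),\qquad W_A(t)=\int_0^t e^{(t-s)A}\sqrt Q\,dW_s,$$ be the solution of $dZ^x_t=AZ^x_t\,dt+\sqrt Q\,dW_t$, $Z_0^x=x$. For bounded measurable $f:H\to\mathbb R$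 put $(S_tf)(x)=\mathbb E[f(Z^x_t)]$. Let $u_0:H\to\mathbb R$ and $B:H\to H$ be bounded and measurable, and define $$u^0(t,x)=(S_tu_0)(x),\qquad u^{n+1}(t,x)=(S_tu_0)(x)+\int_0^t\big(S_{t-s}\langle B,Du^n(s)\rangle\big)(x)\,ds,$$ $v^0=u^0$ and $v^n=u^n-u^{n-1}$ for $n\ge1$, where $D$ is the Fréchet derivative in $x$ and $u^n(s)=u^n(s,\cdot)$. For random vectors $h,y$ in $H$ and $r>0$, $\langle h,Q_r^{-1/2}y\rangle$ denotes the limit in probability of $\langle h,(Q_r+\varepsilon)^{-1}Q_r^{1/2}y\rangle$ as $\varepsilon\downarrow0$ (in the formula below $y$ is centered Gaussian with covariance $Q_r$ and independent of the bounded vector $h$; for deterministic $h$ the limit is the usual centered Gaussian variable with variance $|h|^2$). Write $\|\cdot\|_\infty$ for the supremum over $H$ of the norm. Then for every $n\ge1$ and $t>0$ the following holds. (a) For every $x\in H$, $$v^n(t,x)=\int_0^t dr_n\int_0^{r_n}dr_{n-1}\cdots\int_0^{r_2}dr_1\;\mathbb E\Big[u_0(Z^x_t)\prod_{i=1}^n\Big\langle\Lambda(r_{i+1}-r_i)B(Z^x_{r_i}),\,Q_{r_{i+1}-r_i}^{-1/2}\big(Z^x_{r_{i+1}}-e^{(r_{i+1}-r_i)A}Z^x_{r_i}\big)\Big\rangle\Big],$$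 where $r_{n+1}=t$; here the random variable in the expectation is integrable whenever $0<r_1<\dots<r_n<t$, and its expectation is an integrable function of $(r_1,\dots,r_n)$ on this simplex. (b) $v^n(t,\cdot)$ is bounded, and $$\|v^n(t)\|_\infty\le\|u_0\|_\infty\|B\|_\infty^n\int_0^t dr_n\int_0^{r_n}dr_{n-1}\cdots\int_0^{r_2}dr_1\prod_{i=1}^n\|\Lambda(r_{i+1}-r_i)\|_{\mathcal L(H)}.$$ (c) $v^n(t,\cdot)$ is Fréchet differentiable with bounded derivative and, with $r_0=0$, $$\|Dv^n(t)\|_\infty\le\|u_0\|_\infty\|B\|_\infty^n\int_0^t dr_n\int_0^{r_n}dr_{n-1}\cdots\int_0^{r_2}dr_1\prod_{i=0}^n\|\Lambda(r_{i+1}-r_i)\|_{\mathcal L(H)}.$$ -/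

import Mathlib

open Set Filter Topology MeasureTheory ProbabilityTheory
open scoped NNReal ENNReal

namespace KolmogorovSeries

noncomputable section

section Operators

variable {H : Type*} [NormedAddCommGroup H] [InnerProductSpace ℝ H] [CompleteSpace H]

/-! ### Strongly continuous semigroups and their generators -/

/-- `(T t)_{t ≥ 0}` is a strongly continuous semigroup of bounded operators on `H`
(the values `T t` for `t < 0` are irrelevant). -/
structure IsC0Semigroup (T : ℝ → H →L[ℝ] H) : Prop where
  map_zero : T 0 = ContinuousLinearMap.id ℝ H
  map_add : ∀ s t, 0 ≤ s → 0 ≤ t → T (s + t) = (T s).comp (T t)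
  strongly_continuous : ∀ x, ContinuousOn (fun t => T t x) (Ici 0)

/-- The (in general unbounded) operator `A : D(A) ⊆ H → H` is the infinitesimal generator of `T`:
`x ∈ D(A)` and `A x = y` iff `(T t x - x) / t → y` as `t ↓ 0`. -/
def IsGenerator (A : H →ₗ.[ℝ] H) (T : ℝ → H →L[ℝ] H) : Prop :=
  ∀ x y : H, (x, y) ∈ A.graph ↔
    Tendsto (fun t : ℝ => t⁻¹ • (T t x - x)) (𝓝[>] 0) (𝓝 y)

/-! ### Trace class operators -/

/-- `R` is of trace class (nuclear): `R x = ∑ ⟨aₙ, x⟩ bₙ` with `∑ ‖aₙ‖ ‖bₙ‖ < ∞`. -/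
def IsTraceClass (R : H →L[ℝ] H) : Prop :=
  ∃ a b : ℕ → H, Summable (fun n => ‖a n‖ * ‖b n‖) ∧
    ∀ x, HasSum (fun n => (inner ℝ (a n) x : ℝ) • b n) (R x)

/-! ### The nonnegative square root of a nonnegative operator -/

theorem catalan_sum (N : ℕ) :
    ∑ n ∈ Finset.range N, (catalan n : ℝ) * (1 / 4) ^ n
      = 2 - 2 * (N.centralBinom : ℝ) * (1 / 4) ^ N := by
  induction N with
  | zero => simp
  | succ N ih =>
    have h1 : ((N : ℝ) + 1) * catalan N = N.centralBinom := by
      exact_mod_cast succ_mul_catalan_eq_centralBinom N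
    have h2 : ((N : ℝ) + 1) * (N + 1).centralBinom = 2 * (2 * N + 1) * N.centralBinom := by
      exact_mod_cast Nat.succ_mul_centralBinom_succ N
    have hN : ((N : ℝ) + 1) ≠ 0 := by positivity
    rw [Finset.sum_range_succ, ih, pow_succ]
    have h3 : (catalan N : ℝ) = N.centralBinom / (N + 1) := by field_simp; linarith
    have h4 : ((N + 1).centralBinom : ℝ) = 2 * (2 * N + 1) * N.centralBinom / (N + 1) := by
      field_simp; linarith
    rw [h3, h4]
    field_simp
    ring

theorem catalan_bound (N : ℕ) :
    ∑ n ∈ Finset.range N, (catalan n : ℝ) * (1 / 4) ^ n ≤ 2 := by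
  rw [catalan_sum]
  have : 0 ≤ 2 * (N.centralBinom : ℝ) * (1 / 4) ^ N := by positivity
  linarith

theorem exists_unit_sqrt (X : H →L[ℝ] H) (hX : IsSelfAdjoint X) (hn : ‖X‖ ≤ 1) :
    ∃ S : H →L[ℝ] H, S.IsPositive ∧ S * S = 1 - X := by
  have hs0 : Summable fun n => (catalan n : ℝ) * (1 / 4) ^ n :=
    summable_of_sum_range_le (fun n => by positivity) catalan_bound
  have hsum2 : ∑' n, (catalan n : ℝ) * (1 / 4) ^ n ≤ 2 :=
    Real.tsum_le_of_sum_range_le (fun n => by positivity) catalan_bound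
  let c : ℕ → H →L[ℝ] H := fun n => ((catalan n : ℝ) * (1 / 4) ^ n) • X ^ n
  have hpow : ∀ n, ‖X ^ n‖ ≤ 1 := fun n => by
    induction n with
    | zero => rw [pow_zero]; exact ContinuousLinearMap.norm_id_le
    | succ n ih =>
      rw [pow_succ]
      exact (norm_mul_le _ _).trans (mul_le_one₀ ih (norm_nonneg _) hn)
  have hcn : ∀ n, ‖c n‖ ≤ (catalan n : ℝ) * (1 / 4) ^ n := fun n => by
    simp only [c, norm_smul]
    rw [Real.norm_of_nonneg (by positivity)]
    exact mul_le_of_le_one_right (by positivity) (hpow n)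
  have hcs : Summable fun n => ‖c n‖ :=
    Summable.of_nonneg_of_le (fun _ => norm_nonneg _) hcn hs0
  let g : H →L[ℝ] H := ∑' n, c n
  have hgn : ‖g‖ ≤ 2 :=
    (norm_tsum_le_tsum_norm hcs).trans ((hcs.tsum_le_tsum hcn hs0).trans hsum2)
  have hg : g = 1 + (1 / 4 : ℝ) • (X * (g * g)) := by
    have h1 : g * g = ∑' n, ((catalan (n + 1) : ℝ) * (1 / 4) ^ n) • X ^ n := by
      change (∑' n, c n) * (∑' n, c n) = _
      rw [tsum_mul_tsum_eq_tsum_sum_antidiagonal_of_summable_norm hcs hcs]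
      refine tsum_congr fun n => ?_
      rw [catalan_succ']
      push_cast
      rw [Finset.sum_mul, Finset.sum_smul]
      refine Finset.sum_congr rfl fun p hp => ?_
      have := Finset.HasAntidiagonal.mem_antidiagonal.1 hp
      simp only [c, smul_mul_smul_comm, ← pow_add, this]
      congr 1
      rw [← this]
      ring
    have h2 : g = c 0 + ∑' n, c (n + 1) := hcs.of_norm.tsum_eq_zero_add
    have h3 : (1 / 4 : ℝ) • (X * (g * g)) = ∑' n, c (n + 1) := by
      rw [h1, ← smul_mul_assoc]
      have hs : Summable fun n => ((catalan (n + 1) : ℝ) * (1 / 4) ^ n) • X ^ n := by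
        refine Summable.of_norm (Summable.of_nonneg_of_le (fun _ => norm_nonneg _) (fun n => ?_)
          (((summable_nat_add_iff 1).2 hs0).mul_left 4))
        rw [norm_smul, Real.norm_of_nonneg (by positivity)]
        refine (mul_le_of_le_one_right (by positivity) (hpow n)).trans (le_of_eq ?_)
        ring
      rw [← hs.tsum_mul_left]
      refine tsum_congr fun n => ?_
      simp only [c, smul_mul_smul_comm, ← pow_succ']
      congr 1
      ring
    rw [h3]
    conv_lhs => rw [h2]
    simp [c]
  have hcomm : Commute X g := by
    refine Commute.tsum_right _ fun n => ?_
    exact ((Commute.refl X).pow_right n).smul_right _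
  have hgsa : IsSelfAdjoint g := by
    change star (∑' n, c n) = ∑' n, c n
    rw [tsum_star]
    refine tsum_congr fun n => ?_
    simp only [c, star_smul, star_trivial, star_pow, hX.star_eq]
  refine ⟨1 - (1 / 2 : ℝ) • (X * g), ?_, ?_⟩
  · rw [ContinuousLinearMap.isPositive_iff']
    refine ⟨?_, fun x => ?_⟩
    · refine (IsSelfAdjoint.one _).sub ?_
      exact (IsSelfAdjoint.all (1 / 2 : ℝ)).smul ((IsSelfAdjoint.commute_iff hX hgsa).1 hcomm)
    · have h1 : ‖(X * g)‖ ≤ 2 := (norm_mul_le _ _).trans (by nlinarith [norm_nonneg X, norm_nonneg g])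
      have h2 : inner ℝ ((X * g) x) x ≤ 2 * ‖x‖ ^ 2 := by
        refine (real_inner_le_norm _ _).trans ?_
        have := (X * g).le_opNorm x
        have h3 := mul_le_mul_of_nonneg_right h1 (norm_nonneg x)
        nlinarith [norm_nonneg x]
      have h3 : inner ℝ ((1 - (1 / 2 : ℝ) • (X * g)) x) x = ‖x‖ ^ 2 - 1 / 2 * inner ℝ ((X * g) x) x := by
        rw [sub_apply, inner_sub_left, smul_apply,
          real_inner_smul_left, one_apply_eq_self, real_inner_self_eq_norm_sq]
      rw [h3]
      linarith
  · have h4 : X * g * (X * g) = (4 : ℝ) • (X * g - X) := by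
      have e1 : X * g * (X * g) = X * (X * (g * g)) := by
        rw [mul_assoc, ← mul_assoc g X g, ← hcomm.eq, mul_assoc]
      have e2 : X * (g * g) = (4 : ℝ) • (g - 1) := by
        nth_rewrite 3 [hg]
        rw [add_sub_cancel_left, smul_smul]; norm_num
      rw [e1, e2, mul_smul_comm, mul_sub, mul_one]
    have e : (1 - (1 / 2 : ℝ) • (X * g)) * (1 - (1 / 2 : ℝ) • (X * g))
        = 1 - X * g + (1 / 4 : ℝ) • (X * g * (X * g)) := by
      rw [sub_mul, mul_sub, mul_sub, smul_mul_smul_comm]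
      simp only [one_mul, mul_one]
      module
    rw [e, h4, smul_smul]
    norm_num

theorem norm_one_sub_le {H : Type*} [NormedAddCommGroup H] [InnerProductSpace ℝ H]
    (R : H →L[ℝ] H) (hR : R.IsPositive) (hpos : 0 < ‖R‖) :
    ‖(1 : H →L[ℝ] H) - ‖R‖⁻¹ • R‖ ≤ 1 := by
  set p : H →L[ℝ] H := ‖R‖⁻¹ • R with hp
  have hpp : p.IsPositive := hR.smul_of_nonneg (inv_nonneg.2 hpos.le)
  have hpn : ‖p‖ ≤ 1 := by
    rw [hp, norm_smul, norm_inv, norm_norm, inv_mul_cancel₀ hpos.ne']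
  refine ContinuousLinearMap.opNorm_le_bound _ zero_le_one fun x => ?_
  have hsym : ∀ y z, inner ℝ (p y) z = inner ℝ y (p z) := hpp.inner_left_eq_inner_right
  have h1 : inner ℝ (p (p x)) (p x) ≤ ‖p x‖ ^ 2 := by
    have h2 := real_inner_le_norm (p (p x)) (p x)
    have h3 := p.le_opNorm (p x)
    nlinarith [norm_nonneg (p x), norm_nonneg p]
  have h2 : 0 ≤ inner ℝ (p (x - p x)) (x - p x) := hpp.inner_nonneg_left _
  have h3 : inner ℝ (p (x - p x)) (x - p x)
      = inner ℝ (p x) x - 2 * ‖p x‖ ^ 2 + inner ℝ (p (p x)) (p x) := by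
    rw [map_sub, inner_sub_left, inner_sub_right, inner_sub_right, real_inner_self_eq_norm_sq,
      hsym (p x) x, real_inner_self_eq_norm_sq]
    ring
  have h4 : ‖x - p x‖ ^ 2 ≤ ‖x‖ ^ 2 := by
    rw [norm_sub_sq_real, real_inner_comm]
    nlinarith
  have h5 := (pow_le_pow_iff_left₀ (norm_nonneg _) (norm_nonneg _) two_ne_zero).1 h4
  simpa using h5

/-- Every nonnegative bounded operator has a nonnegative square root. -/
theorem exists_sqrt (R : H →L[ℝ] H) (hR : R.IsPositive) :
    ∃ S : H →L[ℝ] H, S.IsPositive ∧ S.comp S = R := by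
  rcases eq_or_ne R 0 with rfl | h0
  · exact ⟨0, ContinuousLinearMap.isPositive_zero, by simp⟩
  have hpos : 0 < ‖R‖ := norm_pos_iff.2 h0
  obtain ⟨S, hS, hSS⟩ := exists_unit_sqrt (1 - ‖R‖⁻¹ • R)
    ((IsSelfAdjoint.one _).sub ((IsSelfAdjoint.all ‖R‖⁻¹).smul hR.isSelfAdjoint)) (norm_one_sub_le R hR hpos)
  refine ⟨√‖R‖ • S, hS.smul_of_nonneg (Real.sqrt_nonneg _), ?_⟩
  have : (√‖R‖ • S) * (√‖R‖ • S) = R := by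
    rw [smul_mul_smul_comm, hSS, Real.mul_self_sqrt hpos.le, sub_sub_cancel, smul_smul,
      mul_inv_cancel₀ hpos.ne', one_smul]
  exact this

open Classical in
/-- The nonnegative square root `R^{1/2}` of a nonnegative operator `R`: the (unique) nonnegative
`S` with `S ∘ S = R` (and `0` if `R` is not nonnegative). -/
def opSqrt (R : H →L[ℝ] H) : H →L[ℝ] H :=
  if h : ∃ S : H →L[ℝ] H, S.IsPositive ∧ S.comp S = R then h.choose else 0

theorem opSqrt_spec {R : H →L[ℝ] H} (hR : R.IsPositive) :
    (opSqrt R).IsPositive ∧ (opSqrt R).comp (opSqrt R) = R := by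
  have h := exists_sqrt R hR
  rw [opSqrt, dif_pos h]
  exact h.choose_spec

/-! ### The operator `S⁻¹ T` for `range T ⊆ range S` -/

theorem exists_quotient (S T : H →L[ℝ] H) (h : range T ⊆ range S) :
    ∃ L : H →L[ℝ] H, S.comp L = T ∧ ∀ x, L x ∈ (LinearMap.ker S.toLinearMap)ᗮ := by
  let K := LinearMap.ker S.toLinearMap
  have hK : IsClosed (K : Set H) := S.isClosed_ker
  have : CompleteSpace K := hK.completeSpace_coe
  have hex : ∀ x, ∃ z, S z = T x ∧ z ∈ Kᗮ := by
    intro x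
    obtain ⟨z, hz⟩ := h ⟨x, rfl⟩
    refine ⟨z - K.starProjection z, ?_, K.sub_starProjection_mem_orthogonal z⟩
    have : S (K.starProjection z) = 0 := K.starProjection_apply_mem z
    rw [map_sub, this, sub_zero, hz]
  have huniq : ∀ z w, S z = S w → z ∈ Kᗮ → w ∈ Kᗮ → z = w := by
    intro z w hzw hz hw
    have h1 : z - w ∈ K := by simp [K, LinearMap.mem_ker, hzw]
    have h2 : z - w ∈ Kᗮ := sub_mem hz hw
    exact sub_eq_zero.1 (inner_self_eq_zero.1 (h2 _ h1))
  choose f hf1 hf2 using hex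
  let F : H →ₗ[ℝ] H :=
    { toFun := f
      map_add' := fun x y => huniq _ _ (by simp [hf1]) (hf2 _) (add_mem (hf2 _) (hf2 _))
      map_smul' := fun a x => huniq _ _ (by simp [hf1]) (hf2 _) (Submodule.smul_mem _ _ (hf2 _)) }
  have hF : Continuous F := by
    refine F.continuous_of_seq_closed_graph fun u x y hu hy => ?_
    refine huniq _ _ ?_ ?_ (hf2 x)
    · refine tendsto_nhds_unique ((S.continuous.tendsto y).comp hy) ?_
      have : (S ∘ F ∘ u) = fun n => T (u n) := by
        funext n; exact hf1 (u n)
      rw [this]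
      change Tendsto _ _ (𝓝 (S (f x)))
      rw [hf1]
      exact (T.continuous.tendsto x).comp hu
    · exact K.isClosed_orthogonal.mem_of_tendsto hy (Eventually.of_forall fun n => hf2 _)
  exact ⟨⟨F, hF⟩, ContinuousLinearMap.ext hf1, hf2⟩

open Classical in
/-- The operator `S⁻¹ T`, where `S⁻¹` is the pseudo-inverse of `S` (the inverse of `S` on its range
if `S` is injective): the unique bounded `L` with `S L = T` and values orthogonal to `ker S`. It
exists as soon as `range T ⊆ range S`. -/
def invComp (S T : H →L[ℝ] H) : H →L[ℝ] H :=
  if h : ∃ L : H →L[ℝ] H, S.comp L = T ∧ ∀ x, L x ∈ (LinearMap.ker S.toLinearMap)ᗮ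
  then h.choose else 0

theorem invComp_spec {S T : H →L[ℝ] H} (h : range T ⊆ range S) :
    S.comp (invComp S T) = T ∧ ∀ x, invComp S T x ∈ (LinearMap.ker S.toLinearMap)ᗮ := by
  have h' := exists_quotient S T h
  rw [invComp, dif_pos h']
  exact h'.choose_spec

/-! ### The covariance operators `Q_t` and the operators `Λ(t)` -/

theorem exists_covOp [SecondCountableTopology H] {T : ℝ → H →L[ℝ] H} (hT : IsC0Semigroup T)
    (Q : H →L[ℝ] H) {t : ℝ} (ht : 0 ≤ t) :
    ∃ R : H →L[ℝ] H, ∀ x, IntervalIntegrable (fun s => T s (Q ((T s).adjoint x))) volume 0 t ∧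
      R x = ∫ s in (0 : ℝ)..t, T s (Q ((T s).adjoint x)) := by
  borelize H
  obtain ⟨C, hC⟩ : ∃ C, ∀ s : Icc (0 : ℝ) t, ‖T s‖ ≤ C := by
    refine banach_steinhaus fun x => ?_
    obtain ⟨C, hC⟩ := (isCompact_Icc (a := (0 : ℝ)) (b := t)).exists_bound_of_continuousOn
      ((hT.strongly_continuous x).mono Icc_subset_Ici_self)
    exact ⟨C, fun s => hC s s.2⟩
  have hC0 : 0 ≤ C := (norm_nonneg _).trans (hC ⟨0, left_mem_Icc.2 ht⟩)
  -- the semigroup, extended constantly to negative times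
  let U : ℝ → H →L[ℝ] H := fun s => T (max s 0)
  have hU : ∀ x, Continuous fun s => U s x := fun x =>
    (hT.strongly_continuous x).comp_continuous (by fun_prop) fun s => le_max_right s 0
  have hUT : ∀ s ∈ Ioc 0 t, U s = T s := fun s hs => by simp [U, max_eq_left hs.1.le]
  have hmeas1 : ∀ x, Measurable fun s => (U s).adjoint x := fun x => by
    have hball : ∀ (c : H) (r : ℝ), 0 ≤ r →
        MeasurableSet ((fun s => (U s).adjoint x) ⁻¹' Metric.closedBall c r) := fun c r hr => by
      have : ((fun s => (U s).adjoint x) ⁻¹' Metric.closedBall c r)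
          = ⋂ z : H, {s | inner ℝ x (U s z) - inner ℝ c z ≤ r * ‖z‖} := by
        ext s
        simp only [mem_preimage, Metric.mem_closedBall, dist_eq_norm, mem_iInter, mem_ofPred_eq]
        have e : ∀ z, inner ℝ x (U s z) - inner ℝ c z = inner ℝ ((U s).adjoint x - c) z :=
          fun z => by rw [inner_sub_left, ContinuousLinearMap.adjoint_inner_left]
        simp only [e]
        constructor
        · intro h z
          exact (real_inner_le_norm _ _).trans (mul_le_mul_of_nonneg_right h (norm_nonneg _))
        · intro h
          have h1 := h ((U s).adjoint x - c)
          rw [real_inner_self_eq_norm_sq, sq] at h1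
          rcases (norm_nonneg ((U s).adjoint x - c)).eq_or_lt with h2 | h2
          · rw [← h2]; exact hr
          · exact le_of_mul_le_mul_right h1 h2
      rw [this]
      refine (isClosed_iInter fun z => ?_).measurableSet
      exact isClosed_le (((continuous_const.inner (hU z)).sub continuous_const)) continuous_const
    refine measurable_of_isOpen fun V hV => ?_
    obtain ⟨D, hD, hDd⟩ := TopologicalSpace.exists_countable_dense H
    have hVe : V = ⋃ c ∈ D, ⋃ q : ℚ, ⋃ _ : 0 ≤ (q : ℝ) ∧ Metric.closedBall c (q : ℝ) ⊆ V,
        Metric.closedBall c (q : ℝ) := by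
      apply Subset.antisymm
      · intro y hy
        obtain ⟨ε, hε, hεV⟩ := Metric.isOpen_iff.1 hV y hy
        obtain ⟨q, hq0, hq⟩ := exists_rat_btwn (show (0 : ℝ) < ε / 2 by linarith)
        obtain ⟨c, hc, hcy⟩ := hDd.exists_dist_lt y hq0
        simp only [mem_iUnion]
        refine ⟨c, hc, q, ⟨hq0.le, fun z hz => hεV ?_⟩, ?_⟩
        · rw [Metric.mem_closedBall] at hz
          rw [Metric.mem_ball]
          have := dist_triangle z c y
          rw [dist_comm c y] at this
          linarith
        · exact Metric.mem_closedBall.2 hcy.le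
      · simp only [iUnion_subset_iff]
        exact fun c _ q h => h.2
    rw [hVe]
    simp only [preimage_iUnion]
    exact MeasurableSet.biUnion hD fun c _ => MeasurableSet.iUnion fun q =>
      MeasurableSet.iUnion fun h => hball c q h.1
  have hmeas : ∀ x, Measurable fun s => U s (Q ((U s).adjoint x)) := fun x => by
    have h1 : StronglyMeasurable (Function.uncurry fun (z : H) (s : ℝ) => U s z) :=
      stronglyMeasurable_uncurry_of_continuous_of_stronglyMeasurable
        (fun s => (U s).continuous) (fun z => (hU z).stronglyMeasurable)
    exact h1.measurable.comp ((Q.continuous.measurable.comp (hmeas1 x)).prodMk measurable_id)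
  have hint : ∀ x, IntervalIntegrable (fun s => T s (Q ((T s).adjoint x))) volume 0 t := by
    intro x
    rw [intervalIntegrable_iff_integrableOn_Ioc_of_le ht]
    refine Integrable.of_bound (C := C * (‖Q‖ * (C * ‖x‖))) ?_ ?_
    · refine ((hmeas x).aestronglyMeasurable).congr ?_
      filter_upwards [ae_restrict_mem measurableSet_Ioc] with s hs
      rw [hUT s hs]
    · filter_upwards [ae_restrict_mem measurableSet_Ioc] with s hs
      have hs' : ‖T s‖ ≤ C := hC ⟨s, hs.1.le, hs.2⟩
      have hs'' : ‖(T s).adjoint‖ ≤ C := by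
        rw [LinearIsometryEquiv.norm_map]; exact hs'
      refine ((T s).le_of_opNorm_le hs' _).trans (mul_le_mul_of_nonneg_left ?_ hC0)
      refine (Q.le_opNorm _).trans (mul_le_mul_of_nonneg_left ?_ (norm_nonneg _))
      exact (T s).adjoint.le_of_opNorm_le hs'' _
  let F : H →ₗ[ℝ] H :=
    { toFun := fun x => ∫ s in (0 : ℝ)..t, T s (Q ((T s).adjoint x))
      map_add' := fun x y => by
        rw [← intervalIntegral.integral_add (hint x) (hint y)]
        simp only [map_add]
      map_smul' := fun a x => by
        rw [RingHom.id_apply, ← intervalIntegral.integral_smul]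
        simp only [map_smul] }
  refine ⟨F.mkContinuous (C * (‖Q‖ * C) * t) fun x => ?_, fun x => ⟨hint x, rfl⟩⟩
  change ‖∫ s in (0 : ℝ)..t, T s (Q ((T s).adjoint x))‖ ≤ _
  have := intervalIntegral.norm_integral_le_of_norm_le_const (a := 0) (b := t)
    (f := fun s => T s (Q ((T s).adjoint x))) (C := C * (‖Q‖ * (C * ‖x‖))) (fun s hs => by
      rw [uIoc_of_le ht] at hs
      have hs' : ‖T s‖ ≤ C := hC ⟨s, hs.1.le, hs.2⟩
      have hs'' : ‖(T s).adjoint‖ ≤ C := by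
        rw [LinearIsometryEquiv.norm_map]; exact hs'
      refine ((T s).le_of_opNorm_le hs' _).trans (mul_le_mul_of_nonneg_left ?_ hC0)
      refine (Q.le_opNorm _).trans (mul_le_mul_of_nonneg_left ?_ (norm_nonneg _))
      exact (T s).adjoint.le_of_opNorm_le hs'' _)
  rw [sub_zero, abs_of_nonneg ht] at this
  refine this.trans (le_of_eq ?_)
  ring

open Classical in
/-- The operator `Q_t = ∫₀ᵗ e^{sA} Q e^{sA*} ds` (strong integral), where `T s = e^{sA}`. -/
def covOp (T : ℝ → H →L[ℝ] H) (Q : H →L[ℝ] H) (t : ℝ) : H →L[ℝ] H :=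
  if h : ∃ R : H →L[ℝ] H, ∀ x, R x = ∫ s in (0 : ℝ)..t, T s (Q ((T s).adjoint x))
  then h.choose else 0

theorem covOp_apply [SecondCountableTopology H] {T : ℝ → H →L[ℝ] H} (hT : IsC0Semigroup T)
    (Q : H →L[ℝ] H) {t : ℝ} (ht : 0 ≤ t) (x : H) :
    covOp T Q t x = ∫ s in (0 : ℝ)..t, T s (Q ((T s).adjoint x)) := by
  have h : ∃ R : H →L[ℝ] H, ∀ x, R x = ∫ s in (0 : ℝ)..t, T s (Q ((T s).adjoint x)) := by
    obtain ⟨R, hR⟩ := exists_covOp hT Q ht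
    exact ⟨R, fun x => (hR x).2⟩
  rw [covOp, dif_pos h]
  exact h.choose_spec x

/-- The operator `Λ(t) = Q_t^{-1/2} e^{tA}`. -/
def Lam (T : ℝ → H →L[ℝ] H) (Q : H →L[ℝ] H) (t : ℝ) : H →L[ℝ] H :=
  invComp (opSqrt (covOp T Q t)) (T t)

end Operators

section Stochastics

variable {H : Type*} [NormedAddCommGroup H] [InnerProductSpace ℝ H] [CompleteSpace H]
  {Ω : Type*} [MeasurableSpace Ω] {ι : Type*}

/-! ### Cylindrical Brownian motion and the stochastic convolution -/

/-- The coordinates `W^k` of a cylindrical Brownian motion `W_t = ∑ₖ W^k_t eₖ`: independent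
one-dimensional standard Brownian motions. -/
structure IsCylindricalBM (W : ι → ℝ≥0 → Ω → ℝ) (P : Measure Ω) : Prop where
  brownian : ∀ k, IsBrownianReal (W k) P
  indep : iIndepFun (fun k ω => fun t : ℝ≥0 => W k t ω) P

/-- `I` is (a version of) the Wiener integral `∫₀ᵗ f(s) dw_s` of the continuous function
`f : [0, t] → H` with respect to the Brownian motion `w`: the `L²(P)`-limit of the sums
`∑_{j<N} (w_{(j+1)t/N} - w_{jt/N}) f(jt/N)`. -/
def IsWienerIntegral (P : Measure Ω) (w : ℝ≥0 → Ω → ℝ) (f : ℝ → H) (t : ℝ) (I : Ω → H) : Prop :=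
  MemLp I 2 P ∧
    Tendsto (fun N : ℕ => eLpNorm (fun ω =>
        (∑ j ∈ Finset.range N,
          (w (Real.toNNReal ((j + 1) * t / N)) ω - w (Real.toNNReal (j * t / N)) ω) •
            f (j * t / N)) - I ω) 2 P)
      atTop (𝓝 0)

/-- `WA` is (a version of) the stochastic convolution
`W_A(t) = ∫₀ᵗ e^{(t-s)A} √Q dW_s = ∑ₖ ∫₀ᵗ e^{(t-s)A} √Q eₖ dW^k_s`, the series being convergent
in `L²(P)`; here `T s = e^{sA}`. -/
def IsStochasticConvolution (P : Measure Ω) (T : ℝ → H →L[ℝ] H) (Q : H →L[ℝ] H)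
    (e : HilbertBasis ι ℝ H) (W : ι → ℝ≥0 → Ω → ℝ) (WA : ℝ → Ω → H) : Prop :=
  ∀ t, 0 ≤ t → MemLp (WA t) 2 P ∧ ∃ I : ι → Ω → H,
    (∀ k, IsWienerIntegral P (W k) (fun s => T (t - s) (opSqrt Q (e k))) t (I k)) ∧
    Tendsto (fun F : Finset ι => eLpNorm (fun ω => (∑ k ∈ F, I k ω) - WA t ω) 2 P)
      atTop (𝓝 0)

/-- The solution `Z_t^x = e^{tA} x + W_A(t)` of `dZ = A Z dt + √Q dW`, `Z_0 = x`. -/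
def proc (T : ℝ → H →L[ℝ] H) (WA : ℝ → Ω → H) (x : H) (t : ℝ) (ω : Ω) : H :=
  T t x + WA t ω

/-! ### The iteration scheme -/

/-- `(S_t f)(x) = E[f(Z_t^x)]`. -/
def transOp (P : Measure Ω) (T : ℝ → H →L[ℝ] H) (WA : ℝ → Ω → H) (t : ℝ) (f : H → ℝ) (x : H) : ℝ :=
  ∫ ω, f (proc T WA x t ω) ∂P

/-- The iterates `u⁰(t,x) = (S_t u₀)(x)`,
`u^{n+1}(t,x) = (S_t u₀)(x) + ∫₀ᵗ (S_{t-s} ⟨B, D u^n(s)⟩)(x) ds`. -/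
def iterate (P : Measure Ω) (T : ℝ → H →L[ℝ] H) (WA : ℝ → Ω → H) (u₀ : H → ℝ) (B : H → H) :
    ℕ → ℝ → H → ℝ
  | 0, t, x => transOp P T WA t u₀ x
  | n + 1, t, x => transOp P T WA t u₀ x +
      ∫ s in (0 : ℝ)..t,
        transOp P T WA (t - s) (fun y => fderiv ℝ (iterate P T WA u₀ B n s) y (B y)) x

/-- The series terms `v⁰ = u⁰`, `v^n = u^n - u^{n-1}` for `n ≥ 1`. -/
def seriesTerm (P : Measure Ω) (T : ℝ → H →L[ℝ] H) (WA : ℝ → Ω → H) (u₀ : H → ℝ) (B : H → H) :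
    ℕ → ℝ → H → ℝ
  | 0, t, x => iterate P T WA u₀ B 0 t x
  | n + 1, t, x => iterate P T WA u₀ B (n + 1) t x - iterate P T WA u₀ B n t x

/-! ### The random variables `⟨h, R^{-1/2} y⟩` -/

open Classical in
/-- The random variable `⟨h, R^{-1/2} y⟩` for random vectors `h, y` in `H` and a nonnegative
operator `R`: the limit in probability, as `ε ↓ 0`, of `⟨h, (R + ε)⁻¹ R^{1/2} y⟩`. If `R` is
injective and `y` takes values in the range of `R^{1/2}` it is the literal inner product. If `y` is
a centered Gaussian vector with covariance `R`, independent of the bounded random vector `h`, the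
limit exists (also in `L²`) although `y` is in general not in the range of `R^{1/2}`; for
deterministic `h` it is then the centered Gaussian variable with variance `‖h‖²` obtained by
extending `R^{1/2} g ↦ ⟨g, y⟩` isometrically from the range of `R^{1/2}` to `H`. -/
def gaussPairing (P : Measure Ω) (R : H →L[ℝ] H) (h y : Ω → H) : Ω → ℝ :=
  if hX : ∃ X : Ω → ℝ, AEMeasurable X P ∧
      TendstoInMeasure P
        (fun (ε : ℝ) ω => inner ℝ (h ω)
          (Ring.inverse (R + ε • ContinuousLinearMap.id ℝ H) (opSqrt R (y ω))))
        (𝓝[>] 0) X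
  then hX.choose else 0

/-! ### Iterated time integrals -/

/-- `∫₀ᵗ drₙ ∫₀^{rₙ} dr_{n-1} ⋯ ∫₀^{r₂} dr₁ F(r₁, …, rₙ)`. -/
def iteratedIntegral : (n : ℕ) → ℝ → ((Fin n → ℝ) → ℝ) → ℝ
  | 0, _, F => F Fin.elim0
  | n + 1, t, F => ∫ s in (0 : ℝ)..t,
      iteratedIntegral n s (fun r => F (Fin.snoc (α := fun _ => ℝ) r s))

/-- The times `(r₀, r₁, …, rₙ, r_{n+1})` with `r₀ = 0` and `r_{n+1} = t`. -/
def times {n : ℕ} (t : ℝ) (r : Fin n → ℝ) : Fin (n + 2) → ℝ :=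
  Fin.cons (α := fun _ => ℝ) 0 (Fin.snoc (α := fun _ => ℝ) r t)

/-- The simplex `0 < r₁ < ⋯ < rₙ < t`. -/
def simplex (n : ℕ) (t : ℝ) : Set (Fin n → ℝ) := {r | StrictMono (times t r)}

/-- The gap `r_{i+1} - r_i`, `0 ≤ i ≤ n`. -/
def gap {n : ℕ} (t : ℝ) (r : Fin n → ℝ) (i : Fin (n + 1)) : ℝ :=
  times t r i.succ - times t r i.castSucc

/-- The random variable
`u₀(Z_t^x) ∏_{i=1}^n ⟨Λ(r_{i+1}-r_i) B(Z_{r_i}^x),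
  Q_{r_{i+1}-r_i}^{-1/2} (Z_{r_{i+1}}^x - e^{(r_{i+1}-r_i)A} Z_{r_i}^x)⟩`.
(The index `i : Fin n` below runs over `0, …, n-1`, so that `i.succ` runs over `1, …, n`.) -/
def integrand (P : Measure Ω) (T : ℝ → H →L[ℝ] H) (Q : H →L[ℝ] H) (WA : ℝ → Ω → H)
    (u₀ : H → ℝ) (B : H → H) (x : H) {n : ℕ} (t : ℝ) (r : Fin n → ℝ) (ω : Ω) : ℝ :=
  u₀ (proc T WA x t ω) * ∏ i : Fin n,
    gaussPairing P (covOp T Q (gap t r i.succ))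
      (fun ω => Lam T Q (gap t r i.succ) (B (proc T WA x (times t r i.succ.castSucc) ω)))
      (fun ω => proc T WA x (times t r i.succ.succ) ω -
        T (gap t r i.succ) (proc T WA x (times t r i.succ.castSucc) ω)) ω

/-- The uniform norm `‖f‖_∞ = sup_x ‖f x‖` of a bounded function. -/
def supNorm {α E : Type*} [Norm E] (f : α → E) : ℝ := ⨆ x, ‖f x‖

end Stochastics

end

end KolmogorovSeries

set_option linter.unusedSectionVars false

namespace KolmogorovSeries

noncomputable section

section OperatorLemmas

variable {H : Type*} [NormedAddCommGroup H] [InnerProductSpace ℝ H] [CompleteSpace H]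

/-! ### Regularised inverses of nonnegative operators -/

/-! For `s < t` the vector `Z_t - e^{(t-s)A} Z_s` is centered Gaussian with covariance `Q_{t-s}` and
independent of the values of `Z` at finitely many times up to `s`. Everything therefore rests on a
single Gaussian measure with injective covariance `R = Q_τ`, together with `R^{1/2} Λ = e^{τA}`.
Replacing `x` by `x + h` translates that measure by `R^{1/2} Λ h`; by Cameron–Martin this multiplies
it by `exp(X - ‖Λh‖²/2)`, where `X = ⟨Λh, R^{-1/2} ·⟩`, and in `L²` this density is `1 + X +
O(‖Λh‖²)`. Hence `S_τ f` is Fréchet differentiable for merely bounded measurable `f`, its derivative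
in direction `h` is the expectation of `f(Z_τ)` times `X`, and the derivative is bounded by `‖f‖
‖Λ(τ)‖` (`exists_hasFDerivAt`).

The rest is a perturbation series. Since the iteration is affine, `v^{n+1}(t) = ∫₀ᵗ S_{t-s}⟨B, D
v^n(s)⟩ ds`, a recursion that splits off the first time. The representation formula is instead
unravelled by conditioning on the past of the last time, so `term` is defined by the recursion that
splits off the last time; `term_succ_eq` shows by Fubini on a triangle that the two recursions
agree. Both norm bounds are iterated convolutions of `‖Λ‖` (`convPow`), with innermost function `1`
for `v^n` and `‖Λ‖` for `D v^n`. They are finite because measurable nonnegative functions that are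
`O(t^{-δ})` with `0 < δ < 1` are stable under convolution (`IsSingular.causalConv`).

On the probabilistic side, all coordinates of `W_A` lie in one closed Gaussian subspace of `L²(P)`,
where orthogonality is independence and laws are determined by variances. The Itô isometry for step
functions gives the covariance of `W_A`, and with it the joint law of the past and the next
increment (`map_prodMk_increment`). `gaussPairing_ae_eq` and `pairing_ae_eq` identify the limit in
probability with a white noise on each fibre, `exists_transitionPairing` evaluates one conditional
expectation, and `integral_integrand` iterates it. -/

theorem isUnit_add_smul_id {R : H →L[ℝ] H} (hR : R.IsPositive) {ε : ℝ} (hε : 0 < ε) :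
    IsUnit (R + ε • ContinuousLinearMap.id ℝ H) := by
  refine ContinuousLinearMap.isUnit_of_forall_le_norm_inner_map _ (c := ⟨ε, hε.le⟩)
    (by exact_mod_cast hε) fun x => ?_
  have h1 : 0 ≤ inner ℝ (R x) x := hR.inner_nonneg_left x
  have h2 : inner ℝ ((R + ε • ContinuousLinearMap.id ℝ H) x) x
      = inner ℝ (R x) x + ε * ‖x‖ ^ 2 := by
    simp [inner_add_left, real_inner_smul_left]
  rw [h2, Real.norm_of_nonneg (by positivity)]
  change ‖x‖ ^ 2 * ε ≤ _
  linarith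

theorem apply_inverse_add {R : H →L[ℝ] H} (hR : R.IsPositive) {ε : ℝ} (hε : 0 < ε) (x : H) :
    R (Ring.inverse (R + ε • ContinuousLinearMap.id ℝ H) x)
      + ε • Ring.inverse (R + ε • ContinuousLinearMap.id ℝ H) x = x := by
  have h := Ring.mul_inverse_cancel _ (isUnit_add_smul_id hR hε)
  have h2 := congrArg (fun f : H →L[ℝ] H => f x) h
  simpa using h2

theorem inverse_apply_add {R : H →L[ℝ] H} (hR : R.IsPositive) {ε : ℝ} (hε : 0 < ε) (x : H) :
    Ring.inverse (R + ε • ContinuousLinearMap.id ℝ H) (R x + ε • x) = x := by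
  have h := Ring.inverse_mul_cancel _ (isUnit_add_smul_id hR hε)
  have h2 := congrArg (fun f : H →L[ℝ] H => f x) h
  simpa using h2

theorem inverse_inner_comm {R : H →L[ℝ] H} (hR : R.IsPositive) {ε : ℝ} (hε : 0 < ε) (x y : H) :
    inner ℝ (Ring.inverse (R + ε • ContinuousLinearMap.id ℝ H) x) y
      = inner ℝ x (Ring.inverse (R + ε • ContinuousLinearMap.id ℝ H) y) := by
  have h1 := apply_inverse_add hR hε x
  have h2 := apply_inverse_add hR hε y
  set u := Ring.inverse (R + ε • ContinuousLinearMap.id ℝ H) x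
  set v := Ring.inverse (R + ε • ContinuousLinearMap.id ℝ H) y
  rw [← h1, ← h2, inner_add_left, inner_add_right, hR.inner_left_eq_inner_right,
    real_inner_smul_left, real_inner_smul_right]

/-- With `u = (R + ε)⁻¹ x`, expanding `‖Ru + εu‖²` gives three nonnegative terms, so each summand of
`x = Ru + εu` has norm at most `‖x‖`. The companion bound `norm_apply_inverse_le` reads off the
other summand. -/
theorem norm_smul_inverse_le {R : H →L[ℝ] H} (hR : R.IsPositive) {ε : ℝ} (hε : 0 < ε) (x : H) :
    ‖ε • Ring.inverse (R + ε • ContinuousLinearMap.id ℝ H) x‖ ≤ ‖x‖ := by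
  have h1 := apply_inverse_add hR hε x
  set u := Ring.inverse (R + ε • ContinuousLinearMap.id ℝ H) x
  have h2 : 0 ≤ inner ℝ (R u) u := hR.inner_nonneg_left u
  have h3 : ‖x‖ ^ 2 = ‖R u‖ ^ 2 + 2 * (ε * inner ℝ (R u) u) + ‖ε • u‖ ^ 2 := by
    rw [← h1, norm_add_sq_real, real_inner_smul_right]
  have h4 : ‖ε • u‖ ^ 2 ≤ ‖x‖ ^ 2 := by
    have : 0 ≤ ε * inner ℝ (R u) u := by positivity
    nlinarith [sq_nonneg ‖R u‖]
  exact (pow_le_pow_iff_left₀ (norm_nonneg _) (norm_nonneg _) two_ne_zero).1 h4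

theorem norm_apply_inverse_le {R : H →L[ℝ] H} (hR : R.IsPositive) {ε : ℝ} (hε : 0 < ε) (x : H) :
    ‖R (Ring.inverse (R + ε • ContinuousLinearMap.id ℝ H) x)‖ ≤ ‖x‖ := by
  have h1 := apply_inverse_add hR hε x
  set u := Ring.inverse (R + ε • ContinuousLinearMap.id ℝ H) x
  have h2 : 0 ≤ inner ℝ (R u) u := hR.inner_nonneg_left u
  have h3 : ‖x‖ ^ 2 = ‖R u‖ ^ 2 + 2 * (ε * inner ℝ (R u) u) + ‖ε • u‖ ^ 2 := by
    rw [← h1, norm_add_sq_real, real_inner_smul_right]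
  have h4 : ‖R u‖ ^ 2 ≤ ‖x‖ ^ 2 := by
    have : 0 ≤ ε * inner ℝ (R u) u := by positivity
    nlinarith [sq_nonneg ‖ε • u‖]
  exact (pow_le_pow_iff_left₀ (norm_nonneg _) (norm_nonneg _) two_ne_zero).1 h4

theorem denseRange_of_isPositive {R : H →L[ℝ] H} (hR : R.IsPositive) (hinj : ∀ x, R x = 0 → x = 0) :
    DenseRange R := by
  have h : R.range.topologicalClosure = ⊤ := by
    rw [Submodule.topologicalClosure_eq_top_iff, Submodule.eq_bot_iff]
    intro x hx
    refine hinj x (ext_inner_left ℝ fun y => ?_)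
    rw [inner_zero_right, ← hR.inner_left_eq_inner_right]
    exact hx (R y) ⟨y, rfl⟩
  have h2 := (Submodule.dense_iff_topologicalClosure_eq_top).2 h
  exact h2

/-- The error is `-ε (R + ε)⁻¹ b`. For `b = R g` it is `O(ε)`; in general `b` is approximated by
such vectors, the range being dense, and `‖ε (R + ε)⁻¹‖ ≤ 1` controls the remainder uniformly in
`ε`. This convergence is what makes the regularised pairings converge. -/
theorem tendsto_apply_inverse {R : H →L[ℝ] H} (hR : R.IsPositive) (hinj : ∀ x, R x = 0 → x = 0)
    (b : H) :
    Tendsto (fun ε : ℝ => R (Ring.inverse (R + ε • ContinuousLinearMap.id ℝ H) b))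
      (𝓝[>] 0) (𝓝 b) := by
  rw [Metric.tendsto_nhds]
  intro η hη
  obtain ⟨g, hg⟩ := (denseRange_of_isPositive hR hinj).exists_dist_lt b (half_pos hη)
  have h1 : Tendsto (fun ε : ℝ => ε * (2 * ‖g‖)) (𝓝[>] 0) (𝓝 0) := by
    have : Tendsto (fun ε : ℝ => ε * (2 * ‖g‖)) (𝓝 0) (𝓝 (0 * (2 * ‖g‖))) :=
      (continuous_id.mul continuous_const).tendsto 0
    rw [zero_mul] at this
    exact this.mono_left nhdsWithin_le_nhds
  filter_upwards [h1.eventually (gt_mem_nhds (half_pos hη)), self_mem_nhdsWithin] with ε h2 h3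
  have hε : 0 < ε := h3
  set A := Ring.inverse (R + ε • ContinuousLinearMap.id ℝ H) with hA
  have e1 : R (A b) - b = -(ε • A (b - R g)) - ε • A (R g) := by
    have := apply_inverse_add hR hε b
    rw [← hA] at this
    rw [map_sub, smul_sub, ← sub_eq_zero]
    nth_rewrite 2 [← this]
    abel
  have e2 : A (R g) = g - ε • A g := by
    have := inverse_apply_add hR hε g
    rw [← hA, map_add, map_smul] at this
    rw [eq_sub_iff_add_eq, this]
  have e3 : ‖ε • A (R g)‖ ≤ ε * (2 * ‖g‖) := by
    rw [norm_smul, Real.norm_of_nonneg hε.le, e2]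
    refine mul_le_mul_of_nonneg_left ?_ hε.le
    have := norm_smul_inverse_le hR hε g
    rw [← hA] at this
    linarith [norm_sub_le g (ε • A g)]
  have e4 : ‖ε • A (b - R g)‖ < η / 2 := by
    refine (norm_smul_inverse_le hR hε _).trans_lt ?_
    rwa [← dist_eq_norm]
  rw [dist_eq_norm, e1]
  calc _ ≤ ‖-(ε • A (b - R g))‖ + ‖ε • A (R g)‖ := norm_sub_le _ _
    _ < η / 2 + η / 2 := by rw [norm_neg]; linarith
    _ = η := add_halves η

theorem opSqrt_apply_self {R : H →L[ℝ] H} (hR : R.IsPositive) (x : H) :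
    opSqrt R (opSqrt R x) = R x := by
  have := congrArg (fun f : H →L[ℝ] H => f x) (opSqrt_spec hR).2
  simpa using this

theorem inner_opSqrt {R : H →L[ℝ] H} (hR : R.IsPositive) (x y : H) :
    inner ℝ (opSqrt R x) (opSqrt R y) = inner ℝ (R x) y := by
  rw [← (opSqrt_spec hR).1.inner_left_eq_inner_right, opSqrt_apply_self hR]

theorem norm_opSqrt_sq {R : H →L[ℝ] H} (hR : R.IsPositive) (x : H) :
    ‖opSqrt R x‖ ^ 2 = inner ℝ (R x) x := by
  rw [← real_inner_self_eq_norm_sq, inner_opSqrt hR]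

/-- By duality: the vectors `S g` are dense, and testing `S⁻¹ T x` against `S g` gives `⟨T x, g⟩`.
-/
theorem norm_invComp_apply_le {S T : H →L[ℝ] H} (hS : S.IsPositive) (hinj : ∀ x, S x = 0 → x = 0)
    (h : range T ⊆ range S) {x : H} {c : ℝ} (hc0 : 0 ≤ c)
    (hc : ∀ g, inner ℝ (T x) g ≤ c * ‖S g‖) :
    ‖invComp S T x‖ ≤ c := by
  have h1 : ∀ z, inner ℝ (invComp S T x) z ≤ c * ‖z‖ := by
    intro z
    refine (denseRange_of_isPositive hS hinj).induction_on
      (p := fun z => inner ℝ (invComp S T x) z ≤ c * ‖z‖) z ?_ fun g => ?_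
    · exact isClosed_le (by fun_prop) (by fun_prop)
    · rw [← hS.inner_left_eq_inner_right]
      have := congrArg (fun f : H →L[ℝ] H => f x) (invComp_spec h).1
      rw [ContinuousLinearMap.comp_apply] at this
      rw [this]
      exact hc g
  have h2 := h1 (invComp S T x)
  rw [real_inner_self_eq_norm_sq, sq] at h2
  rcases (norm_nonneg (invComp S T x)).eq_or_lt with h3 | h3
  · rwa [← h3]
  · exact le_of_mul_le_mul_right h2 h3

/-! ### The covariance operators -/

variable {T : ℝ → H →L[ℝ] H}

theorem IsC0Semigroup.exists_norm_le (hT : IsC0Semigroup T) (t : ℝ) :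
    ∃ C, 0 ≤ C ∧ ∀ s, 0 ≤ s → s ≤ t → ‖T s‖ ≤ C := by
  obtain ⟨C, hC⟩ : ∃ C, ∀ s : Icc (0 : ℝ) t, ‖T s‖ ≤ C := by
    refine banach_steinhaus fun x => ?_
    obtain ⟨C, hC⟩ := (isCompact_Icc (a := (0 : ℝ)) (b := t)).exists_bound_of_continuousOn
      ((hT.strongly_continuous x).mono Icc_subset_Ici_self)
    exact ⟨C, fun s => hC s s.2⟩
  refine ⟨max C 0, le_max_right _ _, fun s h0 h1 => (hC ⟨s, h0, h1⟩).trans (le_max_left _ _)⟩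

theorem IsC0Semigroup.apply_add (hT : IsC0Semigroup T) {s t : ℝ} (hs : 0 ≤ s) (ht : 0 ≤ t) (x : H) :
    T (s + t) x = T s (T t x) := by
  rw [hT.map_add s t hs ht]; rfl

theorem IsC0Semigroup.adjoint_apply_add (hT : IsC0Semigroup T) {s t : ℝ} (hs : 0 ≤ s) (ht : 0 ≤ t)
    (x : H) : (T (s + t)).adjoint x = (T t).adjoint ((T s).adjoint x) := by
  rw [hT.map_add s t hs ht, ContinuousLinearMap.adjoint_comp]; rfl

variable [SecondCountableTopology H] {Q : H →L[ℝ] H}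

/-- The density `s ↦ ⟨√Q T_s^* x, √Q T_s^* y⟩` of the covariance `⟨Q_t x, y⟩`. -/
def covDensity (T : ℝ → H →L[ℝ] H) (Q : H →L[ℝ] H) (x y : H) (s : ℝ) : ℝ :=
  inner ℝ (opSqrt Q ((T s).adjoint x)) (opSqrt Q ((T s).adjoint y))

theorem covDensity_eq (hQ : Q.IsPositive) (x y : H) (s : ℝ) :
    covDensity T Q x y s = inner ℝ (T s (Q ((T s).adjoint x))) y := by
  rw [covDensity, inner_opSqrt hQ, ContinuousLinearMap.adjoint_inner_right]

theorem intervalIntegrable_covDensity (hT : IsC0Semigroup T) (hQ : Q.IsPositive) (x y : H) {t : ℝ}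
    (ht : 0 ≤ t) : IntervalIntegrable (covDensity T Q x y) volume 0 t := by
  obtain ⟨R, hR⟩ := exists_covOp hT Q ht
  have h := (hR x).1
  rw [intervalIntegrable_iff] at h ⊢
  refine (h.inner_const (𝕜 := ℝ) y).congr (Eventually.of_forall fun s => ?_)
  exact (covDensity_eq hQ x y s).symm

theorem inner_covOp (hT : IsC0Semigroup T) (hQ : Q.IsPositive) (x y : H) {t : ℝ} (ht : 0 ≤ t) :
    inner ℝ (covOp T Q t x) y = ∫ s in (0 : ℝ)..t, covDensity T Q x y s := by
  obtain ⟨R, hR⟩ := exists_covOp hT Q ht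
  have h := (hR x).1
  rw [covOp_apply hT Q ht, real_inner_comm, intervalIntegral.integral_of_le ht,
    intervalIntegral.integral_of_le ht]
  rw [intervalIntegrable_iff, uIoc_of_le ht] at h
  rw [← integral_inner h]
  refine integral_congr_ae (Eventually.of_forall fun s => ?_)
  rw [covDensity_eq hQ, real_inner_comm]

theorem covDensity_self_nonneg (x : H) (s : ℝ) : 0 ≤ covDensity T Q x x s :=
  real_inner_self_nonneg

theorem covOp_isPositive (hT : IsC0Semigroup T) (hQ : Q.IsPositive) {t : ℝ} (ht : 0 ≤ t) :
    (covOp T Q t).IsPositive := by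
  rw [ContinuousLinearMap.isPositive_iff']
  refine ⟨?_, fun x => ?_⟩
  · rw [ContinuousLinearMap.isSelfAdjoint_iff_isSymmetric]
    intro x y
    change inner ℝ (covOp T Q t x) y = inner ℝ x (covOp T Q t y)
    rw [real_inner_comm _ x, inner_covOp hT hQ _ _ ht, inner_covOp hT hQ _ _ ht]
    simp only [covDensity]
    congr 1; ext s; rw [real_inner_comm]
  · rw [inner_covOp hT hQ _ _ ht]
    exact intervalIntegral.integral_nonneg ht fun s _ => covDensity_self_nonneg x s

theorem covDensity_add (hT : IsC0Semigroup T) (x y : H) {s t : ℝ} (hs : 0 ≤ s) (ht : 0 ≤ t) :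
    covDensity T Q x y (s + t) = covDensity T Q ((T s).adjoint x) ((T s).adjoint y) t := by
  simp only [covDensity, hT.adjoint_apply_add hs ht]

/-- Split the time integral at `s` and shift the second piece with the semigroup law. This identity
yields both the monotonicity of `‖Λ‖` and the law of the increments. -/
theorem inner_covOp_add (hT : IsC0Semigroup T) (hQ : Q.IsPositive) (x y : H) {s t : ℝ}
    (hs : 0 ≤ s) (ht : 0 ≤ t) :
    inner ℝ (covOp T Q (s + t) x) y
      = inner ℝ (covOp T Q s x) y
        + inner ℝ (covOp T Q t ((T s).adjoint x)) ((T s).adjoint y) := by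
  rw [inner_covOp hT hQ _ _ hs, inner_covOp hT hQ _ _ ht, inner_covOp hT hQ _ _ (add_nonneg hs ht)]
  have h0 := intervalIntegrable_covDensity hT hQ x y (add_nonneg hs ht)
  have h1 := intervalIntegrable_covDensity hT hQ x y hs
  rw [← intervalIntegral.integral_add_adjacent_intervals h1 (h1.symm.trans h0)]
  congr 1
  have e := intervalIntegral.integral_comp_add_left (a := 0) (b := t) (covDensity T Q x y) s
  rw [add_zero] at e
  rw [← e]
  refine intervalIntegral.integral_congr fun u hu => ?_
  rw [uIcc_of_le ht] at hu
  exact covDensity_add hT x y hs hu.1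

/-- A vanishing integral of the nonnegative density forces `e^{sA*} x = 0` for almost every `s`,
because `Q` has trivial kernel. Letting such `s` tend to `0` gives `‖x‖² = 0`. -/
theorem covOp_injective (hT : IsC0Semigroup T) (hQ : Q.IsPositive)
    (hQker : LinearMap.ker Q.toLinearMap = ⊥) {t : ℝ} (ht : 0 < t) (x : H)
    (hx : covOp T Q t x = 0) : x = 0 := by
  have h1 := inner_covOp hT hQ x x ht.le
  rw [hx, inner_zero_left] at h1
  have h2 := intervalIntegrable_covDensity hT hQ x x ht.le
  rw [intervalIntegral.integral_of_le ht.le, eq_comm,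
    integral_eq_zero_iff_of_nonneg (fun s => covDensity_self_nonneg x s)
      ((intervalIntegrable_iff_integrableOn_Ioc_of_le ht.le).1 h2)] at h1
  have h3 : ∀ᵐ s ∂(volume.restrict (Ioc 0 t)), (T s).adjoint x = 0 := by
    filter_upwards [h1] with s hs
    have h4 : opSqrt Q ((T s).adjoint x) = 0 := inner_self_eq_zero.1 hs
    have h5 : Q ((T s).adjoint x) = 0 := by rw [← opSqrt_apply_self hQ, h4, map_zero]
    have h6 : (T s).adjoint x ∈ LinearMap.ker Q.toLinearMap := h5
    rw [hQker] at h6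
    exact h6
  -- Strong continuity is known for the semigroup and not for its adjoint, so the information is
  -- moved to `⟨x, e^{sA} x⟩`.
  have h4 : ∀ᵐ s ∂(volume.restrict (Ioc 0 t)), inner ℝ x (T s x) = 0 := by
    filter_upwards [h3] with s hs
    rw [← ContinuousLinearMap.adjoint_inner_left, hs, inner_zero_left]
  have h5 : ContinuousOn (fun s => inner ℝ x (T s x)) (Ici 0) :=
    continuousOn_const.inner (hT.strongly_continuous x)
  have h6 : Tendsto (fun s => inner ℝ x (T s x)) (𝓝[>] 0) (𝓝 (inner ℝ x (T 0 x))) :=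
    (h5 0 self_mem_Ici).mono_left (nhdsWithin_mono _ Ioi_subset_Ici_self)
  have h7 : ∃ᶠ s in 𝓝[>] (0 : ℝ), inner ℝ x (T s x) = 0 := by
    rw [Filter.frequently_iff]
    intro U hU
    obtain ⟨a, ha, haU⟩ := mem_nhdsGT_iff_exists_Ioo_subset.1 hU
    have ha' : (0 : ℝ) < a := ha
    by_contra hcon
    push Not at hcon
    have h8 : volume (Ioo 0 (min a t)) = 0 := by
      rw [ae_restrict_iff' measurableSet_Ioc] at h4
      refine measure_mono_null (fun s hs => ?_) (ae_iff.1 h4)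
      have h9 := hcon s (haU ⟨hs.1, hs.2.trans_le (min_le_left _ _)⟩)
      have h10 : s ∈ Ioc 0 t := ⟨hs.1, hs.2.le.trans (min_le_right _ _)⟩
      exact fun h => h9 (h h10)
    rw [Real.volume_Ioo, ENNReal.ofReal_eq_zero] at h8
    have := lt_min ha' ht
    linarith
  have h8 : inner ℝ x (T 0 x) = 0 := by
    by_contra hne
    exact h7 (h6.eventually_ne hne)
  rw [hT.map_zero] at h8
  exact inner_self_eq_zero.1 h8

theorem opSqrt_covOp_injective (hT : IsC0Semigroup T) (hQ : Q.IsPositive)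
    (hQker : LinearMap.ker Q.toLinearMap = ⊥) {t : ℝ} (ht : 0 < t) (x : H)
    (hx : opSqrt (covOp T Q t) x = 0) : x = 0 := by
  refine covOp_injective hT hQ hQker ht x ?_
  rw [← opSqrt_apply_self (covOp_isPositive hT hQ ht.le), hx, map_zero]

theorem opSqrt_Lam_apply {t : ℝ} (h : range (T t) ⊆ range (opSqrt (covOp T Q t))) (x : H) :
    opSqrt (covOp T Q t) (Lam T Q t x) = T t x := by
  have := congrArg (fun f : H →L[ℝ] H => f x) (invComp_spec h).1
  exact this

/-- For `u = s + t` one has `⟨e^{uA} x, g⟩ = ⟨Λ(t) x, Q_t^{1/2} e^{sA*} g⟩`, and `‖Q_t^{1/2} e^{sA*}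
g‖ ≤ ‖Q_u^{1/2} g‖` since `Q_u` dominates `e^{sA} Q_t e^{sA*}`. The monotonicity serves to make `t ↦
‖Λ(t)‖` measurable. -/
theorem antitoneOn_norm_Lam (hT : IsC0Semigroup T) (hQ : Q.IsPositive)
    (hQker : LinearMap.ker Q.toLinearMap = ⊥)
    (hrange : ∀ t : ℝ, 0 < t → range (T t) ⊆ range (opSqrt (covOp T Q t))) :
    AntitoneOn (fun t => ‖Lam T Q t‖) (Ioi 0) := by
  intro t ht u hu htu
  have ht : 0 < t := ht
  have hu : 0 < u := hu
  obtain ⟨s, rfl⟩ : ∃ s, u = s + t := ⟨u - t, by ring⟩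
  have hs : 0 ≤ s := by linarith
  refine ContinuousLinearMap.opNorm_le_bound _ (norm_nonneg _) fun x => ?_
  refine (norm_invComp_apply_le (opSqrt_spec (covOp_isPositive hT hQ hu.le)).1
    (opSqrt_covOp_injective hT hQ hQker hu) (hrange _ hu) (norm_nonneg (Lam T Q t x))
    fun g => ?_).trans ((Lam T Q t).le_opNorm x)
  rw [hT.apply_add hs ht.le, ← ContinuousLinearMap.adjoint_inner_right,
    ← opSqrt_Lam_apply (hrange t ht), (opSqrt_spec (covOp_isPositive hT hQ ht.le)).1.inner_left_eq_inner_right]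
  refine (real_inner_le_norm _ _).trans (mul_le_mul_of_nonneg_left ?_ (norm_nonneg _))
  rw [← pow_le_pow_iff_left₀ (norm_nonneg _) (norm_nonneg _) two_ne_zero,
    norm_opSqrt_sq (covOp_isPositive hT hQ ht.le), norm_opSqrt_sq (covOp_isPositive hT hQ hu.le),
    inner_covOp_add hT hQ _ _ hs ht.le]
  have := (covOp_isPositive hT hQ hs).inner_nonneg_left g
  linarith

end OperatorLemmas

section GaussianSpaces

variable {Ω : Type*} [MeasurableSpace Ω] {P : Measure Ω} [IsProbabilityMeasure P]

/-! ### Gaussian spaces -/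

/-- `G ≤ L²(P)` consists of centered Gaussian random variables. -/
def IsGaussianSpace (P : Measure Ω) (G : Submodule ℝ (Lp ℝ 2 P)) : Prop :=
  ∀ X ∈ G, ∫ ω, Complex.exp (X ω * Complex.I) ∂P = Complex.exp (-(‖X‖ ^ 2 / 2 : ℝ))

theorem real_inner_Lp_eq (X Y : Lp ℝ 2 P) : inner ℝ X Y = ∫ ω, X ω * Y ω ∂P := by
  rw [L2.inner_def]
  simp only [RCLike.inner_apply, conj_trivial, mul_comm]

theorem norm_sq_Lp_eq (X : Lp ℝ 2 P) : ‖X‖ ^ 2 = ∫ ω, X ω ^ 2 ∂P := by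
  rw [← real_inner_self_eq_norm_sq, real_inner_Lp_eq]
  simp only [sq]

theorem real_inner_toLp {f g : Ω → ℝ} (hf : MemLp f 2 P) (hg : MemLp g 2 P) :
    inner ℝ (hf.toLp f) (hg.toLp g) = ∫ ω, f ω * g ω ∂P := by
  rw [real_inner_Lp_eq]
  refine integral_congr_ae ?_
  filter_upwards [hf.coeFn_toLp, hg.coeFn_toLp] with ω h1 h2
  rw [h1, h2]

theorem integrable_Lp_two (X : Lp ℝ 2 P) : Integrable X P :=
  (Lp.memLp X).integrable one_le_two

theorem integral_abs_le_norm (X : Lp ℝ 2 P) : ∫ ω, |X ω| ∂P ≤ ‖X‖ := by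
  have h1 : ∫ ω, |X ω| ∂P = (eLpNorm X 1 P).toReal := by
    rw [eLpNorm_one_eq_lintegral_enorm, ← integral_norm_eq_lintegral_enorm (Lp.aestronglyMeasurable X)]
    rfl
  rw [h1, Lp.norm_def]
  exact ENNReal.toReal_mono (Lp.eLpNorm_ne_top X)
    (eLpNorm_le_eLpNorm_of_exponent_le one_le_two (Lp.aestronglyMeasurable X))

theorem norm_exp_sub_exp_le (a b : ℝ) :
    ‖Complex.exp (a * Complex.I) - Complex.exp (b * Complex.I)‖ ≤ |a - b| := by
  have h : Complex.exp (a * Complex.I) - Complex.exp (b * Complex.I)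
      = Complex.exp (Complex.I * b) * (Complex.exp (Complex.I * (a - b : ℝ)) - 1) := by
    rw [mul_sub, ← Complex.exp_add, mul_one]
    congr 2
    · push_cast; ring
    · ring
  rw [h, norm_mul, Complex.norm_exp_I_mul_ofReal, one_mul]
  exact Real.norm_exp_I_mul_ofReal_sub_one_le

theorem integrable_exp_mul_I {f : Ω → ℝ} (hf : AEStronglyMeasurable f P) :
    Integrable (fun ω => Complex.exp (f ω * Complex.I)) P := by
  refine Integrable.of_bound (C := 1) ?_ (Eventually.of_forall fun ω => ?_)
  · exact (Complex.continuous_exp.comp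
      ((Complex.continuous_ofReal).mul continuous_const)).comp_aestronglyMeasurable hf
  · rw [Complex.norm_exp_ofReal_mul_I]

/-- The map `a ↦ e^{ia}` is 1-Lipschitz and the `L²` norm dominates the `L¹` norm on a probability
space. Continuity makes the Gaussian condition closed, so it passes to closures of subspaces. -/
theorem continuous_integral_exp :
    Continuous fun X : Lp ℝ 2 P => ∫ ω, Complex.exp (X ω * Complex.I) ∂P := by
  refine LipschitzWith.continuous (K := 1) (LipschitzWith.of_dist_le_mul fun X Y => ?_)
  rw [dist_eq_norm, dist_eq_norm, NNReal.coe_one, one_mul,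
    ← integral_sub (integrable_exp_mul_I (Lp.aestronglyMeasurable X))
      (integrable_exp_mul_I (Lp.aestronglyMeasurable Y))]
  refine (norm_integral_le_integral_norm _).trans ((integral_mono_ae ?_ ?_ ?_).trans
    (integral_abs_le_norm (X - Y)))
  · exact ((integrable_exp_mul_I (Lp.aestronglyMeasurable X)).sub
      (integrable_exp_mul_I (Lp.aestronglyMeasurable Y))).norm
  · exact (integrable_Lp_two (X - Y)).abs
  · filter_upwards [Lp.coeFn_sub X Y] with ω h
    rw [h]
    exact norm_exp_sub_exp_le _ _

theorem IsGaussianSpace.topologicalClosure {G : Submodule ℝ (Lp ℝ 2 P)} (hG : IsGaussianSpace P G) :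
    IsGaussianSpace P G.topologicalClosure := by
  intro X hX
  have hcl : IsClosed {X : Lp ℝ 2 P |
      ∫ ω, Complex.exp (X ω * Complex.I) ∂P = Complex.exp (-(‖X‖ ^ 2 / 2 : ℝ))} :=
    isClosed_eq continuous_integral_exp (by fun_prop)
  exact closure_minimal (fun Y hY => hG Y hY) hcl hX

variable {G : Submodule ℝ (Lp ℝ 2 P)}

/-- The definition prescribes the characteristic function at frequency `1` only; stability of the
subspace under scaling recovers all frequencies. -/
theorem IsGaussianSpace.integral_exp_smul (hG : IsGaussianSpace P G) {X : Lp ℝ 2 P} (hX : X ∈ G)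
    (t : ℝ) : ∫ ω, Complex.exp ((t * X ω : ℝ) * Complex.I) ∂P
      = Complex.exp (-(t ^ 2 * ‖X‖ ^ 2 / 2 : ℝ)) := by
  have h := hG _ (G.smul_mem t hX)
  rw [norm_smul, mul_pow, Real.norm_eq_abs, sq_abs] at h
  rw [← h]
  refine integral_congr_ae ?_
  filter_upwards [Lp.coeFn_smul t X] with ω h1
  simp only [h1, Pi.smul_apply, smul_eq_mul]

theorem IsGaussianSpace.map_eq (hG : IsGaussianSpace P G) {X : Lp ℝ 2 P} (hX : X ∈ G) :
    P.map X = gaussianReal 0 (‖X‖₊ ^ 2) := by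
  have hm : AEMeasurable X P := (Lp.aestronglyMeasurable X).aemeasurable
  have := Measure.isProbabilityMeasure_map hm
  refine Measure.ext_of_charFun (funext fun t => ?_)
  rw [charFun_apply_real, integral_map hm (by fun_prop), charFun_gaussianReal]
  have h := hG.integral_exp_smul hX t
  push_cast at h ⊢
  rw [h]
  congr 1
  simp
  ring

/-- Orthogonality makes the squared norm of any linear combination of `X` and `Y` additive, so the
joint characteristic function factorises. -/
theorem IsGaussianSpace.indepFun (hG : IsGaussianSpace P G) {X Y : Lp ℝ 2 P} (hX : X ∈ G)
    (hY : Y ∈ G) (h : inner ℝ X Y = 0) : IndepFun X Y P := by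
  have hmX : AEMeasurable X P := (Lp.aestronglyMeasurable X).aemeasurable
  have hmY : AEMeasurable Y P := (Lp.aestronglyMeasurable Y).aemeasurable
  rw [indepFun_iff_charFun_prod hmX hmY]
  intro t
  rw [charFun_apply_real, charFun_apply_real, charFun_apply, integral_map (by fun_prop) (by fun_prop),
    integral_map hmX (by fun_prop), integral_map hmY (by fun_prop)]
  have h1 := hG.integral_exp_smul hX t.ofLp.1
  have h2 := hG.integral_exp_smul hY t.ofLp.2
  have h3 := hG _ (G.add_mem (G.smul_mem t.ofLp.1 hX) (G.smul_mem t.ofLp.2 hY))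
  rw [norm_add_sq_real, real_inner_smul_left, real_inner_smul_right, h, norm_smul, norm_smul,
    mul_pow, mul_pow, Real.norm_eq_abs, Real.norm_eq_abs, sq_abs, sq_abs] at h3
  push_cast at h1 h2
  rw [h1, h2, ← Complex.exp_add]
  have h4 : ∫ ω, Complex.exp (inner ℝ (WithLp.toLp 2 (X ω, Y ω)) t * Complex.I) ∂P
      = ∫ ω, Complex.exp ((t.ofLp.1 • X + t.ofLp.2 • Y : Lp ℝ 2 P) ω * Complex.I) ∂P := by
    refine integral_congr_ae ?_
    filter_upwards [Lp.coeFn_add (t.ofLp.1 • X) (t.ofLp.2 • Y), Lp.coeFn_smul t.ofLp.1 X,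
      Lp.coeFn_smul t.ofLp.2 Y] with ω e1 e2 e3
    rw [e1, Pi.add_apply, e2, e3]
    simp [WithLp.prod_inner_apply]
  rw [h4, h3]
  congr 1
  push_cast
  ring

theorem IsGaussianSpace.integral_cexp (hG : IsGaussianSpace P G) {X : Lp ℝ 2 P} (hX : X ∈ G)
    (z : ℂ) : ∫ ω, Complex.exp (z * X ω) ∂P = Complex.exp (‖X‖ ^ 2 * z ^ 2 / 2) := by
  have h := complexMGF_gaussianReal (hG.map_eq hX) z
  rw [complexMGF] at h
  rw [h]
  simp

/-- Write `X = X' + αY` with `X'` orthogonal to `Y`. Then `X'` and `Y` are independent and only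
one-dimensional Gaussian exponentials remain, one of them at the complex parameter `1 + αi`. -/
theorem IsGaussianSpace.integral_cexp_mul (hG : IsGaussianSpace P G) {X Y : Lp ℝ 2 P} (hX : X ∈ G)
    (hY : Y ∈ G) : ∫ ω, Complex.exp (X ω * Complex.I) * Complex.exp (Y ω) ∂P
      = Complex.exp (‖Y‖ ^ 2 / 2 - ‖X‖ ^ 2 / 2 + inner ℝ X Y * Complex.I) := by
  -- If `Y = 0` the quotient is `0` by convention, which is still a correct coefficient.
  set α : ℝ := inner ℝ X Y / ‖Y‖ ^ 2 with hα
  have hαY : α * ‖Y‖ ^ 2 = inner ℝ X Y := by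
    by_cases h0 : Y = 0
    · simp [h0]
    · rw [hα, div_mul_cancel₀]
      exact pow_ne_zero 2 (norm_ne_zero_iff.2 h0)
  set X' : Lp ℝ 2 P := X - α • Y with hX'
  have hX'G : X' ∈ G := G.sub_mem hX (G.smul_mem α hY)
  have horth : inner ℝ X' Y = 0 := by
    rw [hX', inner_sub_left, real_inner_smul_left, real_inner_self_eq_norm_sq, hαY, sub_self]
  have hind := hG.indepFun hX'G hY horth
  have hnorm : ‖X‖ ^ 2 = ‖X'‖ ^ 2 + α ^ 2 * ‖Y‖ ^ 2 := by
    have : X = X' + α • Y := by rw [hX', sub_add_cancel]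
    rw [this, norm_add_sq_real, real_inner_smul_right, horth, norm_smul, mul_pow, Real.norm_eq_abs,
      sq_abs]
    ring
  have h1 : ∫ ω, Complex.exp (X ω * Complex.I) * Complex.exp (Y ω) ∂P
      = ∫ ω, Complex.exp (Complex.I * X' ω) * Complex.exp ((1 + α * Complex.I) * Y ω) ∂P := by
    refine integral_congr_ae ?_
    filter_upwards [Lp.coeFn_sub X (α • Y), Lp.coeFn_smul α Y] with ω e1 e2
    rw [hX', e1, Pi.sub_apply, e2, Pi.smul_apply, smul_eq_mul, ← Complex.exp_add, ← Complex.exp_add]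
    congr 1
    push_cast
    ring
  have hmX : AEMeasurable X' P := (Lp.aestronglyMeasurable X').aemeasurable
  have hmY : AEMeasurable Y P := (Lp.aestronglyMeasurable Y).aemeasurable
  rw [h1, hind.integral_fun_comp_mul_comp (f := fun x : ℝ => Complex.exp (Complex.I * x))
    (g := fun x : ℝ => Complex.exp ((1 + α * Complex.I) * x)) hmX hmY (by fun_prop) (by fun_prop),
    hG.integral_cexp hX'G, hG.integral_cexp hY, ← Complex.exp_add]
  congr 1
  have e1 : (‖X‖ : ℂ) ^ 2 = (‖X'‖ : ℂ) ^ 2 + α ^ 2 * (‖Y‖ : ℂ) ^ 2 := by exact_mod_cast hnorm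
  have e2 : ((inner ℝ X Y : ℝ) : ℂ) = α * (‖Y‖ : ℂ) ^ 2 := by exact_mod_cast hαY.symm
  rw [e1, e2]
  have := Complex.I_sq
  linear_combination ((‖X'‖ : ℂ) ^ 2 / 2 + α ^ 2 * (‖Y‖ : ℂ) ^ 2 / 2) * this

/-! ### Exponentials of Gaussian variables -/

/-- The value `e^v - 1 - v` is `O(v²)`: in `L²` the normalised exponential agrees with `1 + x` up to
an error of order `v`, the square of the standard deviation. This is the second-order remainder
behind differentiability of the semigroup. -/
theorem integral_sq_exp_sub_gaussianReal (v : ℝ≥0) :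
    Integrable (fun x : ℝ => (Real.exp (x - v / 2) - 1 - x) ^ 2) (gaussianReal 0 v) ∧
    Integrable (fun x : ℝ => Real.exp (x - v / 2) ^ 2) (gaussianReal 0 v) ∧
    ∫ x, (Real.exp (x - v / 2) - 1 - x) ^ 2 ∂(gaussianReal 0 v) = Real.exp v - 1 - v := by
  have hexp : ∀ t : ℝ, ∫ x, Real.exp (t * x) ∂(gaussianReal 0 v) = Real.exp (v * t ^ 2 / 2) := by
    intro t
    have := congrFun (mgf_id_gaussianReal (μ := 0) (v := v)) t
    simpa [mgf] using this
  have hi : ∀ t : ℝ, Integrable (fun x : ℝ => Real.exp (t * x)) (gaussianReal 0 v) := fun t =>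
    integrable_exp_mul_gaussianReal t
  have hmem : ∀ t : ℝ, t ∈ interior (integrableExpSet id (gaussianReal 0 v)) := by
    intro t; rw [integrableExpSet_id_gaussianReal, interior_univ]; trivial
  -- The mixed moment is the derivative at `1` of the moment generating function.
  have hx : ∫ x, x * Real.exp x ∂(gaussianReal 0 v) = v * Real.exp (v / 2) := by
    have h1 := deriv_mgf (hmem 1)
    rw [mgf_id_gaussianReal] at h1
    simp only [id, one_mul, zero_mul, zero_add] at h1
    rw [← h1]
    have h2 : HasDerivAt (fun t : ℝ => Real.exp (v * t ^ 2 / 2)) (Real.exp (v * 1 ^ 2 / 2)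
        * (v * (2 * 1 ^ 1 * 1) / 2)) 1 := by
      refine HasDerivAt.exp ?_
      have := ((hasDerivAt_id (1 : ℝ)).pow 2).const_mul (v : ℝ) |>.div_const 2
      simpa using this
    rw [h2.deriv]
    simp
    ring
  have hxi : Integrable (fun x : ℝ => x * Real.exp x) (gaussianReal 0 v) := by
    have := integrable_pow_mul_exp_of_mem_interior_integrableExpSet (hmem 1) 1
    simpa using this
  have hid : Integrable (fun x : ℝ => x) (gaussianReal 0 v) :=
    (memLp_id_gaussianReal 1).integrable (by norm_num)
  have hsq : Integrable (fun x : ℝ => x ^ 2) (gaussianReal 0 v) :=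
    (memLp_id_gaussianReal 2).integrable_sq
  have hsqv : ∫ x, x ^ 2 ∂(gaussianReal 0 v) = v := by
    have h1 := variance_fun_id_gaussianReal (μ := 0) (v := v)
    rw [variance_eq_integral (by fun_prop)] at h1
    simpa using h1
  set c := Real.exp (-(v / 2 : ℝ)) with hc
  have e0 : ∀ x : ℝ, Real.exp (x - v / 2) = c * Real.exp x := fun x => by
    rw [hc, ← Real.exp_add]; congr 1; ring
  have e1 : (fun x : ℝ => (Real.exp (x - v / 2) - 1 - x) ^ 2) = fun x =>
      (c ^ 2 * Real.exp (2 * x) - 2 * c * Real.exp (1 * x) - 2 * c * (x * Real.exp x))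
        + (1 + 2 * x + x ^ 2) := by
    funext x
    rw [e0, two_mul x, Real.exp_add, one_mul]
    ring
  have i1 : Integrable (fun x : ℝ => c ^ 2 * Real.exp (2 * x) - 2 * c * Real.exp (1 * x)
      - 2 * c * (x * Real.exp x)) (gaussianReal 0 v) :=
    (((hi 2).const_mul _).sub ((hi 1).const_mul _)).sub (hxi.const_mul _)
  have i2 : Integrable (fun x : ℝ => 1 + 2 * x + x ^ 2) (gaussianReal 0 v) :=
    ((integrable_const 1).add (hid.const_mul 2)).add hsq
  refine ⟨?_, ?_, ?_⟩
  · rw [e1]; exact i1.add i2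
  · refine ((hi 2).const_mul (c ^ 2)).congr (Eventually.of_forall fun x => ?_)
    simp only [e0]
    rw [two_mul, Real.exp_add]
    ring
  · have j1 : Integrable (fun x : ℝ => c ^ 2 * Real.exp (2 * x)) (gaussianReal 0 v) :=
      (hi 2).const_mul _
    have j2 : Integrable (fun x : ℝ => 2 * c * Real.exp (1 * x)) (gaussianReal 0 v) :=
      (hi 1).const_mul _
    have j3 : Integrable (fun x : ℝ => c ^ 2 * Real.exp (2 * x) - 2 * c * Real.exp (1 * x))
      (gaussianReal 0 v) := j1.sub j2
    have j4 : Integrable (fun x : ℝ => 1 + 2 * x) (gaussianReal 0 v) :=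
      (integrable_const 1).add (hid.const_mul 2)
    rw [e1, integral_add i1 i2, integral_sub j3 (hxi.const_mul _), integral_sub j1 j2,
      integral_add j4 hsq, integral_add (integrable_const 1) (hid.const_mul 2)]
    have j5 : ∫ x : ℝ, 2 * x ∂(gaussianReal 0 v) = 0 := by
      rw [integral_const_mul, integral_id_gaussianReal, mul_zero]
    simp only [integral_const_mul, hexp, hx, hsqv, j5]
    simp only [integral_const, probReal_univ, one_smul]
    have f1 : c * Real.exp (v / 2) = 1 := by rw [hc, ← Real.exp_add]; simp
    have f2 : c ^ 2 * Real.exp (v * 2 ^ 2 / 2) = Real.exp v := by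
      rw [hc, ← Real.exp_nat_mul, ← Real.exp_add]; congr 1; push_cast; ring
    have f3 : (v : ℝ) * 1 ^ 2 / 2 = v / 2 := by ring
    rw [f2, f3]
    linear_combination (-2 - 2 * (v : ℝ)) * f1

/-- The density `exp (X - ‖X‖² / 2)` associated with a Gaussian variable `X`. -/
def gaussExp (X : Lp ℝ 2 P) (ω : Ω) : ℝ := Real.exp (X ω - ‖X‖ ^ 2 / 2)

theorem IsGaussianSpace.memLp_gaussExp (hG : IsGaussianSpace P G) {X : Lp ℝ 2 P} (hX : X ∈ G) :
    MemLp (gaussExp X) 2 P := by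
  have hm : AEMeasurable X P := (Lp.aestronglyMeasurable X).aemeasurable
  have hme : AEStronglyMeasurable (gaussExp X) P :=
    (Real.measurable_exp.comp_aemeasurable (hm.sub_const _)).aestronglyMeasurable
  rw [memLp_two_iff_integrable_sq hme]
  have h := (integral_sq_exp_sub_gaussianReal (‖X‖₊ ^ 2)).2.1
  rw [← hG.map_eq hX] at h
  have h2 := h.comp_aemeasurable hm
  simpa [Function.comp_def, gaussExp] using h2

theorem IsGaussianSpace.norm_gaussExp_sub (hG : IsGaussianSpace P G) {X : Lp ℝ 2 P} (hX : X ∈ G) :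
    ∫ ω, (gaussExp X ω - 1 - X ω) ^ 2 ∂P = Real.exp (‖X‖ ^ 2) - 1 - ‖X‖ ^ 2 := by
  have hm : AEMeasurable X P := (Lp.aestronglyMeasurable X).aemeasurable
  have h := (integral_sq_exp_sub_gaussianReal (‖X‖₊ ^ 2)).2.2
  rw [← hG.map_eq hX, integral_map hm (by fun_prop)] at h
  simpa [gaussExp] using h

end GaussianSpaces

section GaussianMeasures

variable {H : Type*} [NormedAddCommGroup H] [InnerProductSpace ℝ H] [CompleteSpace H]
  [SecondCountableTopology H] [MeasurableSpace H] [BorelSpace H]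

/-! ### Nondegenerate centered Gaussian measures on a Hilbert space -/

/-- `μ` is the centered Gaussian measure with injective covariance operator `R`. -/
structure IsCenteredGaussian (μ : Measure H) (R : H →L[ℝ] H) : Prop where
  isPositive : R.IsPositive
  injective : ∀ x, R x = 0 → x = 0
  memLp : MemLp id 2 μ
  integral_sq : ∀ c, ∫ y, inner ℝ c y ^ 2 ∂μ = inner ℝ (R c) c
  integral_exp : ∀ c, ∫ y, Complex.exp ((inner ℝ c y : ℝ) * Complex.I) ∂μ
    = Complex.exp (-(inner ℝ (R c) c / 2 : ℝ))

namespace IsCenteredGaussian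

variable {μ : Measure H} [IsProbabilityMeasure μ] {R : H →L[ℝ] H}

theorem memLp_inner (hμ : IsCenteredGaussian μ R) (c : H) : MemLp (fun y => inner ℝ c y) 2 μ :=
  hμ.memLp.const_inner c

theorem norm_toLp_inner (hμ : IsCenteredGaussian μ R) (c : H) :
    ‖(hμ.memLp_inner c).toLp‖ = ‖opSqrt R c‖ := by
  have h : ‖(hμ.memLp_inner c).toLp‖ ^ 2 = ‖opSqrt R c‖ ^ 2 := by
    rw [norm_opSqrt_sq hμ.isPositive, ← real_inner_self_eq_norm_sq, real_inner_toLp,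
      ← hμ.integral_sq c]
    simp only [sq]
  exact (pow_left_inj₀ (norm_nonneg _) (norm_nonneg _) two_ne_zero).1 h

/-- The map `c ↦ ⟨c, ·⟩` from `H` to `L²(μ)`. -/
def linFun (hμ : IsCenteredGaussian μ R) : H →L[ℝ] Lp ℝ 2 μ :=
  LinearMap.mkContinuous
    { toFun := fun c => (hμ.memLp_inner c).toLp
      map_add' := fun c d => by
        rw [← MemLp.toLp_add]
        congr 1
        funext y
        simp [inner_add_left]
      map_smul' := fun a c => by
        rw [RingHom.id_apply, ← MemLp.toLp_const_smul]
        congr 1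
        funext y
        simp [real_inner_smul_left] }
    ‖opSqrt R‖ fun c => (hμ.norm_toLp_inner c).trans_le ((opSqrt R).le_opNorm c)

theorem coeFn_linFun (hμ : IsCenteredGaussian μ R) (c : H) :
    hμ.linFun c =ᵐ[μ] fun y => inner ℝ c y := (hμ.memLp_inner c).coeFn_toLp

theorem norm_linFun (hμ : IsCenteredGaussian μ R) (c : H) : ‖hμ.linFun c‖ = ‖opSqrt R c‖ :=
  hμ.norm_toLp_inner c

theorem inner_linFun (hμ : IsCenteredGaussian μ R) (c d : H) :
    inner ℝ (hμ.linFun c) (hμ.linFun d) = inner ℝ (opSqrt R c) (opSqrt R d) := by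
  rw [real_inner_eq_norm_add_mul_self_sub_norm_mul_self_sub_norm_mul_self_div_two,
    real_inner_eq_norm_add_mul_self_sub_norm_mul_self_sub_norm_mul_self_div_two,
    ← map_add, ← map_add, norm_linFun, norm_linFun, norm_linFun]

/-- The Gaussian space generated by the functionals `⟨c, ·⟩`. -/
def space (hμ : IsCenteredGaussian μ R) : Submodule ℝ (Lp ℝ 2 μ) :=
  hμ.linFun.range.topologicalClosure

theorem linFun_mem (hμ : IsCenteredGaussian μ R) (c : H) : hμ.linFun c ∈ hμ.space :=
  Submodule.le_topologicalClosure _ ⟨c, rfl⟩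

/-- The functional `y ↦ ⟨b, (R + ε)⁻¹ R^{1/2} y⟩`, as an element of `L²(μ)` depending on `b`. -/
def regFun (hμ : IsCenteredGaussian μ R) (ε : ℝ) : H →L[ℝ] Lp ℝ 2 μ :=
  hμ.linFun.comp ((opSqrt R).comp (Ring.inverse (R + ε • ContinuousLinearMap.id ℝ H)))

theorem norm_regFun (hμ : IsCenteredGaussian μ R) (ε : ℝ) (b : H) :
    ‖hμ.regFun ε b‖ = ‖R (Ring.inverse (R + ε • ContinuousLinearMap.id ℝ H) b)‖ := by
  change ‖hμ.linFun (opSqrt R _)‖ = _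
  rw [norm_linFun, opSqrt_apply_self hμ.isPositive]
  rfl

theorem coeFn_regFun (hμ : IsCenteredGaussian μ R) {ε : ℝ} (hε : 0 < ε) (b : H) :
    hμ.regFun ε b =ᵐ[μ] fun y => inner ℝ b
      (Ring.inverse (R + ε • ContinuousLinearMap.id ℝ H) (opSqrt R y)) := by
  filter_upwards [hμ.coeFn_linFun
    (opSqrt R (Ring.inverse (R + ε • ContinuousLinearMap.id ℝ H) b))] with y hy
  change hμ.linFun (opSqrt R _) y = _
  refine hy.trans ?_
  rw [(opSqrt_spec hμ.isPositive).1.inner_left_eq_inner_right, inverse_inner_comm hμ.isPositive hε]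

/-- Distances between the regularised functionals in `L²(μ)` equal distances between the vectors `R
(R + ε)⁻¹ b` in `H`, so the Cauchy property transfers from `tendsto_apply_inverse`. -/
theorem exists_tendsto_regFun (hμ : IsCenteredGaussian μ R) (b : H) :
    ∃ X, Tendsto (fun ε => hμ.regFun ε b) (𝓝[>] 0) (𝓝 X) := by
  refine cauchy_map_iff_exists_tendsto.1 ?_
  have hd : ∀ ε ε' : ℝ, dist (hμ.regFun ε b) (hμ.regFun ε' b)
      = dist (R (Ring.inverse (R + ε • ContinuousLinearMap.id ℝ H) b))
        (R (Ring.inverse (R + ε' • ContinuousLinearMap.id ℝ H) b)) := by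
    intro ε ε'
    have e : hμ.regFun ε b - hμ.regFun ε' b = hμ.linFun (opSqrt R
        (Ring.inverse (R + ε • ContinuousLinearMap.id ℝ H) b
          - Ring.inverse (R + ε' • ContinuousLinearMap.id ℝ H) b)) := by
      simp only [map_sub]; rfl
    rw [dist_eq_norm, e, norm_linFun, opSqrt_apply_self hμ.isPositive, map_sub, dist_eq_norm]
  have hc := (tendsto_apply_inverse hμ.isPositive hμ.injective b).cauchy_map
  rw [cauchy_map_iff, Metric.uniformity_eq_comap_nhds_zero, tendsto_comap_iff] at hc ⊢
  refine ⟨hc.1, ?_⟩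
  simpa only [Function.comp_def, hd] using hc.2

/-- The isometry `b ↦ ⟨b, R^{-1/2} ·⟩` from `H` to `L²(μ)`. -/
def whiteNoise (hμ : IsCenteredGaussian μ R) : H →L[ℝ] Lp ℝ 2 μ :=
  continuousLinearMapOfTendsto (l := 𝓝[>] (0 : ℝ)) hμ.regFun
    (f := fun b => (hμ.exists_tendsto_regFun b).choose)
    (tendsto_pi_nhds.2 fun b => (hμ.exists_tendsto_regFun b).choose_spec)

theorem tendsto_regFun (hμ : IsCenteredGaussian μ R) (b : H) :
    Tendsto (fun ε => hμ.regFun ε b) (𝓝[>] 0) (𝓝 (hμ.whiteNoise b)) :=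
  (hμ.exists_tendsto_regFun b).choose_spec

theorem whiteNoise_mem (hμ : IsCenteredGaussian μ R) (b : H) : hμ.whiteNoise b ∈ hμ.space :=
  (Submodule.isClosed_topologicalClosure _).mem_of_tendsto (hμ.tendsto_regFun b)
    (Eventually.of_forall fun _ => hμ.linFun_mem _)

theorem norm_whiteNoise (hμ : IsCenteredGaussian μ R) (b : H) : ‖hμ.whiteNoise b‖ = ‖b‖ := by
  refine tendsto_nhds_unique (hμ.tendsto_regFun b).norm ?_
  simp only [norm_regFun]
  exact (tendsto_apply_inverse hμ.isPositive hμ.injective b).norm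

/-- This is the cross term in the Cameron–Martin computation. For the regularised functional the
covariance is an explicit inner product in `H`, and both sides pass to the limit. -/
theorem inner_linFun_whiteNoise (hμ : IsCenteredGaussian μ R) (c b : H) :
    inner ℝ (hμ.linFun c) (hμ.whiteNoise b) = inner ℝ (opSqrt R c) b := by
  refine tendsto_nhds_unique (tendsto_const_nhds.inner (hμ.tendsto_regFun b)) ?_
  have : ∀ ε, inner ℝ (hμ.linFun c) (hμ.regFun ε b)
      = inner ℝ (opSqrt R c) (R (Ring.inverse (R + ε • ContinuousLinearMap.id ℝ H) b)) := by
    intro ε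
    refine (hμ.inner_linFun c _).trans ?_
    rw [← opSqrt_apply_self hμ.isPositive]
    rfl
  simp only [this]
  exact tendsto_const_nhds.inner (tendsto_apply_inverse hμ.isPositive hμ.injective b)

theorem isGaussianSpace (hμ : IsCenteredGaussian μ R) : IsGaussianSpace μ hμ.space := by
  refine IsGaussianSpace.topologicalClosure ?_
  rintro _ ⟨c, rfl⟩
  have h := hμ.norm_linFun c
  change ∫ ω, Complex.exp (hμ.linFun c ω * Complex.I) ∂μ = Complex.exp (-(‖hμ.linFun c‖ ^ 2 / 2 : ℝ))
  rw [h, norm_opSqrt_sq hμ.isPositive, ← hμ.integral_exp c]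
  refine integral_congr_ae ?_
  filter_upwards [hμ.coeFn_linFun c] with y hy
  rw [hy]

/-- The Cameron–Martin formula. -/
theorem map_add_eq_withDensity (hμ : IsCenteredGaussian μ R) (b : H) :
    μ.map (· + opSqrt R b)
      = μ.withDensity fun y => ENNReal.ofReal (gaussExp (hμ.whiteNoise b) y) := by
  have hmem := hμ.isGaussianSpace.memLp_gaussExp (hμ.whiteNoise_mem b)
  have hint : Integrable (gaussExp (hμ.whiteNoise b)) μ := hmem.integrable one_le_two
  have : IsFiniteMeasure (μ.withDensity fun y => ENNReal.ofReal (gaussExp (hμ.whiteNoise b) y)) :=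
    isFiniteMeasure_withDensity_ofReal hint.2
  -- Both measures are finite, so it suffices to compare characteristic functions.
  refine Measure.ext_of_charFun (funext fun t => ?_)
  rw [charFun_map_add_const, charFun_apply, charFun_apply,
    integral_withDensity_eq_integral_toReal_smul₀ hint.aemeasurable.ennreal_ofReal
      (Eventually.of_forall fun _ => ENNReal.ofReal_lt_top)]
  -- The formula is used with the linear functional `⟨t, ·⟩` in the exponent with `i` and the white
  -- noise in the real exponent. Its factor `exp(‖b‖²/2)` cancels the normalisation, and the
  -- covariance of the two is the phase `⟨R^{1/2} b, t⟩` of the translation.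
  have h1 := hμ.isGaussianSpace.integral_cexp_mul (hμ.linFun_mem t) (hμ.whiteNoise_mem b)
  have h2 : ∫ y, (ENNReal.ofReal (gaussExp (hμ.whiteNoise b) y)).toReal •
        Complex.exp (inner ℝ y t * Complex.I) ∂μ
      = ∫ y, Complex.exp (-(‖b‖ ^ 2 / 2 : ℝ)) * (Complex.exp (hμ.linFun t y * Complex.I)
          * Complex.exp (hμ.whiteNoise b y)) ∂μ := by
    refine integral_congr_ae ?_
    filter_upwards [hμ.coeFn_linFun t] with y hy
    have hpos : 0 ≤ gaussExp (hμ.whiteNoise b) y := (Real.exp_pos _).le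
    rw [hy, ENNReal.toReal_ofReal hpos, gaussExp, norm_whiteNoise, real_inner_comm, Complex.real_smul,
      Complex.ofReal_exp, ← Complex.exp_add, ← Complex.exp_add, ← Complex.exp_add]
    congr 1
    push_cast
    ring
  have h3 : ∫ y, Complex.exp (inner ℝ y t * Complex.I) ∂μ = Complex.exp (-(inner ℝ (R t) t / 2 : ℝ)) := by
    rw [← hμ.integral_exp t]
    simp only [real_inner_comm]
  rw [h2, integral_const_mul, h1, h3, inner_linFun_whiteNoise, norm_whiteNoise, norm_linFun,
    ← Complex.ofReal_pow ‖opSqrt R t‖, norm_opSqrt_sq hμ.isPositive, ← Complex.exp_add,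
    ← Complex.exp_add, (opSqrt_spec hμ.isPositive).1.inner_left_eq_inner_right, real_inner_comm (opSqrt R t) b]
  congr 1
  push_cast
  ring

theorem integral_add_opSqrt (hμ : IsCenteredGaussian μ R) {f : H → ℝ} (hf : Measurable f) (b : H) :
    ∫ y, f (y + opSqrt R b) ∂μ = ∫ y, f y * gaussExp (hμ.whiteNoise b) y ∂μ := by
  have hmem := hμ.isGaussianSpace.memLp_gaussExp (hμ.whiteNoise_mem b)
  have hint : Integrable (gaussExp (hμ.whiteNoise b)) μ := hmem.integrable one_le_two
  have h := integral_map (μ := μ) (φ := (· + opSqrt R b)) (by fun_prop) hf.aestronglyMeasurable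
  rw [← h, hμ.map_add_eq_withDensity b,
    integral_withDensity_eq_integral_toReal_smul₀ hint.aemeasurable.ennreal_ofReal
      (Eventually.of_forall fun _ => ENNReal.ofReal_lt_top)]
  refine integral_congr_ae (Eventually.of_forall fun y => ?_)
  have hpos : 0 ≤ gaussExp (hμ.whiteNoise b) y := (Real.exp_pos _).le
  simp only [ENNReal.toReal_ofReal hpos, smul_eq_mul, mul_comm]

theorem abs_integral_mul_le {X : H → ℝ} (hX : MemLp X 2 μ) {f : H → ℝ} {M c : ℝ}
    (hM0 : 0 ≤ M) (hc : 0 ≤ c) (hf : ∀ y, |f y| ≤ M) (h : ∫ y, X y ^ 2 ∂μ ≤ c ^ 2) :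
    |∫ y, f y * X y ∂μ| ≤ M * c := by
  have h1 : ‖hX.toLp X‖ ≤ c := by
    refine (pow_le_pow_iff_left₀ (norm_nonneg _) hc two_ne_zero).1 ?_
    rw [← real_inner_self_eq_norm_sq, real_inner_toLp]
    simpa only [← sq] using h
  have h2 := (integral_abs_le_norm (hX.toLp X)).trans h1
  have h3 : ∫ y, |hX.toLp X y| ∂μ = ∫ y, |X y| ∂μ := by
    refine integral_congr_ae ?_
    filter_upwards [hX.coeFn_toLp] with y hy
    rw [hy]
  rw [h3] at h2
  have h4 : |∫ y, f y * X y ∂μ| ≤ ∫ y, M * |X y| ∂μ := by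
    rw [← Real.norm_eq_abs]
    refine norm_integral_le_of_norm_le ((hX.integrable one_le_two).abs.const_mul M)
      (Eventually.of_forall fun y => ?_)
    rw [Real.norm_eq_abs, abs_mul]
    exact mul_le_mul_of_nonneg_right (hf y) (abs_nonneg _)
  rw [integral_const_mul] at h4
  exact h4.trans (mul_le_mul_of_nonneg_left h2 hM0)

variable {T L : H →L[ℝ] H} {f : H → ℝ} {M : ℝ}

/-- Translating the argument by `h` translates `μ` by `R^{1/2} L h`, and Cameron–Martin puts this
into the density. The density linearises in `L²(μ)` with error `O(‖L h‖²)`, so no regularity of `f`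
is needed: `f` enters through its bound `M` alone. The gradient bound holds because the white noise
of `L h` has `L²` norm `‖L h‖`. -/
theorem exists_hasFDerivAt (hμ : IsCenteredGaussian μ R) (hTL : ∀ h, opSqrt R (L h) = T h)
    (hf : Measurable f) (hM0 : 0 ≤ M) (hfM : ∀ y, |f y| ≤ M) (x : H) :
    ∃ D : H →L[ℝ] ℝ, HasFDerivAt (fun x => ∫ y, f (T x + y) ∂μ) D x ∧ ‖D‖ ≤ M * ‖L‖ ∧
      ∀ h, D h = ∫ y, f (T x + y) * hμ.whiteNoise (L h) y ∂μ := by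
  have hfm : Measurable fun y => f (T x + y) := hf.comp (by fun_prop)
  have hmem : MemLp (fun y => f (T x + y)) 2 μ :=
    MemLp.of_bound hfm.aestronglyMeasurable M (Eventually.of_forall fun y => hfM _)
  let D : H →L[ℝ] ℝ := (innerSL ℝ (hmem.toLp _)).comp (hμ.whiteNoise.comp L)
  have hD : ∀ h, D h = ∫ y, f (T x + y) * hμ.whiteNoise (L h) y ∂μ := fun h => by
    change inner ℝ (hmem.toLp _) (hμ.whiteNoise (L h)) = _
    rw [real_inner_Lp_eq]
    refine integral_congr_ae ?_
    filter_upwards [hmem.coeFn_toLp] with y hy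
    rw [hy]
  refine ⟨D, ?_, ?_, hD⟩
  · rw [hasFDerivAt_iff_isLittleO_nhds_zero]
    refine Asymptotics.IsBigO.trans_isLittleO (g := fun h : H => ‖h‖ ^ 2) ?_
      (Asymptotics.isLittleO_norm_pow_id one_lt_two)
    refine Asymptotics.IsBigO.of_bound (M * ‖L‖ ^ 2) ?_
    -- The inequality `|e^v - 1 - v| ≤ v²` used below with `v = ‖L h‖²` requires `|v| ≤ 1`.
    have hev : ∀ᶠ h in 𝓝 (0 : H), ‖L h‖ < 1 := by
      have : Tendsto (fun h => ‖L h‖) (𝓝 0) (𝓝 ‖L 0‖) := (L.continuous.norm).tendsto 0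
      rw [map_zero, norm_zero] at this
      exact this.eventually (gt_mem_nhds one_pos)
    filter_upwards [hev] with h hh
    set X := hμ.whiteNoise (L h) with hX
    have hXG := hμ.whiteNoise_mem (L h)
    have hE := hμ.isGaussianSpace.memLp_gaussExp hXG
    have h1 : ∫ y, f (T (x + h) + y) ∂μ = ∫ y, f (T x + y) * gaussExp X y ∂μ := by
      rw [← hμ.integral_add_opSqrt hfm, hTL, map_add]
      simp only [add_assoc, add_comm (T h)]
    have hmul : ∀ {Y : H → ℝ}, MemLp Y 2 μ → Integrable (fun y => f (T x + y) * Y y) μ := by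
      intro Y hY
      exact (hY.integrable one_le_two).bdd_mul hfm.aestronglyMeasurable
        (c := M) (Eventually.of_forall fun y => hfM _)
    have h2 : ∫ y, f (T (x + h) + y) ∂μ - ∫ y, f (T x + y) ∂μ - D h
        = ∫ y, f (T x + y) * (gaussExp X y - 1 - X y) ∂μ := by
      have i1 := hmul hE
      have i2 := hmul (memLp_const (μ := μ) (p := 2) (1 : ℝ))
      have i3 := hmul (Lp.memLp X)
      have e : ∀ y, f (T x + y) * (gaussExp X y - 1 - X y)
        = f (T x + y) * gaussExp X y - f (T x + y) * 1 - f (T x + y) * X y := fun y => by ring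
      simp only [e]
      have i12 : Integrable (fun y => f (T x + y) * gaussExp X y - f (T x + y) * 1) μ := i1.sub i2
      rw [integral_sub i12 i3, integral_sub i1 i2, h1, hD]
      simp only [mul_one, hX]
    rw [h2]
    have hb : 0 ≤ ‖L h‖ := norm_nonneg _
    have h3 : ∫ y, (gaussExp X y - 1 - X y) ^ 2 ∂μ ≤ (‖L h‖ ^ 2) ^ 2 := by
      rw [hμ.isGaussianSpace.norm_gaussExp_sub hXG, norm_whiteNoise]
      have h4 : |‖L h‖ ^ 2| ≤ 1 := by
        rw [abs_of_nonneg (sq_nonneg _)]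
        exact pow_le_one₀ hb hh.le
      exact (le_abs_self _).trans (Real.abs_exp_sub_one_sub_id_le h4)
    have h5 := abs_integral_mul_le ((hE.sub (memLp_const 1)).sub (Lp.memLp X)) hM0 (sq_nonneg _)
      (fun y => hfM (T x + y)) h3
    rw [Real.norm_eq_abs, norm_pow, norm_norm]
    refine h5.trans ?_
    rw [mul_assoc, ← mul_pow]
    exact mul_le_mul_of_nonneg_left (pow_le_pow_left₀ hb (L.le_opNorm h) 2) hM0
  · refine ContinuousLinearMap.opNorm_le_bound _ (by positivity) fun h => ?_
    rw [hD, Real.norm_eq_abs]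
    refine (abs_integral_mul_le (Lp.memLp (hμ.whiteNoise (L h))) hM0 (norm_nonneg (L h))
      (fun y => hfM (T x + y)) ?_).trans ?_
    · rw [← norm_sq_Lp_eq, norm_whiteNoise]
    · rw [mul_assoc]
      exact mul_le_mul_of_nonneg_left (L.le_opNorm h) hM0

theorem differentiable_integral (hμ : IsCenteredGaussian μ R) (hTL : ∀ h, opSqrt R (L h) = T h)
    (hf : Measurable f) (hM0 : 0 ≤ M) (hfM : ∀ y, |f y| ≤ M) :
    Differentiable ℝ fun x => ∫ y, f (T x + y) ∂μ := fun x =>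
  (hμ.exists_hasFDerivAt hTL hf hM0 hfM x).choose_spec.1.differentiableAt

theorem norm_fderiv_integral_le (hμ : IsCenteredGaussian μ R) (hTL : ∀ h, opSqrt R (L h) = T h)
    (hf : Measurable f) (hM0 : 0 ≤ M) (hfM : ∀ y, |f y| ≤ M) (x : H) :
    ‖fderiv ℝ (fun x => ∫ y, f (T x + y) ∂μ) x‖ ≤ M * ‖L‖ := by
  obtain ⟨D, h1, h2, -⟩ := hμ.exists_hasFDerivAt hTL hf hM0 hfM x
  rwa [h1.fderiv]

theorem fderiv_integral_apply (hμ : IsCenteredGaussian μ R) (hTL : ∀ h, opSqrt R (L h) = T h)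
    (hf : Measurable f) (hM0 : 0 ≤ M) (hfM : ∀ y, |f y| ≤ M) (x h : H) :
    fderiv ℝ (fun x => ∫ y, f (T x + y) ∂μ) x h
      = ∫ y, f (T x + y) * hμ.whiteNoise (L h) y ∂μ := by
  obtain ⟨D, h1, -, h3⟩ := hμ.exists_hasFDerivAt hTL hf hM0 hfM x
  rw [h1.fderiv, h3]

end IsCenteredGaussian

end GaussianMeasures

section Pairing

variable {H : Type*} [NormedAddCommGroup H] [InnerProductSpace ℝ H] [CompleteSpace H]
  [SecondCountableTopology H] [MeasurableSpace H] [BorelSpace H]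

namespace IsCenteredGaussian

variable {μ : Measure H} [IsProbabilityMeasure μ] {R : H →L[ℝ] H}
  {E : Type*} [MeasurableSpace E] {ρ : Measure E} [IsProbabilityMeasure ρ] {h : E → H} {c : ℝ}

/-! ### The pairing `⟨h, R^{-1/2} y⟩` on a product space -/

/-- The regularised pairing `⟨h(e), (R + ε)⁻¹ R^{1/2} y⟩`. -/
def regPairing (R : H →L[ℝ] H) (h : E → H) (ε : ℝ) (p : E × H) : ℝ :=
  inner ℝ (h p.1) (Ring.inverse (R + ε • ContinuousLinearMap.id ℝ H) (opSqrt R p.2))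

theorem measurable_regPairing (hh : Measurable h) (ε : ℝ) :
    Measurable (regPairing R h ε) := by
  unfold regPairing
  refine Measurable.inner (hh.comp measurable_fst) ?_
  fun_prop

theorem regPairing_eq (hμ : IsCenteredGaussian μ R) {ε : ℝ} (hε : 0 < ε) (e : E) (y : H) :
    regPairing R h ε (e, y) = inner ℝ
      (opSqrt R (Ring.inverse (R + ε • ContinuousLinearMap.id ℝ H) (h e))) y := by
  rw [(opSqrt_spec hμ.isPositive).1.inner_left_eq_inner_right, inverse_inner_comm hμ.isPositive hε]
  rfl

theorem integral_inner_opSqrt_sq (hμ : IsCenteredGaussian μ R) (z : H) :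
    ∫ y, inner ℝ (opSqrt R z) y ^ 2 ∂μ = ‖R z‖ ^ 2 := by
  rw [hμ.integral_sq, ← norm_opSqrt_sq hμ.isPositive, opSqrt_apply_self hμ.isPositive]

/-- With the first coordinate frozen at `e`, the variable is a Gaussian functional of variance `‖R
(z e)‖²`; Fubini integrates these variances. -/
theorem memLp_inner_opSqrt (hμ : IsCenteredGaussian μ R) {z : E → H} (hz : Measurable z)
    (hc : ∀ e, ‖R (z e)‖ ≤ c) :
    MemLp (fun p : E × H => inner ℝ (opSqrt R (z p.1)) p.2) 2 (ρ.prod μ) ∧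
    ∫ p, inner ℝ (opSqrt R (z p.1)) p.2 ^ 2 ∂(ρ.prod μ) = ∫ e, ‖R (z e)‖ ^ 2 ∂ρ := by
  have hm : Measurable fun p : E × H => (inner ℝ (opSqrt R (z p.1)) p.2 : ℝ) :=
    Measurable.inner ((opSqrt R).continuous.measurable.comp (hz.comp measurable_fst)) measurable_snd
  have hint : Integrable (fun p : E × H => (inner ℝ (opSqrt R (z p.1)) p.2 : ℝ) ^ 2) (ρ.prod μ) := by
    rw [integrable_prod_iff (hm.pow_const 2).aestronglyMeasurable]
    refine ⟨Eventually.of_forall fun e => ?_, ?_⟩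
    · have := (hμ.memLp_inner (opSqrt R (z e))).integrable_sq
      exact this
    simp only [norm_pow, Real.norm_eq_abs, sq_abs, hμ.integral_inner_opSqrt_sq]
    refine Integrable.of_bound (C := c ^ 2) ?_ (Eventually.of_forall fun e => ?_)
    · exact ((R.continuous.measurable.comp hz).norm.pow_const 2).aestronglyMeasurable
    · rw [Real.norm_of_nonneg (sq_nonneg _)]
      exact pow_le_pow_left₀ (norm_nonneg _) (hc e) 2
  refine ⟨(memLp_two_iff_integrable_sq hm.aestronglyMeasurable).2 hint, ?_⟩
  rw [integral_prod _ hint]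
  simp only [hμ.integral_inner_opSqrt_sq]

theorem memLp_regPairing (hμ : IsCenteredGaussian μ R) (hh : Measurable h) (hc : ∀ e, ‖h e‖ ≤ c)
    {ε : ℝ} (hε : 0 < ε) : MemLp (regPairing R h ε) 2 (ρ.prod μ) := by
  refine (hμ.memLp_inner_opSqrt (c := c)
    (z := fun e => Ring.inverse (R + ε • ContinuousLinearMap.id ℝ H) (h e)) (by fun_prop)
    fun e => (norm_apply_inverse_le hμ.isPositive hε _).trans (hc e)).1.congr_norm
    (measurable_regPairing hh ε).aestronglyMeasurable (Eventually.of_forall fun p => ?_)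
  rw [← hμ.regPairing_eq hε]

theorem tendsto_integral_norm_sub (hμ : IsCenteredGaussian μ R) (hh : Measurable h)
    (hc : ∀ e, ‖h e‖ ≤ c) :
    Tendsto (fun ε : ℝ => ∫ e,
      ‖R (Ring.inverse (R + ε • ContinuousLinearMap.id ℝ H) (h e)) - h e‖ ^ 2 ∂ρ)
      (𝓝[>] 0) (𝓝 0) := by
  have h0 : ∫ _ : E, (0 : ℝ) ∂ρ = 0 := by simp
  suffices hs : Tendsto (fun ε : ℝ => ∫ e,
      ‖R (Ring.inverse (R + ε • ContinuousLinearMap.id ℝ H) (h e)) - h e‖ ^ 2 ∂ρ)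
      (𝓝[>] 0) (𝓝 (∫ _ : E, (0 : ℝ) ∂ρ)) by rwa [h0] at hs
  refine tendsto_integral_filter_of_dominated_convergence (fun _ => (2 * c) ^ 2)
    (Eventually.of_forall fun ε => ?_) ?_ (integrable_const _) (Eventually.of_forall fun e => ?_)
  · have : Measurable fun e => R (Ring.inverse (R + ε • ContinuousLinearMap.id ℝ H) (h e)) - h e := by
      fun_prop
    exact (this.norm.pow_const 2).aestronglyMeasurable
  · filter_upwards [self_mem_nhdsWithin] with ε hε
    refine Eventually.of_forall fun e => ?_
    rw [Real.norm_of_nonneg (sq_nonneg _)]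
    refine pow_le_pow_left₀ (norm_nonneg _) ?_ 2
    refine (norm_sub_le _ _).trans ?_
    have := norm_apply_inverse_le hμ.isPositive hε (h e)
    linarith [hc e]
  · have := ((tendsto_apply_inverse hμ.isPositive hμ.injective (h e)).sub_const (h e)).norm.pow 2
    simpa using this

/-- The second moment of a difference of two regularised pairings is the `ρ`-integral of `‖R (A ε h)
- R (A ε' h)‖²`, with `A ε = (R + ε)⁻¹`. Each `R (A ε h)` tends to `h` in `L²(ρ)` by dominated
convergence, so the pairings are Cauchy in `L²(ρ ⊗ μ)`. -/
theorem exists_pairing (hμ : IsCenteredGaussian μ R) (hh : Measurable h) (hc : ∀ e, ‖h e‖ ≤ c)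
    (ρ : Measure E) [IsProbabilityMeasure ρ] :
    ∃ ψ : E × H → ℝ, Measurable ψ ∧ Tendsto
      (fun ε : ℝ => eLpNorm (regPairing R h ε - ψ) 2 (ρ.prod μ)) (𝓝[>] 0) (𝓝 0) := by
  classical
  set A : ℝ → H →L[ℝ] H := fun ε => Ring.inverse (R + ε • ContinuousLinearMap.id ℝ H) with hA
  let F : ℝ → Lp ℝ 2 (ρ.prod μ) := fun ε =>
    if hε : 0 < ε then (hμ.memLp_regPairing (ρ := ρ) hh hc hε).toLp _ else 0
  have hF : ∀ {ε} (hε : 0 < ε), F ε = (hμ.memLp_regPairing (ρ := ρ) hh hc hε).toLp _ :=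
    fun {ε} hε => dif_pos hε
  let g : ℝ → ℝ := fun ε => ∫ e, ‖R (A ε (h e)) - h e‖ ^ 2 ∂ρ
  have hgi : ∀ ε, 0 < ε → Integrable (fun e => ‖R (A ε (h e)) - h e‖ ^ 2) ρ := fun ε hε => by
    have hm : Measurable fun e => R (A ε (h e)) - h e := by fun_prop
    refine Integrable.of_bound (C := (2 * c) ^ 2) (hm.norm.pow_const 2).aestronglyMeasurable
      (Eventually.of_forall fun e => ?_)
    rw [Real.norm_of_nonneg (sq_nonneg _)]
    refine pow_le_pow_left₀ (norm_nonneg _) ?_ 2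
    refine (norm_sub_le _ _).trans ?_
    have := norm_apply_inverse_le hμ.isPositive hε (h e)
    linarith [hc e]
  have hdist : ∀ ε ε', 0 < ε → 0 < ε' → dist (F ε) (F ε') ^ 2 ≤ 2 * g ε + 2 * g ε' := by
    intro ε ε' hε hε'
    have hm : Measurable fun e => A ε (h e) - A ε' (h e) := by fun_prop
    obtain ⟨m1, m2⟩ := hμ.memLp_inner_opSqrt (ρ := ρ) (c := 2 * c) hm (fun e => by
      rw [map_sub]
      refine (norm_sub_le _ _).trans ?_
      have := norm_apply_inverse_le hμ.isPositive hε (h e)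
      have := norm_apply_inverse_le hμ.isPositive hε' (h e)
      linarith [hc e])
    have e1 : F ε - F ε' = m1.toLp _ := by
      rw [hF hε, hF hε', ← MemLp.toLp_sub]
      refine MemLp.toLp_congr _ _ (Eventually.of_forall fun p => ?_)
      rw [Pi.sub_apply, hμ.regPairing_eq hε, hμ.regPairing_eq hε', ← inner_sub_left, ← map_sub]
    rw [dist_eq_norm, e1, ← real_inner_self_eq_norm_sq, real_inner_toLp]
    simp only [← sq]
    rw [m2, ← integral_const_mul, ← integral_const_mul,
      ← integral_add ((hgi ε hε).const_mul 2) ((hgi ε' hε').const_mul 2)]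
    refine integral_mono_of_nonneg (Eventually.of_forall fun e => sq_nonneg _)
      (((hgi ε hε).const_mul 2).add ((hgi ε' hε').const_mul 2)) (Eventually.of_forall fun e => ?_)
    have e2 : R (A ε (h e) - A ε' (h e)) = (R (A ε (h e)) - h e) - (R (A ε' (h e)) - h e) := by
      rw [map_sub]; abel
    simp only [e2]
    have := norm_sub_le (R (A ε (h e)) - h e) (R (A ε' (h e)) - h e)
    have h1 := pow_le_pow_left₀ (norm_nonneg _) this 2
    nlinarith [sq_nonneg (‖R (A ε (h e)) - h e‖ - ‖R (A ε' (h e)) - h e‖)]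
  have hcauchy : Cauchy (map F (𝓝[>] 0)) := by
    rw [Metric.cauchy_iff]
    refine ⟨inferInstance, fun η hη => ?_⟩
    have hev : ∀ᶠ ε in 𝓝[>] (0 : ℝ), 0 < ε ∧ g ε < η ^ 2 / 4 := by
      refine Eventually.and self_mem_nhdsWithin ?_
      exact (hμ.tendsto_integral_norm_sub hh hc).eventually (gt_mem_nhds (by positivity))
    refine ⟨F '' {ε | 0 < ε ∧ g ε < η ^ 2 / 4}, image_mem_map hev, ?_⟩
    rintro _ ⟨ε, hε, rfl⟩ _ ⟨ε', hε', rfl⟩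
    have h1 := hdist ε ε' hε.1 hε'.1
    have h2 : dist (F ε) (F ε') ^ 2 < η ^ 2 := by linarith [hε.2, hε'.2]
    exact lt_of_pow_lt_pow_left₀ 2 hη.le h2
  obtain ⟨X, hX⟩ := cauchy_map_iff_exists_tendsto.1 hcauchy
  have hXm := (Lp.aestronglyMeasurable X).aemeasurable
  refine ⟨hXm.mk X, hXm.measurable_mk, ?_⟩
  rw [Lp.tendsto_Lp_iff_tendsto_eLpNorm'] at hX
  refine hX.congr' ?_
  filter_upwards [self_mem_nhdsWithin] with ε hε
  refine eLpNorm_congr_ae ?_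
  rw [hF hε]
  exact (MemLp.coeFn_toLp _).sub hXm.ae_eq_mk

/-- Almost everywhere convergence along a sequence on the product restricts to almost every fibre.
On a fibre the same sequence converges in `L²(μ)` to the white noise of the frozen vector, and a
further subsequence compares the two limits. -/
theorem pairing_ae_eq (hμ : IsCenteredGaussian μ R) (hh : Measurable h) {ψ : E × H → ℝ}
    (hψ : Measurable ψ)
    (hlim : Tendsto (fun ε : ℝ => eLpNorm (regPairing R h ε - ψ) 2 (ρ.prod μ)) (𝓝[>] 0) (𝓝 0)) :
    ∀ᵐ e ∂ρ, (fun y => ψ (e, y)) =ᵐ[μ] hμ.whiteNoise (h e) := by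
  have h1 : TendstoInMeasure (ρ.prod μ) (regPairing R h) (𝓝[>] 0) ψ :=
    tendstoInMeasure_of_tendsto_eLpNorm two_ne_zero
      (fun ε => (measurable_regPairing hh ε).aestronglyMeasurable) hψ.aestronglyMeasurable hlim
  obtain ⟨ns, hns, hae⟩ := h1.exists_seq_tendsto_ae'
  have hpos : ∀ᶠ k in atTop, 0 < ns k := hns.eventually self_mem_nhdsWithin
  filter_upwards [Measure.ae_ae_of_ae_prod hae] with e he
  have h2 : Tendsto (fun k => hμ.regFun (ns k) (h e)) atTop (𝓝 (hμ.whiteNoise (h e))) :=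
    (hμ.tendsto_regFun (h e)).comp hns
  obtain ⟨ms, hms, hae2⟩ := (tendstoInMeasure_of_tendsto_Lp h2).exists_seq_tendsto_ae
  have h3 : ∀ᵐ y ∂μ, ∀ k, 0 < ns k → hμ.regFun (ns k) (h e) y = regPairing R h (ns k) (e, y) := by
    rw [ae_all_iff]
    intro k
    by_cases hk : 0 < ns k
    · filter_upwards [hμ.coeFn_regFun hk (h e)] with y hy _
      exact hy
    · exact Eventually.of_forall fun y hy => absurd hy hk
  filter_upwards [he, hae2, h3] with y hy1 hy2 hy3
  refine tendsto_nhds_unique (hy1.comp hms.tendsto_atTop) (hy2.congr' ?_)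
  filter_upwards [hms.tendsto_atTop.eventually hpos] with k hk
  exact hy3 _ hk

/-- Independence of `h` and `y` enters only through the hypothesis that the joint law is a product.
It transports the `L²` limit to `Ω`, where almost sure uniqueness of limits in probability
identifies the chosen limit. -/
theorem gaussPairing_ae_eq (hh : Measurable h) {ψ : E × H → ℝ}
    (hψ : Measurable ψ) {Ω : Type*} [MeasurableSpace Ω] {P : Measure Ω} {p : Ω → E} {Y : Ω → H}
    (hp : AEMeasurable p P) (hY : AEMeasurable Y P)
    (hmap : P.map (fun ω => (p ω, Y ω)) = ρ.prod μ)
    (hlim : Tendsto (fun ε : ℝ => eLpNorm (regPairing R h ε - ψ) 2 (ρ.prod μ)) (𝓝[>] 0) (𝓝 0)) :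
    gaussPairing P R (fun ω => h (p ω)) Y =ᵐ[P] fun ω => ψ (p ω, Y ω) := by
  have hpY : AEMeasurable (fun ω => (p ω, Y ω)) P := hp.prodMk hY
  have hψa : AEMeasurable (fun ω => ψ (p ω, Y ω)) P := hψ.comp_aemeasurable hpY
  have hconv : TendstoInMeasure P
      (fun (ε : ℝ) ω => inner ℝ (h (p ω))
        (Ring.inverse (R + ε • ContinuousLinearMap.id ℝ H) (opSqrt R (Y ω))))
      (𝓝[>] 0) (fun ω => ψ (p ω, Y ω)) := by
    refine tendstoInMeasure_of_tendsto_eLpNorm two_ne_zero (fun ε =>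
      ((measurable_regPairing (R := R) hh ε).comp_aemeasurable hpY).aestronglyMeasurable)
      hψa.aestronglyMeasurable ?_
    refine hlim.congr fun ε => ?_
    rw [← hmap, eLpNorm_map_measure
      ((measurable_regPairing hh ε).sub hψ).aestronglyMeasurable hpY]
    rfl
  have hex : ∃ X : Ω → ℝ, AEMeasurable X P ∧ TendstoInMeasure P
      (fun (ε : ℝ) ω => inner ℝ (h (p ω))
        (Ring.inverse (R + ε • ContinuousLinearMap.id ℝ H) (opSqrt R (Y ω))))
      (𝓝[>] 0) X := ⟨_, hψa, hconv⟩
  rw [gaussPairing, dif_pos hex]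
  exact tendstoInMeasure_ae_unique hex.choose_spec.2 hconv

variable {φ : E → ℝ} {ψ : E × H → ℝ}

/-- Conditionally on `e` the pairing has second moment `‖h e‖² ≤ c²`, so multiplying a square
integrable function of the past by it preserves square integrability. This keeps products of any
number of pairings in `L²`. -/
theorem memLp_mul_pairing (hμ : IsCenteredGaussian μ R) (hh : Measurable h) (hc : ∀ e, ‖h e‖ ≤ c)
    (hψ : Measurable ψ) (hψe : ∀ᵐ e ∂ρ, (fun y => ψ (e, y)) =ᵐ[μ] hμ.whiteNoise (h e))
    (hφ : Measurable φ) (hφ2 : MemLp φ 2 ρ) :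
    MemLp (fun q : E × H => φ q.1 * ψ q) 2 (ρ.prod μ) := by
  have hm : Measurable fun q : E × H => φ q.1 * ψ q := (hφ.comp measurable_fst).mul hψ
  rw [memLp_two_iff_integrable_sq hm.aestronglyMeasurable,
    integrable_prod_iff (hm.pow_const 2).aestronglyMeasurable]
  constructor
  · filter_upwards [hψe] with e he
    have h1 : MemLp (fun y => ψ (e, y)) 2 μ := (Lp.memLp _).ae_eq he.symm
    exact (h1.const_mul (φ e)).integrable_sq
  · have h2 : (fun e => ∫ y, ‖(φ e * ψ (e, y)) ^ 2‖ ∂μ) =ᵐ[ρ] fun e => φ e ^ 2 * ‖h e‖ ^ 2 := by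
      filter_upwards [hψe] with e he
      rw [← hμ.norm_whiteNoise, norm_sq_Lp_eq, ← integral_const_mul]
      refine integral_congr_ae ?_
      filter_upwards [he] with y hy
      rw [Real.norm_of_nonneg (sq_nonneg _), mul_pow, hy]
    refine Integrable.congr ?_ h2.symm
    refine (hφ2.integrable_sq.mul_const (c ^ 2)).mono'
      ((hφ.pow_const 2).mul (hh.norm.pow_const 2)).aestronglyMeasurable
      (Eventually.of_forall fun e => ?_)
    rw [Real.norm_of_nonneg (by positivity)]
    exact mul_le_mul_of_nonneg_left (pow_le_pow_left₀ (norm_nonneg _) (hc e) 2) (sq_nonneg _)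

theorem integral_mul_pairing (hμ : IsCenteredGaussian μ R) (hh : Measurable h)
    (hc : ∀ e, ‖h e‖ ≤ c) (hψ : Measurable ψ)
    (hψe : ∀ᵐ e ∂ρ, (fun y => ψ (e, y)) =ᵐ[μ] hμ.whiteNoise (h e))
    (hφ : Measurable φ) (hφ2 : MemLp φ 2 ρ) {F : E × H → ℝ} (hF : Measurable F) {M : ℝ}
    (hM : ∀ q, |F q| ≤ M) :
    ∫ q, F q * (φ q.1 * ψ q) ∂(ρ.prod μ)
      = ∫ e, (∫ y, F (e, y) * hμ.whiteNoise (h e) y ∂μ) * φ e ∂ρ := by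
  have h1 := hμ.memLp_mul_pairing hh hc hψ hψe hφ hφ2
  have hint : Integrable (fun q => F q * (φ q.1 * ψ q)) (ρ.prod μ) :=
    (h1.integrable one_le_two).bdd_mul hF.aestronglyMeasurable (c := M) (Eventually.of_forall hM)
  rw [integral_prod _ hint]
  refine integral_congr_ae ?_
  filter_upwards [hψe] with e he
  rw [← integral_mul_const]
  refine integral_congr_ae ?_
  filter_upwards [he] with y hy
  have : ψ (e, y) = hμ.whiteNoise (h e) y := hy
  rw [this]
  ring

end IsCenteredGaussian

end Pairing

/-! ### Convolutions of functions with an integrable singularity at `0` -/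

section Singular

variable {δ : ℝ}

/-- `g` is measurable, nonnegative, and `O(t^{-δ})` on bounded intervals `(0, t₀]`. -/
structure IsSingular (δ : ℝ) (g : ℝ → ℝ) : Prop where
  measurable : Measurable g
  nonneg : ∀ t, 0 ≤ g t
  bound : ∀ t₀, 0 < t₀ → ∃ K, 0 ≤ K ∧ ∀ t, 0 < t → t ≤ t₀ → g t ≤ K * t ^ (-δ)

/-- The convolution `∫₀ᵗ f(t - s) g(s) ds`. -/
def causalConv (f g : ℝ → ℝ) (t : ℝ) : ℝ := ∫ s in Ioc 0 t, f (t - s) * g s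

theorem measurable_setIntegral_Ioc {α : Type*} [MeasurableSpace α] {F : α × ℝ → ℝ}
    (hF : Measurable F) {τ : α → ℝ} (hτ : Measurable τ) :
    Measurable fun a => ∫ s in Ioc 0 (τ a), F (a, s) := by
  have h1 : ∀ a, ∫ s in Ioc 0 (τ a), F (a, s)
      = ∫ s, indicator {q : α × ℝ | 0 < q.2 ∧ q.2 ≤ τ q.1} F (a, s) := by
    intro a
    rw [← integral_indicator measurableSet_Ioc]
    rfl
  simp only [h1]
  have hm : MeasurableSet {q : α × ℝ | 0 < q.2 ∧ q.2 ≤ τ q.1} :=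
    (measurableSet_lt measurable_const measurable_snd).inter
      (measurableSet_le measurable_snd (hτ.comp measurable_fst))
  exact ((hF.indicator hm).stronglyMeasurable.integral_prod_right').measurable

theorem measurable_causalConv {f g : ℝ → ℝ} (hf : Measurable f) (hg : Measurable g) :
    Measurable (causalConv f g) :=
  measurable_setIntegral_Ioc (F := fun q : ℝ × ℝ => f (q.1 - q.2) * g q.2)
    (by fun_prop) measurable_id

theorem setIntegral_Ioc_comp_sub (f : ℝ → ℝ) {t : ℝ} (ht : 0 ≤ t) :
    ∫ s in Ioc 0 t, f (t - s) = ∫ s in Ioc 0 t, f s := by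
  rw [← intervalIntegral.integral_of_le ht, ← intervalIntegral.integral_of_le ht,
    intervalIntegral.integral_comp_sub_left]
  simp

theorem integrableOn_comp_sub {f : ℝ → ℝ} {t : ℝ} (ht : 0 ≤ t) (hf : IntegrableOn f (Ioc 0 t)) :
    IntegrableOn (fun s => f (t - s)) (Ioc 0 t) := by
  rw [← intervalIntegrable_iff_integrableOn_Ioc_of_le ht] at hf ⊢
  have := (hf.comp_sub_left t).symm
  simpa using this

theorem integrableOn_rpow_neg (hδ : δ < 1) {t : ℝ} (ht : 0 ≤ t) :
    IntegrableOn (fun s : ℝ => s ^ (-δ)) (Ioc 0 t) := by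
  rw [← intervalIntegrable_iff_integrableOn_Ioc_of_le ht]
  exact intervalIntegral.intervalIntegrable_rpow' (by linarith)

theorem IsSingular.integrableOn (hδ : δ < 1) {g : ℝ → ℝ} (hg : IsSingular δ g) {t : ℝ}
    (ht : 0 < t) : IntegrableOn g (Ioc 0 t) := by
  obtain ⟨K, hK, hb⟩ := hg.bound t ht
  refine Integrable.mono' ((integrableOn_rpow_neg hδ ht.le).const_mul K)
    hg.measurable.aestronglyMeasurable ?_
  filter_upwards [ae_restrict_mem measurableSet_Ioc] with s hs
  rw [Real.norm_of_nonneg (hg.nonneg s)]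
  exact hb s hs.1 hs.2

/-- One of `s` and `t - s` is at least `t / 2`, so one of the two singular factors is at most
`(t/2)^{-δ}`. -/
theorem rpow_neg_mul_le (hδ0 : 0 < δ) {s t : ℝ} (hs : 0 < s) (hst : s < t) :
    (t - s) ^ (-δ) * s ^ (-δ) ≤ (t / 2) ^ (-δ) * ((t - s) ^ (-δ) + s ^ (-δ)) := by
  have ht2 : 0 < t / 2 := by linarith
  have hts : 0 < t - s := sub_pos.2 hst
  have p1 : 0 ≤ (t - s) ^ (-δ) := Real.rpow_nonneg hts.le _
  have p2 : 0 ≤ s ^ (-δ) := Real.rpow_nonneg hs.le _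
  have p3 : 0 ≤ (t / 2) ^ (-δ) := Real.rpow_nonneg ht2.le _
  rcases le_total (t / 2) s with h | h
  · have h1 : s ^ (-δ) ≤ (t / 2) ^ (-δ) := Real.rpow_le_rpow_of_nonpos ht2 h (by linarith)
    nlinarith
  · have h1 : (t - s) ^ (-δ) ≤ (t / 2) ^ (-δ) :=
      Real.rpow_le_rpow_of_nonpos ht2 (by linarith) (by linarith)
    nlinarith

/-- The convolution of two `t^{-δ}` singularities is of order `t^{1-2δ} = t^{1-δ} t^{-δ}`, and
`t^{1-δ}` is bounded on bounded intervals because `δ < 1`. The singularity thus does not get worse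
under iteration. -/
theorem IsSingular.integrableOn_mul (hδ0 : 0 < δ) (hδ : δ < 1) {f g : ℝ → ℝ} (hf : IsSingular δ f)
    (hg : IsSingular δ g) {t₀ : ℝ} (ht₀ : 0 < t₀) :
    ∃ K, 0 ≤ K ∧ ∀ t, 0 < t → t ≤ t₀ → IntegrableOn (fun s => f (t - s) * g s) (Ioc 0 t) ∧
      causalConv f g t ≤ K * t ^ (-δ) := by
  obtain ⟨Kf, hKf, hbf⟩ := hf.bound t₀ ht₀
  obtain ⟨Kg, hKg, hbg⟩ := hg.bound t₀ ht₀
  -- Here `2^δ` comes from `(t/2)^{-δ}`, `2/(1-δ)` from integrating both `s^{-δ}` and `(t-s)^{-δ}`,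
  -- and `t₀^{1-δ}` bounds the surplus power of `t`.
  refine ⟨Kf * Kg * (2 ^ δ * (2 / (1 - δ))) * t₀ ^ (1 - δ), ?_, fun t ht htt₀ => ?_⟩
  · have : 0 < 1 - δ := by linarith
    positivity
  have hi := integrableOn_rpow_neg hδ ht.le
  have hdom : IntegrableOn
      (fun s : ℝ => Kf * Kg * (t / 2) ^ (-δ) * ((t - s) ^ (-δ) + s ^ (-δ))) (Ioc 0 t) :=
    Integrable.const_mul ((integrableOn_comp_sub ht.le hi).add hi) _
  have hle : ∀ᵐ s ∂(volume.restrict (Ioc 0 t)), f (t - s) * g s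
      ≤ Kf * Kg * (t / 2) ^ (-δ) * ((t - s) ^ (-δ) + s ^ (-δ)) := by
    -- The bound on `f` holds at positive arguments, so the endpoint `s = t` has to be discarded.
    have hne : ∀ᵐ s ∂(volume.restrict (Ioc 0 t)), s ≠ t :=
      ae_restrict_of_ae (Measure.ae_ne volume t)
    filter_upwards [ae_restrict_mem measurableSet_Ioc, hne] with s hs hst
    have hst' : s < t := lt_of_le_of_ne hs.2 hst
    calc f (t - s) * g s ≤ (Kf * (t - s) ^ (-δ)) * (Kg * s ^ (-δ)) :=
          mul_le_mul (hbf _ (sub_pos.2 hst') (by linarith [hs.1])) (hbg s hs.1 (by linarith [hs.2]))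
            (hg.nonneg s) (mul_nonneg hKf (Real.rpow_nonneg (sub_pos.2 hst').le _))
      _ = Kf * Kg * ((t - s) ^ (-δ) * s ^ (-δ)) := by ring
      _ ≤ Kf * Kg * ((t / 2) ^ (-δ) * ((t - s) ^ (-δ) + s ^ (-δ))) :=
          mul_le_mul_of_nonneg_left (rpow_neg_mul_le hδ0 hs.1 hst') (mul_nonneg hKf hKg)
      _ = _ := by ring
  have hint : IntegrableOn (fun s => f (t - s) * g s) (Ioc 0 t) := by
    refine Integrable.mono' hdom
      ((hf.measurable.comp (by fun_prop)).mul hg.measurable).aestronglyMeasurable ?_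
    filter_upwards [hle] with s hs
    rwa [Real.norm_of_nonneg (mul_nonneg (hf.nonneg _) (hg.nonneg _))]
  refine ⟨hint, (integral_mono_ae hint hdom hle).trans ?_⟩
  rw [integral_const_mul, integral_add (integrableOn_comp_sub ht.le hi) hi,
    setIntegral_Ioc_comp_sub (fun s => s ^ (-δ)) ht.le, ← intervalIntegral.integral_of_le ht.le,
    integral_rpow (Or.inl (by linarith)), Real.zero_rpow (by linarith)]
  have e1 : (t / 2) ^ (-δ) = 2 ^ δ * t ^ (-δ) := by
    rw [Real.div_rpow ht.le (by norm_num), Real.rpow_neg (by norm_num : (0 : ℝ) ≤ 2), div_inv_eq_mul,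
      mul_comm]
  have e2 : t ^ (-δ + 1) ≤ t₀ ^ (1 - δ) := by
    rw [neg_add_eq_sub]
    exact Real.rpow_le_rpow ht.le htt₀ (by linarith)
  have e3 : Kf * Kg * (t / 2) ^ (-δ) * ((t ^ (-δ + 1) - 0) / (-δ + 1) + (t ^ (-δ + 1) - 0) / (-δ + 1))
      = Kf * Kg * (2 ^ δ * (2 / (1 - δ))) * t ^ (-δ + 1) * t ^ (-δ) := by
    rw [e1, neg_add_eq_sub]
    ring
  rw [e3]
  have : 0 < 1 - δ := by linarith
  have ht' : 0 ≤ t ^ (-δ) := Real.rpow_nonneg ht.le _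
  gcongr

theorem IsSingular.integrableOn_conv (hδ0 : 0 < δ) (hδ : δ < 1) {f g : ℝ → ℝ}
    (hf : IsSingular δ f) (hg : IsSingular δ g) {t : ℝ} (ht : 0 < t) :
    IntegrableOn (fun s => f (t - s) * g s) (Ioc 0 t) := by
  obtain ⟨K, -, h⟩ := hf.integrableOn_mul hδ0 hδ hg ht
  exact (h t ht le_rfl).1

theorem IsSingular.causalConv (hδ0 : 0 < δ) (hδ : δ < 1) {f g : ℝ → ℝ} (hf : IsSingular δ f)
    (hg : IsSingular δ g) : IsSingular δ (causalConv f g) where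
  measurable := measurable_causalConv hf.measurable hg.measurable
  nonneg t := integral_nonneg fun s => mul_nonneg (hf.nonneg _) (hg.nonneg _)
  bound t₀ ht₀ := by
    obtain ⟨K, hK, h⟩ := hf.integrableOn_mul hδ0 hδ hg ht₀
    exact ⟨K, hK, fun t ht htt => (h t ht htt).2⟩

theorem isSingular_one (hδ0 : 0 < δ) : IsSingular δ fun _ => 1 where
  measurable := measurable_const
  nonneg _ := zero_le_one
  bound t₀ ht₀ := by
    refine ⟨t₀ ^ δ, Real.rpow_nonneg ht₀.le _, fun t ht htt => ?_⟩
    rw [Real.rpow_neg ht.le, ← div_eq_mul_inv, le_div_iff₀ (Real.rpow_pos_of_pos ht _), one_mul]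
    exact Real.rpow_le_rpow ht.le htt hδ0.le

/-- The iterated convolutions `g ↦ f * (f * ⋯ (f * g))`. -/
def convPow (f g : ℝ → ℝ) : ℕ → ℝ → ℝ
  | 0 => g
  | n + 1 => causalConv f (convPow f g n)

theorem IsSingular.convPow (hδ0 : 0 < δ) (hδ : δ < 1) {f g : ℝ → ℝ} (hf : IsSingular δ f)
    (hg : IsSingular δ g) (n : ℕ) : IsSingular δ (convPow f g n) := by
  induction n with
  | zero => exact hg
  | succ n ih => exact hf.causalConv hδ0 hδ ih

end Singular

/-! ### Measurability of derivatives -/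

section WeakMeasurability

variable {H : Type*} [NormedAddCommGroup H] [InnerProductSpace ℝ H] [CompleteSpace H]
  [SecondCountableTopology H] {α : Type*} [MeasurableSpace α]

/-- Distinct basis vectors are at distance `√2`, so balls of radius `1/2` around them are disjoint,
and separability allows only countably many. -/
theorem countable_of_hilbertBasis {ι : Type*} (b : HilbertBasis ι ℝ H) : Countable ι := by
  have hd : (univ : Set ι).PairwiseDisjoint fun i => Metric.ball (b i) (1 / 2) := by
    intro i _ j _ hij
    refine Metric.ball_disjoint_ball ?_
    have h1 : dist (b i) (b j) ^ 2 = 2 := by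
      rw [dist_eq_norm, norm_sub_sq_real, b.orthonormal.1, b.orthonormal.1, b.orthonormal.2 hij]
      norm_num
    nlinarith [dist_nonneg (x := b i) (y := b j)]
  have := hd.countable_of_isOpen (fun i _ => Metric.isOpen_ball)
    fun i _ => ⟨b i, Metric.mem_ball_self (by norm_num)⟩
  exact countable_univ_iff.1 this

/-- Through the Riesz isomorphism a functional becomes a vector, which is the limit of its finite
expansions in a countable Hilbert basis; each coefficient is measurable. -/
theorem stronglyMeasurable_of_apply {g : α → H →L[ℝ] ℝ} (hg : ∀ h, Measurable fun a => g a h) :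
    StronglyMeasurable g := by
  obtain ⟨w, b, -⟩ := exists_hilbertBasis ℝ H
  have hw : Countable w := countable_of_hilbertBasis b
  have h1 : StronglyMeasurable fun a => (InnerProductSpace.toDual ℝ H).symm (g a) := by
    refine stronglyMeasurable_of_tendsto (atTop : Filter (Finset w))
      (f := fun F a => ∑ i ∈ F, b.repr ((InnerProductSpace.toDual ℝ H).symm (g a)) i • b i)
      (fun F => ?_) (tendsto_pi_nhds.2 fun a => b.hasSum_repr _)
    refine Finset.stronglyMeasurable_fun_sum F fun i _ => ?_
    simp only [HilbertBasis.repr_apply_apply, real_inner_comm (_ : H) (b i),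
      InnerProductSpace.toDual_symm_apply]
    exact (hg (b i)).stronglyMeasurable.smul_const (b i)
  have h2 := (InnerProductSpace.toDual ℝ H).continuous.comp_stronglyMeasurable h1
  simpa [Function.comp_def] using h2

variable [MeasurableSpace H] [BorelSpace H]

/-- On `S` the derivative in direction `v` is the limit of the quotients `k (F(x + v/k) - F(x))`,
which are jointly measurable. The indicator removes the parameters at which differentiability is not
known. -/
theorem measurable_indicator_fderiv {F : α → H → ℝ} (hF : Measurable (Function.uncurry F))
    {S : Set α} (hS : MeasurableSet S) (hd : ∀ a ∈ S, Differentiable ℝ (F a)) {v : α × H → H}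
    (hv : Measurable v) :
    Measurable ({q : α × H | q.1 ∈ S}.indicator fun q => fderiv ℝ (F q.1) q.2 (v q)) := by
  have hSm : MeasurableSet {q : α × H | q.1 ∈ S} := measurable_fst hS
  refine measurable_of_tendsto_metrizable
    (f := fun (k : ℕ) => {q : α × H | q.1 ∈ S}.indicator fun q =>
      (k : ℝ) • (F q.1 (q.2 + (k : ℝ)⁻¹ • v q) - F q.1 q.2)) (fun k => ?_) ?_
  · refine Measurable.indicator ?_ hSm
    have hw : Measurable fun q : α × H => q.2 + (k : ℝ)⁻¹ • v q :=
      measurable_snd.add (hv.const_smul ((k : ℝ)⁻¹))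
    have h1 : Measurable fun q : α × H => F q.1 (q.2 + (k : ℝ)⁻¹ • v q) :=
      hF.comp (measurable_fst.prodMk hw)
    have h2 : Measurable fun q : α × H => F q.1 (q.2 + (k : ℝ)⁻¹ • v q) - F q.1 q.2 := h1.sub hF
    exact h2.const_smul (k : ℝ)
  · refine tendsto_pi_nhds.2 fun q => ?_
    by_cases hq : q.1 ∈ S
    · have hq' : q ∈ {q : α × H | q.1 ∈ S} := hq
      simp only [indicator_of_mem hq']
      refine (hd q.1 hq q.2).hasFDerivAt.lim (v q) (c := fun k : ℕ => (k : ℝ)) ?_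
      simpa using tendsto_natCast_atTop_atTop
    · have hq' : q ∉ {q : α × H | q.1 ∈ S} := hq
      simp only [indicator_of_notMem hq']
      exact tendsto_const_nhds

end WeakMeasurability

section Series

variable {H : Type*} [NormedAddCommGroup H] [InnerProductSpace ℝ H] [CompleteSpace H]
  [SecondCountableTopology H] [MeasurableSpace H] [BorelSpace H]

/-! ### The perturbation series of a smoothing family of kernels -/

/-- The operator `f ↦ ∫ f dκ(t, ·)`. -/
def semi (κ : Kernel (ℝ × H) H) (t : ℝ) (f : H → ℝ) (x : H) : ℝ := ∫ y, f y ∂κ (t, x)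

open Classical in
/-- The function `⟨B, D S_t f⟩`, where `S_t f = semi κ t f`. -/
def gradB (κ : Kernel (ℝ × H) H) (B : H → H) (t : ℝ) (f : H → ℝ) (x : H) : ℝ :=
  if 0 < t then fderiv ℝ (semi κ t f) x (B x) else 0

/-- The series terms, defined by splitting off the last time:
`v^{n+1}(t; f) = ∫₀ᵗ v^n(s; ⟨B, D S_{t-s} f⟩) ds`. -/
def term (κ : Kernel (ℝ × H) H) (B : H → H) : ℕ → ℝ → (H → ℝ) → H → ℝ
  | 0, t, f, x => semi κ t f x
  | n + 1, t, f, x => ∫ s in Ioc 0 t, term κ B n s (gradB κ B (t - s) f) x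

/-- The kernels `κ` map bounded functions to differentiable functions, with gradient bound
`lam`. -/
structure IsSmoothing (κ : Kernel (ℝ × H) H) (δ : ℝ) (lam : ℝ → ℝ) : Prop where
  pos : 0 < δ
  lt_one : δ < 1
  isSingular : IsSingular δ lam
  differentiable : ∀ t, 0 < t → ∀ f : H → ℝ, Measurable f → ∀ M, 0 ≤ M → (∀ y, |f y| ≤ M) →
    Differentiable ℝ (semi κ t f)
  norm_fderiv_le : ∀ t, 0 < t → ∀ f : H → ℝ, Measurable f → ∀ M, 0 ≤ M → (∀ y, |f y| ≤ M) →
    ∀ x, ‖fderiv ℝ (semi κ t f) x‖ ≤ M * lam t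

variable {κ : Kernel (ℝ × H) H} [IsMarkovKernel κ] {δ : ℝ} {lam : ℝ → ℝ} {B : H → H} {b : ℝ}
  {α : Type*} [MeasurableSpace α]

theorem measurable_semi {f : α → H → ℝ} (hf : Measurable (Function.uncurry f)) :
    Measurable fun q : α × ℝ × H => semi κ q.2.1 (f q.1) q.2.2 := by
  have h := StronglyMeasurable.integral_kernel_prod_right (κ := κ.comap
    (Prod.snd : α × ℝ × H → ℝ × H) measurable_snd) (f := fun (q : α × ℝ × H) (y : H) => f q.1 y)
    (hf.comp ((measurable_fst.comp measurable_fst).prodMk measurable_snd)).stronglyMeasurable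
  exact h.measurable

theorem abs_semi_le {f : H → ℝ} {M : ℝ} (hf : ∀ y, |f y| ≤ M) (t : ℝ) (x : H) :
    |semi κ t f x| ≤ M := by
  have h := norm_integral_le_of_norm_le_const (μ := κ (t, x)) (f := f) (Eventually.of_forall hf)
  simpa [semi] using h

theorem IsSmoothing.measurable_gradB (hκ : IsSmoothing κ δ lam) (hB : Measurable B)
    {f : α → H → ℝ} (hf : Measurable (Function.uncurry f)) (hfb : ∀ a, ∃ M, ∀ y, |f a y| ≤ M) :
    Measurable fun q : α × ℝ × H => gradB κ B q.2.1 (f q.1) q.2.2 := by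
  have h1 := measurable_indicator_fderiv (α := α × ℝ) (F := fun c => semi κ c.2 (f c.1))
    ((measurable_semi hf (κ := κ)).comp (by fun_prop :
      Measurable fun q : (α × ℝ) × H => (q.1.1, q.1.2, q.2))) (S := {c | 0 < c.2})
    (measurableSet_lt measurable_const measurable_snd) (fun c hc => by
      obtain ⟨M, hM⟩ := hfb c.1
      exact hκ.differentiable c.2 hc (f c.1) (hf.comp measurable_prodMk_left) M
        ((abs_nonneg _).trans (hM 0)) hM) (v := fun q => B q.2) (hB.comp measurable_snd)
  have h2 := h1.comp (by fun_prop : Measurable fun q : α × ℝ × H => ((q.1, q.2.1), q.2.2))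
  convert h2 using 1
  funext q
  simp [gradB, indicator]

theorem IsSmoothing.abs_gradB_le (hκ : IsSmoothing κ δ lam) (hBb : ∀ x, ‖B x‖ ≤ b) {f : H → ℝ}
    (hf : Measurable f) {M : ℝ} (hM0 : 0 ≤ M) (hM : ∀ y, |f y| ≤ M) (t : ℝ) (x : H) :
    |gradB κ B t f x| ≤ M * lam t * b := by
  have hb : 0 ≤ b := (norm_nonneg _).trans (hBb x)
  have hl := hκ.isSingular.nonneg t
  rw [gradB]
  split_ifs with ht
  · refine ((fderiv ℝ (semi κ t f) x).le_opNorm (B x)).trans ?_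
    exact mul_le_mul (hκ.norm_fderiv_le t ht f hf M hM0 hM x) (hBb x) (norm_nonneg _)
      (mul_nonneg hM0 hl)
  · rw [abs_zero]; positivity

theorem IsSmoothing.measurable_gradB_apply (hκ : IsSmoothing κ δ lam) (hB : Measurable B)
    {f : H → ℝ} (hf : Measurable f) {M : ℝ} (hM : ∀ y, |f y| ≤ M) (t : ℝ) :
    Measurable (gradB κ B t f) := by
  have h := hκ.measurable_gradB hB (α := Unit) (f := fun _ => f) (hf.comp measurable_snd)
    (fun _ => ⟨M, hM⟩)
  exact h.comp (by fun_prop : Measurable fun x : H => ((), t, x))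

/-- The initial function depends on an arbitrary measurable parameter, since each step of the
induction adds the splitting time to the parameter space. No uniform bound in the parameter is
needed. -/
theorem IsSmoothing.measurable_term (hκ : IsSmoothing κ δ lam) (hB : Measurable B)
    (hBb : ∀ x, ‖B x‖ ≤ b) (n : ℕ) :
    ∀ {α : Type _} [MeasurableSpace α] {f : α → H → ℝ}, Measurable (Function.uncurry f) →
      (∀ a, ∃ M, ∀ y, |f a y| ≤ M) →
      Measurable fun q : α × ℝ × H => term κ B n q.2.1 (f q.1) q.2.2 := by
  induction n with
  | zero => intro α _ f hf _; exact measurable_semi hf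
  | succ n ih =>
    intro α _ f hf hfb
    have h1 : Measurable (Function.uncurry fun (a : α × ℝ) => gradB κ B a.2 (f a.1)) :=
      (hκ.measurable_gradB hB hf hfb).comp
        (by fun_prop : Measurable fun q : (α × ℝ) × H => (q.1.1, q.1.2, q.2))
    have h2 := ih h1 fun a => by
      obtain ⟨M, hM⟩ := hfb a.1
      have hfa : Measurable (f a.1) := hf.comp measurable_prodMk_left
      exact ⟨_, hκ.abs_gradB_le hBb hfa ((abs_nonneg _).trans (hM 0)) hM a.2⟩
    have h3 := h2.comp (by fun_prop : Measurable fun q : (α × ℝ × H) × ℝ =>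
      (((q.1.1, q.1.2.1 - q.2) : α × ℝ), q.2, q.1.2.2))
    exact measurable_setIntegral_Ioc h3 (measurable_fst.comp measurable_snd)

/-- Measurability in the splitting time of the integrand in the definition of `term`. -/
theorem IsSmoothing.measurable_term_gradB (hκ : IsSmoothing κ δ lam) (hB : Measurable B)
    (hBb : ∀ x, ‖B x‖ ≤ b) (n : ℕ) {f : H → ℝ} (hf : Measurable f) {M : ℝ} (hM : ∀ y, |f y| ≤ M) :
    Measurable fun q : ℝ × ℝ × H => term κ B n q.2.1 (gradB κ B q.1 f) q.2.2 := by
  refine hκ.measurable_term hB hBb n (α := ℝ) (f := fun q => gradB κ B q f) ?_ ?_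
  · have h := hκ.measurable_gradB hB (α := Unit) (f := fun _ => f) (hf.comp measurable_snd)
      (fun _ => ⟨M, hM⟩)
    exact h.comp (by fun_prop : Measurable fun q : ℝ × H => ((), q.1, q.2))
  · exact fun a => ⟨_, hκ.abs_gradB_le hBb hf ((abs_nonneg _).trans (hM 0)) hM a⟩

/-- The induction is applied to `⟨B, D S_{t-s} f⟩`, whose bound is `M lam(t-s) b`; the function and
its bound must therefore stay general. Each step adds one factor `b` and one convolution with `lam`.
-/
theorem IsSmoothing.abs_term_le (hκ : IsSmoothing κ δ lam) (hB : Measurable B)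
    (hBb : ∀ x, ‖B x‖ ≤ b) (n : ℕ) : ∀ {f : H → ℝ}, Measurable f → ∀ {M : ℝ}, 0 ≤ M →
    (∀ y, |f y| ≤ M) → ∀ {t : ℝ}, 0 < t → ∀ x,
    |term κ B n t f x| ≤ M * b ^ n * convPow lam (fun _ => 1) n t := by
  induction n with
  | zero =>
    intro f hf M hM0 hM t ht x
    simpa [term, convPow] using abs_semi_le (κ := κ) hM t x
  | succ n ih =>
    intro f hf M hM0 hM t ht x
    have hsing := hκ.isSingular.convPow hκ.pos hκ.lt_one (isSingular_one hκ.pos) n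
    have hi := hκ.isSingular.integrableOn_conv hκ.pos hκ.lt_one hsing ht
    rw [term, convPow, causalConv, ← integral_const_mul, ← Real.norm_eq_abs]
    refine norm_integral_le_of_norm_le (hi.const_mul _) ?_
    filter_upwards [ae_restrict_mem measurableSet_Ioc] with s hs
    have hl := hκ.isSingular.nonneg (t - s)
    have hb : 0 ≤ b := (norm_nonneg _).trans (hBb x)
    refine (ih (hκ.measurable_gradB_apply hB hf hM _) (by positivity)
      (hκ.abs_gradB_le hBb hf hM0 hM (t - s)) hs.1 x).trans (le_of_eq ?_)
    ring

/-- `term κ B n t f` is differentiable, with the gradient bound given by iterated convolutions. -/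
def TermSmooth (κ : Kernel (ℝ × H) H) (lam : ℝ → ℝ) (B : H → H) (b : ℝ) (n : ℕ) : Prop :=
  ∀ {f : H → ℝ}, Measurable f → ∀ {M : ℝ}, 0 ≤ M → (∀ y, |f y| ≤ M) → ∀ {t : ℝ}, 0 < t →
    Differentiable ℝ (term κ B n t f) ∧
      ∀ x, ‖fderiv ℝ (term κ B n t f) x‖ ≤ M * b ^ n * convPow lam lam n t

/-- Differentiation under the time integral. The gradients are dominated by `lam(t-s) convPow lam
lam n s`, independently of the space variable, and this is integrable on `(0, t]` despite the
singularities at both ends. -/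
theorem IsSmoothing.hasFDerivAt_term_succ (hκ : IsSmoothing κ δ lam) (hB : Measurable B)
    (hBb : ∀ x, ‖B x‖ ≤ b) (n : ℕ) (ih : TermSmooth κ lam B b n) {f : H → ℝ} (hf : Measurable f)
    {M : ℝ} (hM0 : 0 ≤ M) (hM : ∀ y, |f y| ≤ M) {t : ℝ} (ht : 0 < t) (x : H) :
    IntegrableOn (fun s => fderiv ℝ (term κ B n s (gradB κ B (t - s) f)) x) (Ioc 0 t) ∧
    HasFDerivAt (term κ B (n + 1) t f)
      (∫ s in Ioc 0 t, fderiv ℝ (term κ B n s (gradB κ B (t - s) f)) x) x ∧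
    ‖∫ s in Ioc 0 t, fderiv ℝ (term κ B n s (gradB κ B (t - s) f)) x‖
      ≤ M * b ^ (n + 1) * convPow lam lam (n + 1) t := by
  have hb : 0 ≤ b := (norm_nonneg _).trans (hBb 0)
  have hsing := hκ.isSingular.convPow hκ.pos hκ.lt_one hκ.isSingular n
  have hi := hκ.isSingular.integrableOn_conv hκ.pos hκ.lt_one hsing ht
  have hsing1 := hκ.isSingular.convPow hκ.pos hκ.lt_one (isSingular_one hκ.pos) n
  have hi1 := hκ.isSingular.integrableOn_conv hκ.pos hκ.lt_one hsing1 ht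
  have hgm := fun s : ℝ => hκ.measurable_gradB_apply hB hf hM s
  have hgb := fun s : ℝ => hκ.abs_gradB_le hBb hf hM0 hM s
  have hg0 : ∀ s : ℝ, 0 ≤ M * lam s * b := fun s =>
    mul_nonneg (mul_nonneg hM0 (hκ.isSingular.nonneg s)) hb
  have hmt := hκ.measurable_term_gradB hB hBb n hf hM
  have hbound : ∀ s ∈ Ioc 0 t, ∀ y, ‖fderiv ℝ (term κ B n s (gradB κ B (t - s) f)) y‖
      ≤ M * b ^ (n + 1) * (lam (t - s) * convPow lam lam n s) := fun s hs y => by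
    refine ((ih (hgm (t - s)) (hg0 _) (hgb (t - s)) hs.1).2 y).trans (le_of_eq ?_)
    ring
  have hmeas : AEStronglyMeasurable
      (fun s => fderiv ℝ (term κ B n s (gradB κ B (t - s) f)) x) (volume.restrict (Ioc 0 t)) := by
    -- Measurability in time of the operator-valued gradient is reduced to fixed directions and then
    -- to limits of difference quotients.
    have h1 : StronglyMeasurable (indicator (Ioc 0 t)
        fun s => fderiv ℝ (term κ B n s (gradB κ B (t - s) f)) x) := by
      refine stronglyMeasurable_of_apply fun h => ?_
      have h2 := measurable_indicator_fderiv (α := ℝ)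
        (F := fun s => term κ B n s (gradB κ B (t - s) f))
        (hmt.comp (by fun_prop : Measurable fun q : ℝ × H => (t - q.1, q.1, q.2)))
        (S := Ioc 0 t) measurableSet_Ioc
        (fun s hs => (ih (hgm (t - s)) (hg0 _) (hgb (t - s)) hs.1).1) (v := fun _ => h)
        measurable_const
      have h3 := h2.comp (by fun_prop : Measurable fun s : ℝ => (s, x))
      convert h3 using 1
      funext s
      by_cases hs : s ∈ Ioc 0 t
      · rw [indicator_of_mem hs, Function.comp_apply, indicator_of_mem (by exact hs)]
      · rw [indicator_of_notMem hs, Function.comp_apply, indicator_of_notMem (by exact hs)]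
        rfl
    refine h1.aestronglyMeasurable.congr ?_
    filter_upwards [ae_restrict_mem measurableSet_Ioc] with s hs
    rw [indicator_of_mem hs]
  have hint : IntegrableOn (fun s => fderiv ℝ (term κ B n s (gradB κ B (t - s) f)) x) (Ioc 0 t) := by
    refine Integrable.mono' (hi.const_mul (M * b ^ (n + 1))) hmeas ?_
    filter_upwards [ae_restrict_mem measurableSet_Ioc] with s hs using hbound s hs x
  refine ⟨hint, ?_, ?_⟩
  · refine hasFDerivAt_integral_of_dominated_of_fderiv_le (μ := volume.restrict (Ioc 0 t))
      (F := fun y s => term κ B n s (gradB κ B (t - s) f) y)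
      (F' := fun y s => fderiv ℝ (term κ B n s (gradB κ B (t - s) f)) y)
      (s := univ) (bound := fun s => M * b ^ (n + 1) * (lam (t - s) * convPow lam lam n s))
      univ_mem (Eventually.of_forall fun y => ?_) ?_ hmeas ?_ (hi.const_mul _) ?_
    · exact (hmt.comp (by fun_prop : Measurable fun s : ℝ => (t - s, s, y))).aestronglyMeasurable
    · refine Integrable.mono' (hi1.const_mul (M * b ^ (n + 1)))
        (hmt.comp (by fun_prop : Measurable fun s : ℝ => (t - s, s, x))).aestronglyMeasurable ?_
      filter_upwards [ae_restrict_mem measurableSet_Ioc] with s hs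
      refine (hκ.abs_term_le hB hBb n (hgm (t - s)) (hg0 _) (hgb (t - s)) hs.1 x).trans
        (le_of_eq ?_)
      ring
    · filter_upwards [ae_restrict_mem measurableSet_Ioc] with s hs y _ using hbound s hs y
    · filter_upwards [ae_restrict_mem measurableSet_Ioc] with s hs y _
      exact ((ih (hgm (t - s)) (hg0 _) (hgb (t - s)) hs.1).1 y).hasFDerivAt
  · rw [convPow, causalConv, ← integral_const_mul]
    refine norm_integral_le_of_norm_le (hi.const_mul _) ?_
    filter_upwards [ae_restrict_mem measurableSet_Ioc] with s hs using hbound s hs x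

theorem IsSmoothing.termSmooth (hκ : IsSmoothing κ δ lam) (hB : Measurable B)
    (hBb : ∀ x, ‖B x‖ ≤ b) (n : ℕ) : TermSmooth κ lam B b n := by
  induction n with
  | zero =>
    intro f hf M hM0 hM t ht
    refine ⟨hκ.differentiable t ht f hf M hM0 hM, fun x => ?_⟩
    have h := hκ.norm_fderiv_le t ht f hf M hM0 hM x
    rw [pow_zero, mul_one]
    exact h
  | succ n ih =>
    intro f hf M hM0 hM t ht
    have h := hκ.hasFDerivAt_term_succ hB hBb n ih hf hM0 hM ht
    refine ⟨fun x => (h x).2.1.differentiableAt, fun x => ?_⟩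
    rw [(h x).2.1.fderiv]
    exact (h x).2.2

end Series

/-- Both sides integrate `G` over the triangle `q, p > 0`, `q + p ≤ t`. For fixed `q` the bound
integrates in `p` to at most `g q` times the full integral of `h`, which gives integrability on the
product. -/
theorem setIntegral_triangle_swap {G : ℝ × ℝ → ℝ} (hG : Measurable G) {g h : ℝ → ℝ} {t : ℝ}
    (hg : IntegrableOn g (Ioc 0 t)) (hg0 : ∀ q, 0 ≤ g q) (hh : IntegrableOn h (Ioc 0 t))
    (hh0 : ∀ q, 0 ≤ h q) (hb : ∀ q p, |G (q, p)| ≤ g q * h (t - q - p)) :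
    ∫ q in Ioc 0 t, ∫ p in Ioc 0 (t - q), G (q, p)
      = ∫ p in Ioc 0 t, ∫ q in Ioc 0 (t - p), G (q, p) := by
  have hS : MeasurableSet {z : ℝ × ℝ | 0 < z.1 ∧ 0 < z.2 ∧ z.1 + z.2 ≤ t} :=
    (measurableSet_lt measurable_const measurable_fst).inter
      ((measurableSet_lt measurable_const measurable_snd).inter
        (measurableSet_le (measurable_fst.add measurable_snd) measurable_const))
  set S := {z : ℝ × ℝ | 0 < z.1 ∧ 0 < z.2 ∧ z.1 + z.2 ≤ t} with hSdef
  have hsec1 : ∀ q ∈ Ioc 0 t, ∀ p,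
      S.indicator G (q, p) = (Ioc 0 (t - q)).indicator (fun p => G (q, p)) p := fun q hq p => by
    have : (q, p) ∈ S ↔ p ∈ Ioc 0 (t - q) := by
      simp only [hSdef, mem_ofPred_eq, mem_Ioc, hq.1, true_and, le_sub_iff_add_le']
    by_cases h : p ∈ Ioc 0 (t - q)
    · rw [indicator_of_mem h, indicator_of_mem (this.2 h)]
    · rw [indicator_of_notMem h, indicator_of_notMem (mt this.1 h)]
  have hsec1' : ∀ q ∉ Ioc 0 t, ∀ p, S.indicator G (q, p) = 0 := fun q hq p => by
    refine indicator_of_notMem (fun hz => hq ⟨hz.1, ?_⟩) _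
    have h1 := hz.2.1
    have h2 := hz.2.2
    simp only at h1 h2
    linarith
  have hsec2 : ∀ p ∈ Ioc 0 t, ∀ q,
      S.indicator G (q, p) = (Ioc 0 (t - p)).indicator (fun q => G (q, p)) q := fun p hp q => by
    have : (q, p) ∈ S ↔ q ∈ Ioc 0 (t - p) := by
      simp only [hSdef, mem_ofPred_eq, mem_Ioc, hp.1, true_and, le_sub_iff_add_le]
    by_cases h : q ∈ Ioc 0 (t - p)
    · rw [indicator_of_mem h, indicator_of_mem (this.2 h)]
    · rw [indicator_of_notMem h, indicator_of_notMem (mt this.1 h)]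
  have hsec2' : ∀ p ∉ Ioc 0 t, ∀ q, S.indicator G (q, p) = 0 := fun p hp q => by
    refine indicator_of_notMem (fun hz => hp ⟨hz.2.1, ?_⟩) _
    have h1 := hz.1
    have h2 := hz.2.2
    simp only at h1 h2
    linarith
  have hGS : Measurable (S.indicator G) := hG.indicator hS
  have hhq : ∀ q ∈ Ioc 0 t, IntegrableOn (fun p => h (t - q - p)) (Ioc 0 (t - q)) := fun q hq =>
    integrableOn_comp_sub (sub_nonneg.2 hq.2)
      (hh.mono_set (Ioc_subset_Ioc_right (by linarith [hq.1])))
  have hint1 : ∀ q ∈ Ioc 0 t, IntegrableOn (fun p => G (q, p)) (Ioc 0 (t - q)) := fun q hq =>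
    Integrable.mono' ((hhq q hq).const_mul (g q))
      (hG.comp measurable_prodMk_left).aestronglyMeasurable
      (Eventually.of_forall fun p => hb q p)
  have hint : Integrable (S.indicator G) (volume.prod volume) := by
    rw [integrable_prod_iff hGS.aestronglyMeasurable]
    refine ⟨Eventually.of_forall fun q => ?_, ?_⟩
    · by_cases hq : q ∈ Ioc 0 t
      · simp only [hsec1 q hq]
        exact (integrable_indicator_iff measurableSet_Ioc).2 (hint1 q hq)
      · simp only [hsec1' q hq]
        exact integrable_zero _ _ _
    · refine Integrable.mono' ((integrable_indicator_iff measurableSet_Ioc).2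
        (hg.mul_const (∫ p in Ioc 0 t, h p)))
        (hGS.norm.stronglyMeasurable.integral_prod_right').aestronglyMeasurable
        (Eventually.of_forall fun q => ?_)
      rw [Real.norm_of_nonneg (integral_nonneg fun _ => norm_nonneg _)]
      by_cases hq : q ∈ Ioc 0 t
      · simp only [hsec1 q hq, indicator_of_mem hq, norm_indicator_eq_indicator_norm]
        rw [integral_indicator measurableSet_Ioc]
        calc ∫ p in Ioc 0 (t - q), ‖G (q, p)‖ ≤ ∫ p in Ioc 0 (t - q), g q * h (t - q - p) :=
              integral_mono (hint1 q hq).norm ((hhq q hq).const_mul _) fun p => hb q p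
          _ = g q * ∫ p in Ioc 0 (t - q), h p := by
              rw [integral_const_mul, setIntegral_Ioc_comp_sub h (sub_nonneg.2 hq.2)]
          _ ≤ _ := mul_le_mul_of_nonneg_left (setIntegral_mono_set hh
              (Eventually.of_forall hh0)
              (Ioc_subset_Ioc_right (by linarith [hq.1])).eventuallyLE) (hg0 q)
      · simp only [hsec1' q hq, indicator_of_notMem hq]
        simp
  have hswap := integral_integral_swap (f := fun q p => S.indicator G (q, p)) hint
  have e1 : ∫ q, ∫ p, S.indicator G (q, p) = ∫ q in Ioc 0 t, ∫ p in Ioc 0 (t - q), G (q, p) := by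
    rw [← integral_indicator measurableSet_Ioc]
    congr 1
    funext q
    by_cases hq : q ∈ Ioc 0 t
    · rw [indicator_of_mem hq, ← integral_indicator measurableSet_Ioc]
      simp only [hsec1 q hq]
    · rw [indicator_of_notMem hq]
      simp only [hsec1' q hq, integral_zero]
  have e2 : ∫ p, ∫ q, S.indicator G (q, p) = ∫ p in Ioc 0 t, ∫ q in Ioc 0 (t - p), G (q, p) := by
    rw [← integral_indicator measurableSet_Ioc]
    congr 1
    funext p
    by_cases hp : p ∈ Ioc 0 t
    · rw [indicator_of_mem hp, ← integral_indicator measurableSet_Ioc]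
      simp only [hsec2 p hp]
    · rw [indicator_of_notMem hp]
      simp only [hsec2' p hp, integral_zero]
  rw [← e1, ← e2, hswap]

/-! ### Splitting off the first time instead of the last -/

section Series

variable {H : Type*} [NormedAddCommGroup H] [InnerProductSpace ℝ H] [CompleteSpace H]
  [SecondCountableTopology H] [MeasurableSpace H] [BorelSpace H]
  {κ : Kernel (ℝ × H) H} [IsMarkovKernel κ] {δ : ℝ} {lam : ℝ → ℝ} {B : H → H} {b : ℝ}

theorem semi_integral {s : ℝ} {K : ℝ → H → ℝ} (hK : Measurable (Function.uncurry K)) {k : ℝ → ℝ}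
    (hk : IntegrableOn k (Ioc 0 s)) (hb : ∀ r y, |K r y| ≤ k r) (p : ℝ) (x : H) :
    semi κ p (fun y => ∫ r in Ioc 0 s, K r y) x = ∫ r in Ioc 0 s, semi κ p (K r) x := by
  refine integral_integral_swap (f := fun y r => K r y) ?_
  refine Integrable.mono' (hk.comp_snd (κ (p, x))) ?_ (Eventually.of_forall fun q => hb q.2 q.1)
  exact (hK.comp measurable_swap).aestronglyMeasurable

open Classical in
/-- The function `⟨B, D v^n(t; f)⟩`, where `v^n(t; f) = term κ B n t f`. -/
def gradTerm (κ : Kernel (ℝ × H) H) (B : H → H) (n : ℕ) (t : ℝ) (f : H → ℝ) (x : H) : ℝ :=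
  if 0 < t then fderiv ℝ (term κ B n t f) x (B x) else 0

theorem IsSmoothing.abs_gradTerm_le (hκ : IsSmoothing κ δ lam) (hB : Measurable B)
    (hBb : ∀ x, ‖B x‖ ≤ b) (n : ℕ) {f : H → ℝ}
    (hf : Measurable f) {M : ℝ} (hM0 : 0 ≤ M) (hM : ∀ y, |f y| ≤ M) (t : ℝ) (x : H) :
    |gradTerm κ B n t f x| ≤ M * b ^ (n + 1) * convPow lam lam n t := by
  have hb : 0 ≤ b := (norm_nonneg _).trans (hBb x)
  have hl := (hκ.isSingular.convPow hκ.pos hκ.lt_one hκ.isSingular n).nonneg t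
  rw [gradTerm]
  split_ifs with ht
  · refine ((fderiv ℝ (term κ B n t f) x).le_opNorm (B x)).trans ?_
    refine (mul_le_mul ((hκ.termSmooth hB hBb n hf hM0 hM ht).2 x) (hBb x) (norm_nonneg _)
      (by positivity)).trans (le_of_eq (by ring))
  · rw [abs_zero]; positivity

theorem IsSmoothing.measurable_gradTerm (hκ : IsSmoothing κ δ lam) (hB : Measurable B)
    (hBb : ∀ x, ‖B x‖ ≤ b) (n : ℕ) {α : Type*} [MeasurableSpace α] {f : α → H → ℝ}
    (hf : Measurable (Function.uncurry f)) (hfb : ∀ a, ∃ M, ∀ y, |f a y| ≤ M) :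
    Measurable fun q : α × ℝ × H => gradTerm κ B n q.2.1 (f q.1) q.2.2 := by
  have h1 := measurable_indicator_fderiv (α := α × ℝ) (F := fun c => term κ B n c.2 (f c.1))
    ((hκ.measurable_term hB hBb n hf hfb).comp (by fun_prop :
      Measurable fun q : (α × ℝ) × H => (q.1.1, q.1.2, q.2))) (S := {c | 0 < c.2})
    (measurableSet_lt measurable_const measurable_snd) (fun c hc => by
      obtain ⟨M, hM⟩ := hfb c.1
      exact (hκ.termSmooth hB hBb n (hf.comp measurable_prodMk_left)
        ((abs_nonneg _).trans (hM 0)) hM hc).1) (v := fun q => B q.2) (hB.comp measurable_snd)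
  have h2 := h1.comp (by fun_prop : Measurable fun q : α × ℝ × H => ((q.1, q.2.1), q.2.2))
  convert h2 using 1
  funext q
  simp [gradTerm, indicator]

theorem IsSmoothing.measurable_gradTerm_apply (hκ : IsSmoothing κ δ lam) (hB : Measurable B)
    (hBb : ∀ x, ‖B x‖ ≤ b) (n : ℕ) {f : H → ℝ} (hf : Measurable f) {M : ℝ} (hM : ∀ y, |f y| ≤ M) :
    Measurable fun q : ℝ × H => gradTerm κ B n q.1 f q.2 := by
  have h := hκ.measurable_gradTerm hB hBb n (α := Unit) (f := fun _ => f) (hf.comp measurable_snd)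
    (fun _ => ⟨M, hM⟩)
  exact h.comp (by fun_prop : Measurable fun q : ℝ × H => ((), q.1, q.2))

theorem IsSmoothing.measurable_gradTerm_gradB (hκ : IsSmoothing κ δ lam) (hB : Measurable B)
    (hBb : ∀ x, ‖B x‖ ≤ b) (n : ℕ) {f : H → ℝ} (hf : Measurable f) {M : ℝ} (hM : ∀ y, |f y| ≤ M) :
    Measurable fun q : ℝ × ℝ × H => gradTerm κ B n q.2.1 (gradB κ B q.1 f) q.2.2 := by
  refine hκ.measurable_gradTerm hB hBb n (f := fun q => gradB κ B q f) ?_ ?_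
  · have h := hκ.measurable_gradB hB (α := Unit) (f := fun _ => f) (hf.comp measurable_snd)
      (fun _ => ⟨M, hM⟩)
    exact h.comp (by fun_prop : Measurable fun q : ℝ × H => ((), q.1, q.2))
  · exact fun a => ⟨_, hκ.abs_gradB_le hBb hf ((abs_nonneg _).trans (hM 0)) hM a⟩

/-- Evaluating the Bochner integral of the gradients in direction `B y` shows that `⟨B, D v^n⟩`
obeys the same last-time recursion as the terms themselves. -/
theorem IsSmoothing.gradTerm_succ (hκ : IsSmoothing κ δ lam) (hB : Measurable B)
    (hBb : ∀ x, ‖B x‖ ≤ b) (n : ℕ) {f : H → ℝ} (hf : Measurable f) {M : ℝ} (hM : ∀ y, |f y| ≤ M)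
    {s : ℝ} (hs : 0 < s) (y : H) :
    gradTerm κ B (n + 1) s f y = ∫ r in Ioc 0 s, gradTerm κ B n r (gradB κ B (s - r) f) y := by
  obtain ⟨h1, h2, -⟩ := hκ.hasFDerivAt_term_succ hB hBb n (hκ.termSmooth hB hBb n) hf
    ((abs_nonneg _).trans (hM 0)) hM hs y
  rw [gradTerm, if_pos hs, h2.fderiv, ContinuousLinearMap.integral_apply h1]
  refine setIntegral_congr_fun measurableSet_Ioc fun r hr => ?_
  rw [gradTerm, if_pos hr.1]

theorem IsSmoothing.integrableOn_semi_gradTerm (hκ : IsSmoothing κ δ lam) (hB : Measurable B)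
    (hBb : ∀ x, ‖B x‖ ≤ b) (n : ℕ) {f : H → ℝ} (hf : Measurable f) {M : ℝ} (hM : ∀ y, |f y| ≤ M)
    {t : ℝ} (ht : 0 < t) (x : H) :
    IntegrableOn (fun s => semi κ (t - s) (gradTerm κ B n s f) x) (Ioc 0 t) := by
  have hM0 : 0 ≤ M := (abs_nonneg _).trans (hM 0)
  have hJ := hκ.isSingular.convPow hκ.pos hκ.lt_one hκ.isSingular n
  refine Integrable.mono' ((hJ.integrableOn hκ.lt_one ht).const_mul (M * b ^ (n + 1)))
    ?_ (Eventually.of_forall fun s =>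
      abs_semi_le (hκ.abs_gradTerm_le hB hBb n hf hM0 hM s) (t - s) x)
  have h := (measurable_semi (κ := κ) (f := fun s => gradTerm κ B n s f)
    (hκ.measurable_gradTerm_apply hB hBb n hf hM)).comp
    (by fun_prop : Measurable fun s : ℝ => (s, t - s, x))
  exact h.aestronglyMeasurable

/-- The series terms, computed by splitting off the first time. -/
theorem IsSmoothing.term_succ_eq (hκ : IsSmoothing κ δ lam) (hB : Measurable B)
    (hBb : ∀ x, ‖B x‖ ≤ b) (n : ℕ) : ∀ {f : H → ℝ}, Measurable f → ∀ {M : ℝ}, (∀ y, |f y| ≤ M) →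
    ∀ {t : ℝ}, 0 < t → ∀ x,
    term κ B (n + 1) t f x = ∫ s in Ioc 0 t, semi κ (t - s) (gradTerm κ B n s f) x := by
  induction n with
  | zero =>
    intro f hf M hM t ht x
    -- With one time only, the two ways of splitting differ by the reflection `s ↦ t - s`.
    exact (setIntegral_Ioc_comp_sub (fun s => semi κ (t - s) (gradTerm κ B 0 s f) x) ht.le).symm.trans
      (setIntegral_congr_fun measurableSet_Ioc fun s _ => by
        simp only [sub_sub_cancel]
        rfl) |>.symm
  | succ n ih =>
    intro f hf M hM t ht x
    have hM0 : 0 ≤ M := (abs_nonneg _).trans (hM 0)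
    have hb0 : 0 ≤ b := (norm_nonneg _).trans (hBb 0)
    have hJ := hκ.isSingular.convPow hκ.pos hκ.lt_one hκ.isSingular n
    have hgm := fun s : ℝ => hκ.measurable_gradB_apply hB hf hM s
    have hgb := fun s : ℝ => hκ.abs_gradB_le hBb hf hM0 hM s
    have hg0 : ∀ s : ℝ, 0 ≤ M * lam s * b := fun s =>
      mul_nonneg (mul_nonneg hM0 (hκ.isSingular.nonneg s)) hb0
    have hDm := hκ.measurable_gradTerm_gradB hB hBb n hf hM
    have hDb : ∀ q s y, |gradTerm κ B n s (gradB κ B q f) y|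
        ≤ M * b ^ (n + 2) * lam q * convPow lam lam n s := fun q s y =>
      (hκ.abs_gradTerm_le hB hBb n (hgm q) (hg0 q) (hgb q) s y).trans (le_of_eq (by ring))
    -- In these coordinates `p` is the duration before the first time and `q` the duration after the
    -- last one. The two splittings become the two orders of integration over the triangle.
    have hL : term κ B (n + 2) t f x = ∫ q in Ioc 0 t, ∫ p in Ioc 0 (t - q),
        semi κ p (gradTerm κ B n (t - q - p) (gradB κ B q f)) x := by
      rw [term, ← setIntegral_Ioc_comp_sub (fun s => term κ B (n + 1) s (gradB κ B (t - s) f) x)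
        ht.le]
      -- The endpoint `q = t` is dropped because the induction hypothesis requires `t - q > 0`.
      rw [integral_Ioc_eq_integral_Ioo, integral_Ioc_eq_integral_Ioo]
      refine setIntegral_congr_fun measurableSet_Ioo fun q hq => ?_
      have htq : 0 < t - q := sub_pos.2 hq.2
      simp only [sub_sub_cancel]
      rw [ih (hgm q) (hgb q) htq x, ← setIntegral_Ioc_comp_sub _ htq.le]
      simp only [sub_sub_cancel]
    have hR : ∫ s in Ioc 0 t, semi κ (t - s) (gradTerm κ B (n + 1) s f) x
        = ∫ p in Ioc 0 t, ∫ q in Ioc 0 (t - p),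
          semi κ p (gradTerm κ B n (t - q - p) (gradB κ B q f)) x := by
      rw [← setIntegral_Ioc_comp_sub _ ht.le, integral_Ioc_eq_integral_Ioo,
        integral_Ioc_eq_integral_Ioo]
      refine setIntegral_congr_fun measurableSet_Ioo fun p hp => ?_
      have htp : 0 < t - p := sub_pos.2 hp.2
      have e1 : gradTerm κ B (n + 1) (t - p) f
          = fun y => ∫ r in Ioc 0 (t - p), gradTerm κ B n r (gradB κ B (t - p - r) f) y :=
        funext fun y => hκ.gradTerm_succ hB hBb n hf hM htp y
      have hk : IntegrableOn (fun r => M * b ^ (n + 2) * lam (t - p - r) * convPow lam lam n r)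
          (Ioc 0 (t - p)) := by
        have := (hκ.isSingular.integrableOn_conv hκ.pos hκ.lt_one hJ htp).const_mul
          (M * b ^ (n + 2))
        simpa only [IntegrableOn, mul_assoc] using this
      have e2 := semi_integral (κ := κ)
        (K := fun r => gradTerm κ B n r (gradB κ B (t - p - r) f))
        (hDm.comp (by fun_prop : Measurable fun q : ℝ × H => (t - p - q.1, q.1, q.2)))
        hk (fun r y => hDb (t - p - r) r y) p x
      simp only [sub_sub_cancel]
      rw [e1]
      refine e2.trans ?_
      rw [← setIntegral_Ioc_comp_sub _ htp.le]
      refine setIntegral_congr_fun measurableSet_Ioc fun q _ => ?_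
      rw [sub_sub_cancel, sub_right_comm t p q]
    rw [hL, hR]
    refine setIntegral_triangle_swap
      (G := fun z => semi κ z.2 (gradTerm κ B n (t - z.1 - z.2) (gradB κ B z.1 f)) x)
      (g := fun q => M * b ^ (n + 2) * lam q) (h := convPow lam lam n) ?_
      ((hκ.isSingular.integrableOn hκ.lt_one ht).const_mul _)
      (fun q => mul_nonneg (by positivity) (hκ.isSingular.nonneg q))
      (hJ.integrableOn hκ.lt_one ht) hJ.nonneg
      (fun q p => abs_semi_le (fun y => hDb q (t - q - p) y) p x)
    have h := measurable_semi (κ := κ) (α := ℝ × ℝ)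
      (f := fun c => gradTerm κ B n c.2 (gradB κ B c.1 f))
      (hDm.comp (by fun_prop : Measurable fun q : (ℝ × ℝ) × H => (q.1.1, q.1.2, q.2)))
    exact h.comp (by fun_prop : Measurable fun z : ℝ × ℝ => ((z.1, t - z.1 - z.2), z.2, x))

end Series

/-! ### The iterates as partial sums of the series -/

section Iterates

variable {H : Type*} [NormedAddCommGroup H] [InnerProductSpace ℝ H] [CompleteSpace H]
  [SecondCountableTopology H] [MeasurableSpace H] [BorelSpace H]
  {κ : Kernel (ℝ × H) H} [IsMarkovKernel κ] {δ : ℝ} {lam : ℝ → ℝ} {B : H → H} {b : ℝ}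
  {Ω : Type*} [MeasurableSpace Ω] {P : Measure Ω} {T : ℝ → H →L[ℝ] H} {WA : ℝ → Ω → H}

/-- The recursion is affine in `D u^n`. On a sum of terms, splitting off the first time turns the
integral of `S_{t-s}⟨B, D v^k(s)⟩` into `v^{k+1}(t)`, while the free part `S_t u₀` is the zeroth
term. -/
theorem IsSmoothing.iterate_eq_sum (hκ : IsSmoothing κ δ lam) (hB : Measurable B)
    (hBb : ∀ x, ‖B x‖ ≤ b)
    (htr : ∀ t, 0 ≤ t → ∀ f : H → ℝ, Measurable f → ∀ x, transOp P T WA t f x = semi κ t f x)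
    {u₀ : H → ℝ} (hu : Measurable u₀) {M : ℝ} (hM : ∀ y, |u₀ y| ≤ M) (n : ℕ) :
    ∀ {t : ℝ}, 0 < t → ∀ x,
      iterate P T WA u₀ B n t x = ∑ k ∈ Finset.range (n + 1), term κ B k t u₀ x := by
  have hM0 : 0 ≤ M := (abs_nonneg _).trans (hM 0)
  induction n with
  | zero =>
    intro t ht x
    simpa [iterate, term] using htr t ht.le u₀ hu x
  | succ n ih =>
    intro t ht x
    have hgm : ∀ k s, Measurable (gradTerm κ B k s u₀) := fun k s =>
      (hκ.measurable_gradTerm_apply hB hBb k hu hM).comp measurable_prodMk_left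
    have e1 : ∀ s ∈ Ioc 0 t,
        transOp P T WA (t - s) (fun y => fderiv ℝ (iterate P T WA u₀ B n s) y (B y)) x
          = ∑ k ∈ Finset.range (n + 1), semi κ (t - s) (gradTerm κ B k s u₀) x := fun s hs => by
      have e2 : iterate P T WA u₀ B n s
          = fun y => ∑ k ∈ Finset.range (n + 1), term κ B k s u₀ y := funext fun y => ih hs.1 y
      have e3 : (fun y => fderiv ℝ (iterate P T WA u₀ B n s) y (B y))
          = fun y => ∑ k ∈ Finset.range (n + 1), gradTerm κ B k s u₀ y := by
        funext y
        rw [e2, fderiv_fun_sum fun k _ => (hκ.termSmooth hB hBb k hu hM0 hM hs.1).1 y, sum_apply]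
        refine Finset.sum_congr rfl fun k _ => ?_
        rw [gradTerm, if_pos hs.1]
      rw [e3, htr (t - s) (sub_nonneg.2 hs.2) _ (Finset.measurable_fun_sum _ fun k _ => hgm k s)]
      refine integral_finsetSum _ fun k _ => ?_
      exact Integrable.of_bound (hgm k s).aestronglyMeasurable _
        (Eventually.of_forall (hκ.abs_gradTerm_le hB hBb k hu hM0 hM s))
    rw [iterate, htr t ht.le u₀ hu, intervalIntegral.integral_of_le ht.le,
      setIntegral_congr_fun measurableSet_Ioc e1,
      integral_finsetSum _ fun k _ => hκ.integrableOn_semi_gradTerm hB hBb k hu hM ht x,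
      Finset.sum_range_succ' fun k => term κ B k t u₀ x, add_comm]
    refine congrArg (· + semi κ t u₀ x) (Finset.sum_congr rfl fun k _ => ?_)
    exact (hκ.term_succ_eq hB hBb k hu hM ht x).symm

theorem IsSmoothing.seriesTerm_eq_term (hκ : IsSmoothing κ δ lam) (hB : Measurable B)
    (hBb : ∀ x, ‖B x‖ ≤ b)
    (htr : ∀ t, 0 ≤ t → ∀ f : H → ℝ, Measurable f → ∀ x, transOp P T WA t f x = semi κ t f x)
    {u₀ : H → ℝ} (hu : Measurable u₀) {M : ℝ} (hM : ∀ y, |u₀ y| ≤ M) (n : ℕ)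
    {t : ℝ} (ht : 0 < t) : seriesTerm P T WA u₀ B n t = term κ B n t u₀ := by
  funext x
  cases n with
  | zero => exact htr t ht.le u₀ hu x
  | succ n =>
    rw [seriesTerm, hκ.iterate_eq_sum hB hBb htr hu hM _ ht,
      hκ.iterate_eq_sum hB hBb htr hu hM _ ht, Finset.sum_range_succ, add_sub_cancel_left]

end Iterates

/-! ### Iterated time integrals of products of gap functions -/

section IteratedIntegrals

theorem times_snoc {n : ℕ} (t s : ℝ) (r : Fin n → ℝ) :
    times t (Fin.snoc (α := fun _ => ℝ) r s) = Fin.snoc (α := fun _ => ℝ) (times s r) t := by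
  rw [times, times, ← Fin.cons_snoc_eq_snoc_cons]

theorem gap_snoc_last {n : ℕ} (t s : ℝ) (r : Fin n → ℝ) :
    gap t (Fin.snoc (α := fun _ => ℝ) r s) (Fin.last (n + 1)) = t - s := by
  have h : times s r (Fin.last (n + 1)) = s := by
    rw [times, ← Fin.succ_last, Fin.cons_succ, Fin.snoc_last]
  rw [gap, times_snoc, Fin.succ_last, Fin.snoc_last, Fin.snoc_castSucc, h]

theorem gap_snoc_castSucc {n : ℕ} (t s : ℝ) (r : Fin n → ℝ) (i : Fin (n + 1)) :
    gap t (Fin.snoc (α := fun _ => ℝ) r s) i.castSucc = gap s r i := by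
  rw [gap, gap, times_snoc, Fin.snoc_castSucc, Fin.succ_castSucc, Fin.snoc_castSucc]

theorem iteratedIntegral_const_mul (c : ℝ) (n : ℕ) : ∀ (t : ℝ) (F : (Fin n → ℝ) → ℝ),
    iteratedIntegral n t (fun r => c * F r) = c * iteratedIntegral n t F := by
  induction n with
  | zero => intro t F; rfl
  | succ n ih =>
    intro t F
    simp only [iteratedIntegral, ih, intervalIntegral.integral_const_mul]

theorem iteratedIntegral_mul_const (c : ℝ) (n : ℕ) (t : ℝ) (F : (Fin n → ℝ) → ℝ) :
    iteratedIntegral n t (fun r => F r * c) = c * iteratedIntegral n t F := by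
  rw [← iteratedIntegral_const_mul]
  simp only [mul_comm c]

variable {lam : ℝ → ℝ}

/-- The last gap `t - s` depends only on the outermost variable `s`, and the remaining gaps are
those of the inner configuration ending at `s`. Pulling the last factor out leaves a convolution.
The variant without the gap from `0` ends with the constant `1`. -/
theorem iteratedIntegral_prod_gap (n : ℕ) : ∀ {t : ℝ}, 0 < t →
    iteratedIntegral n t (fun r => ∏ i : Fin (n + 1), lam (gap t r i)) = convPow lam lam n t := by
  induction n with
  | zero =>
    intro t ht
    simp [iteratedIntegral, convPow, gap, times, Fin.snoc]
  | succ n ih =>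
    intro t ht
    rw [iteratedIntegral, convPow, causalConv, intervalIntegral.integral_of_le ht.le]
    refine setIntegral_congr_fun measurableSet_Ioc fun s hs => ?_
    simp only [Fin.prod_univ_castSucc (n := n + 1), gap_snoc_last, gap_snoc_castSucc,
      iteratedIntegral_mul_const]
    rw [ih hs.1]

theorem iteratedIntegral_prod_gap_succ (n : ℕ) : ∀ {t : ℝ}, 0 < t →
    iteratedIntegral n t (fun r => ∏ i : Fin n, lam (gap t r i.succ))
      = convPow lam (fun _ => 1) n t := by
  induction n with
  | zero =>
    intro t ht
    simp [iteratedIntegral, convPow]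
  | succ n ih =>
    intro t ht
    rw [iteratedIntegral, convPow, causalConv, intervalIntegral.integral_of_le ht.le]
    refine setIntegral_congr_fun measurableSet_Ioc fun s hs => ?_
    simp only [Fin.prod_univ_castSucc (n := n), Fin.succ_last, gap_snoc_last, Fin.succ_castSucc,
      gap_snoc_castSucc, iteratedIntegral_mul_const]
    rw [ih hs.1]

theorem mem_simplex_snoc {n : ℕ} {t s : ℝ} {r : Fin n → ℝ} :
    Fin.snoc (α := fun _ => ℝ) r s ∈ simplex (n + 1) t ↔ r ∈ simplex n s ∧ s < t := by
  simp only [simplex, mem_ofPred_eq, Fin.strictMono_iff_lt_succ]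
  have hg : ∀ {m : ℕ} (t : ℝ) (r : Fin m → ℝ) (i : Fin (m + 1)),
      times t r i.castSucc < times t r i.succ ↔ 0 < gap t r i := fun t r i => by
    rw [gap, sub_pos]
  simp only [hg]
  rw [Fin.forall_fin_succ']
  simp only [gap_snoc_last, gap_snoc_castSucc, sub_pos]

theorem pos_of_mem_simplex {n : ℕ} {t : ℝ} {r : Fin n → ℝ} (hr : r ∈ simplex n t) : 0 < t := by
  have h : times t r 0 < times t r (Fin.last (n + 1)) := hr (Fin.last_pos)
  simpa [times, ← Fin.succ_last] using h

/-- Iterated integrals of functions that agree on the simplex. -/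
theorem iteratedIntegral_congr (n : ℕ) : ∀ {t : ℝ}, 0 < t → ∀ {F G : (Fin n → ℝ) → ℝ},
    (∀ r ∈ simplex n t, F r = G r) → iteratedIntegral n t F = iteratedIntegral n t G := by
  induction n with
  | zero =>
    intro t ht F G h
    refine h _ ?_
    rw [simplex, mem_ofPred_eq, Fin.strictMono_iff_lt_succ]
    intro i
    fin_cases i
    simpa [times, Fin.snoc] using ht
  | succ n ih =>
    intro t ht F G h
    rw [iteratedIntegral, iteratedIntegral, intervalIntegral.integral_of_le ht.le,
      intervalIntegral.integral_of_le ht.le, integral_Ioc_eq_integral_Ioo,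
      integral_Ioc_eq_integral_Ioo]
    -- The interval is now open, as it must be: a configuration whose last time is `s = t` lies
    -- outside the simplex.
    refine setIntegral_congr_fun measurableSet_Ioo fun s hs => ?_
    exact ih hs.1 fun r hr => h _ (mem_simplex_snoc.2 ⟨hr, hs.2⟩)

end IteratedIntegrals

section CylindricalBM

variable {Ω : Type*} [MeasurableSpace Ω] {P : Measure Ω} [IsProbabilityMeasure P] {ι : Type*}
  {W : ι → ℝ≥0 → Ω → ℝ}

/-! ### The Gaussian space of a cylindrical Brownian motion -/

namespace IsCylindricalBM

theorem isPreBrownian (hW : IsCylindricalBM W P) (k : ι) : IsPreBrownianReal (W k) P :=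
  (hW.brownian k).toIsPreBrownianReal

theorem memLp (hW : IsCylindricalBM W P) (k : ι) (t : ℝ≥0) : MemLp (W k t) 2 P :=
  ((hW.isPreBrownian k).hasLaw_eval t).hasGaussianLaw.memLp_two

/-- The value `W^k_t` as an element of `L²(P)`. -/
def bm (hW : IsCylindricalBM W P) (k : ι) (t : ℝ≥0) : Lp ℝ 2 P := (hW.memLp k t).toLp (W k t)

theorem integral_mul (hW : IsCylindricalBM W P) (k : ι) (s t : ℝ≥0) :
    ∫ ω, W k s ω * W k t ω ∂P = min s t := by
  have h := covariance_eq_sub (hW.memLp k s) (hW.memLp k t)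
  rw [(hW.isPreBrownian k).covariance_eval, (hW.isPreBrownian k).integral_eval, zero_mul,
    sub_zero] at h
  exact h.symm

theorem inner_bm (hW : IsCylindricalBM W P) (k : ι) (s t : ℝ≥0) :
    inner ℝ (hW.bm k s) (hW.bm k t) = min (s : ℝ) t := by
  rw [bm, bm, real_inner_toLp, hW.integral_mul, NNReal.coe_min]

theorem inner_bm_of_ne (hW : IsCylindricalBM W P) {k l : ι} (hkl : k ≠ l) (s t : ℝ≥0) :
    inner ℝ (hW.bm k s) (hW.bm l t) = 0 := by
  have hind : IndepFun (W k s) (W l t) P :=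
    (hW.indep.indepFun hkl).comp (measurable_pi_apply s) (measurable_pi_apply t)
  have h := hind.covariance_eq_zero (hW.memLp k s) (hW.memLp l t)
  rw [covariance_eq_sub (hW.memLp k s) (hW.memLp l t), (hW.isPreBrownian k).integral_eval, zero_mul,
    sub_zero] at h
  rw [bm, bm, real_inner_toLp]
  exact h

/-- A finite index set lies in a rectangle `K × J`. The rows over `K` are independent Gaussian
vectors, hence jointly Gaussian, and the required coordinates are a linear image. -/
theorem isGaussianProcess (hW : IsCylindricalBM W P) :
    IsGaussianProcess (fun p : ι × ℝ≥0 => W p.1 p.2) P where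
  hasGaussianLaw I := by
    classical
    let K := I.image Prod.fst
    let J := I.image Prod.snd
    have h1 : HasGaussianLaw (fun ω => fun k : K => J.restrict fun t => W k t ω) P := by
      refine iIndepFun.hasGaussianLaw
        (X := fun (k : K) ω => J.restrict fun t => W k t ω) (fun k => ?_) ?_
      · exact ((hW.isPreBrownian k).hasLaw J).hasGaussianLaw
      · have h2 := hW.indep.precomp (g := fun k : K => (k : ι)) Subtype.val_injective
        exact h2.comp (fun _ => fun f : ℝ≥0 → ℝ => J.restrict f) fun _ => by fun_prop
    let L : (K → J → ℝ) →L[ℝ] (I → ℝ) := ContinuousLinearMap.pi fun p =>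
      (ContinuousLinearMap.proj (R := ℝ) (φ := fun _ : J => ℝ)
        ⟨p.1.2, Finset.mem_image_of_mem _ p.2⟩).comp
        (ContinuousLinearMap.proj (R := ℝ) (φ := fun _ : K => J → ℝ)
          ⟨p.1.1, Finset.mem_image_of_mem _ p.2⟩)
    exact h1.map_fun L

/-- The closed linear span of the random variables `W^k_t`. -/
def space (hW : IsCylindricalBM W P) : Submodule ℝ (Lp ℝ 2 P) :=
  (Submodule.span ℝ (range fun p : ι × ℝ≥0 => hW.bm p.1 p.2)).topologicalClosure

/-- By closedness of the Gaussian condition only finite linear combinations matter. Each is a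
centered Gaussian variable whose variance is its squared `L²` norm. -/
theorem isGaussianSpace (hW : IsCylindricalBM W P) : IsGaussianSpace P hW.space := by
  refine IsGaussianSpace.topologicalClosure fun X hX => ?_
  obtain ⟨c, rfl⟩ := Finsupp.mem_span_range_iff_exists_finsupp.1 hX
  set Y : Ω → ℝ := fun ω => ∑ p ∈ c.support, c p * W p.1 p.2 ω with hY
  have hYlaw : HasGaussianLaw Y P := by
    exact (hW.isGaussianProcess.smul fun p => c p).hasGaussianLaw_fun_sum (I := c.support)
  have hXY : (c.sum fun p a => a • hW.bm p.1 p.2 : Lp ℝ 2 P) =ᵐ[P] Y := by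
    rw [Finsupp.sum]
    refine (Lp.coeFn_fun_finsetSum _ _).trans ?_
    have h : ∀ᵐ ω ∂P, ∀ p ∈ c.support, (c p • hW.bm p.1 p.2 : Lp ℝ 2 P) ω = c p * W p.1 p.2 ω := by
      rw [eventually_all_finset]
      intro p _
      filter_upwards [Lp.coeFn_smul (c p) (hW.bm p.1 p.2), (hW.memLp p.1 p.2).coeFn_toLp]
        with ω h1 h2
      rw [h1, Pi.smul_apply, bm, h2, smul_eq_mul]
    filter_upwards [h] with ω hω
    exact Finset.sum_congr rfl fun p hp => hω p hp
  set X : Lp ℝ 2 P := c.sum fun p a => a • hW.bm p.1 p.2 with hXdef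
  have hmean : P[Y] = 0 := by
    rw [hY, integral_finsetSum _ fun p _ =>
      ((hW.memLp p.1 p.2).integrable one_le_two).const_mul (c p)]
    refine Finset.sum_eq_zero fun p _ => ?_
    rw [integral_const_mul, (hW.isPreBrownian p.1).integral_eval, mul_zero]
  have hvar : Var[Y; P] = ‖X‖ ^ 2 := by
    rw [variance_of_integral_eq_zero hYlaw.aemeasurable hmean, norm_sq_Lp_eq]
    refine integral_congr_ae ?_
    filter_upwards [hXY] with ω h
    rw [h]
  have hchar := hYlaw.charFun_map_eq (1 : ℝ)
  rw [charFun_apply_real, integral_map hYlaw.aemeasurable (by fun_prop)] at hchar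
  have e1 : ∫ ω, Complex.exp (X ω * Complex.I) ∂P
      = ∫ ω, Complex.exp ((1 : ℝ) * Y ω * Complex.I) ∂P := by
    refine integral_congr_ae ?_
    filter_upwards [hXY] with ω h
    rw [h, Complex.ofReal_one, one_mul]
  rw [e1, hchar]
  simp only [RCLike.inner_apply, map_one, mul_one, hmean, hvar]
  congr 1
  push_cast
  ring

end IsCylindricalBM

end CylindricalBM

/-! ### Step functions and Wiener integrals -/

/-- The left-endpoint step function of `c` on the partition of `(0, t]` into `N` intervals. -/
def stepFun (t : ℝ) (c : ℝ → ℝ) (N : ℕ) (u : ℝ) : ℝ :=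
  ∑ j ∈ Finset.range N, (Ioc (j * t / N) ((j + 1) * t / N)).indicator (fun _ => c (j * t / N)) u

theorem measurable_stepFun (t : ℝ) (c : ℝ → ℝ) (N : ℕ) : Measurable (stepFun t c N) :=
  Finset.measurable_fun_sum _ fun _ _ => measurable_const.indicator measurableSet_Ioc

theorem stepFun_of_notMem {t : ℝ} (ht : 0 ≤ t) (c : ℝ → ℝ) (N : ℕ) {u : ℝ} (hu : u ∉ Ioc 0 t) :
    stepFun t c N u = 0 := by
  refine Finset.sum_eq_zero fun j hj => indicator_of_notMem (fun h => hu ⟨?_, ?_⟩) _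
  · exact lt_of_le_of_lt (by positivity) h.1
  · have hN : (j : ℝ) + 1 ≤ N := by exact_mod_cast Finset.mem_range.1 hj
    have hN0 : (0 : ℝ) < N := by
      have : (0 : ℝ) ≤ j := j.cast_nonneg
      linarith
    refine h.2.trans ?_
    rw [div_le_iff₀ hN0, mul_comm t]
    exact mul_le_mul_of_nonneg_right hN ht

theorem exists_stepFun_eq {t : ℝ} (ht : 0 < t) (c : ℝ → ℝ) {N : ℕ} (hN : 0 < N) {u : ℝ}
    (hu : u ∈ Ioc 0 t) : ∃ v, v ∈ Icc 0 t ∧ |v - u| ≤ t / N ∧ stepFun t c N u = c v := by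
  have hN0 : (0 : ℝ) < N := by exact_mod_cast hN
  have hpos : 0 < u * N / t := div_pos (mul_pos hu.1 hN0) ht
  have hcpos : 0 < ⌈u * N / t⌉₊ := Nat.ceil_pos.2 hpos
  -- The cells are open on the left and closed on the right, so the cell containing `u` has index
  -- `⌈uN/t⌉ - 1`.
  obtain ⟨m, hm⟩ : ∃ m, ⌈u * N / t⌉₊ = m + 1 := ⟨_, (Nat.succ_pred_eq_of_pos hcpos).symm⟩
  have h1 : (m : ℝ) < u * N / t := Nat.lt_ceil.1 (by omega)
  have h2 : u * N / t ≤ m + 1 := by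
    have := Nat.le_ceil (u * N / t)
    rw [hm] at this
    exact_mod_cast this
  have hmN : m < N := by
    have : (m : ℝ) < N := h1.trans_le (by
      rw [div_le_iff₀ ht, mul_comm]
      exact mul_le_mul_of_nonneg_left hu.2 hN0.le)
    exact_mod_cast this
  have hkey : ∀ j : ℕ, u ∈ Ioc (j * t / N) (((j : ℝ) + 1) * t / N) ↔ j = m := by
    intro j
    have e1 : (j : ℝ) * t / N < u ↔ (j : ℝ) < u * N / t := by
      rw [div_lt_iff₀ hN0, lt_div_iff₀ ht]
    have e2 : u ≤ ((j : ℝ) + 1) * t / N ↔ u * N / t ≤ (j : ℝ) + 1 := by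
      rw [le_div_iff₀ hN0, div_le_iff₀ ht]
    rw [mem_Ioc, e1, e2]
    constructor
    · rintro ⟨h3, h4⟩
      have h5 : (j : ℝ) < m + 1 := h3.trans_le h2
      have h6 : (m : ℝ) < j + 1 := h1.trans_le h4
      have h5' : j < m + 1 := by exact_mod_cast h5
      have h6' : m < j + 1 := by exact_mod_cast h6
      omega
    · rintro rfl
      exact ⟨h1, h2⟩
  have hu' := (hkey m).2 rfl
  refine ⟨m * t / N, ⟨by positivity, (hu'.1.le.trans hu.2)⟩, ?_, ?_⟩
  · have h3 := hu'.2
    rw [add_mul, one_mul, add_div] at h3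
    rw [abs_sub_comm, abs_of_nonneg (sub_nonneg.2 hu'.1.le)]
    linarith
  · rw [stepFun, Finset.sum_eq_single m, indicator_of_mem hu']
    · intro j _ hjm
      exact indicator_of_notMem (fun h => hjm ((hkey j).1 h)) _
    · intro h
      exact absurd (Finset.mem_range.2 hmN) h

theorem tendsto_stepFun {t : ℝ} (ht : 0 < t) {c : ℝ → ℝ} (hc : ContinuousOn c (Icc 0 t)) (u : ℝ) :
    Tendsto (fun N => stepFun t c N u) atTop (𝓝 ((Ioc 0 t).indicator c u)) := by
  by_cases hu : u ∈ Ioc 0 t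
  · rw [indicator_of_mem hu, Metric.tendsto_nhds]
    intro ε hε
    obtain ⟨η, hη, hηc⟩ := Metric.continuousOn_iff.1 hc u ⟨hu.1.le, hu.2⟩ ε hε
    have hlim : Tendsto (fun N : ℕ => t / (N : ℝ)) atTop (𝓝 0) :=
      tendsto_const_div_atTop_nhds_zero_nat t
    filter_upwards [hlim.eventually (gt_mem_nhds hη), eventually_gt_atTop 0] with N h1 h2
    obtain ⟨v, hv, hvu, he⟩ := exists_stepFun_eq ht c h2 hu
    rw [he]
    exact hηc v hv (by rw [Real.dist_eq]; exact hvu.trans_lt h1)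
  · rw [indicator_of_notMem hu]
    simp only [stepFun_of_notMem ht.le c _ hu]
    exact tendsto_const_nhds

theorem abs_stepFun_le {t : ℝ} (ht : 0 < t) {c : ℝ → ℝ} {C : ℝ} (hC : ∀ u ∈ Icc 0 t, |c u| ≤ C)
    (N : ℕ) (u : ℝ) : |stepFun t c N u| ≤ (Ioc 0 t).indicator (fun _ => C) u := by
  have hC0 : 0 ≤ C := (abs_nonneg _).trans (hC 0 (left_mem_Icc.2 ht.le))
  by_cases hu : u ∈ Ioc 0 t
  · rw [indicator_of_mem hu]
    rcases N.eq_zero_or_pos with rfl | hN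
    · simpa [stepFun] using hC0
    · obtain ⟨v, hv, -, he⟩ := exists_stepFun_eq ht c hN hu
      rw [he]
      exact hC v hv
  · rw [indicator_of_notMem hu, stepFun_of_notMem ht.le c N hu, abs_zero]

theorem tendsto_integral_stepFun_mul {t s : ℝ} (ht : 0 < t) (hs : 0 < s) {c d : ℝ → ℝ}
    (hc : ContinuousOn c (Icc 0 t)) (hd : ContinuousOn d (Icc 0 s)) :
    Tendsto (fun N => ∫ u, stepFun t c N u * stepFun s d N u) atTop
      (𝓝 (∫ u in Ioc 0 (min t s), c u * d u)) := by
  obtain ⟨C, hC⟩ := isCompact_Icc.exists_bound_of_continuousOn hc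
  obtain ⟨D, hD⟩ := isCompact_Icc.exists_bound_of_continuousOn hd
  have hC0 : 0 ≤ C := (norm_nonneg _).trans (hC 0 (left_mem_Icc.2 ht.le))
  have e : ∫ u in Ioc 0 (min t s), c u * d u
      = ∫ u, (Ioc 0 t).indicator c u * (Ioc 0 s).indicator d u := by
    rw [← integral_indicator measurableSet_Ioc]
    congr 1
    funext u
    rw [← inter_indicator_mul, Ioc_inter_Ioc, sup_idem]
  rw [e]
  refine tendsto_integral_of_dominated_convergence
    (fun u => (Ioc 0 t).indicator (fun _ => C * D) u) (fun N => ?_) ?_ (fun N => ?_) ?_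
  · exact ((measurable_stepFun t c N).mul (measurable_stepFun s d N)).aestronglyMeasurable
  · exact (integrable_indicator_iff measurableSet_Ioc).2 (integrableOn_const (by simp))
  · refine Eventually.of_forall fun u => ?_
    have h1 := abs_stepFun_le ht hC N u
    have h2 := abs_stepFun_le hs hD N u
    have hD0 : 0 ≤ D := (norm_nonneg _).trans (hD 0 (left_mem_Icc.2 hs.le))
    have h3 : |stepFun s d N u| ≤ D := h2.trans (indicator_le_self' (fun _ _ => hD0) u)
    rw [norm_mul, Real.norm_eq_abs, Real.norm_eq_abs]
    refine (mul_le_mul h1 h3 (abs_nonneg _) (indicator_nonneg (fun _ _ => hC0) _)).trans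
      (le_of_eq ?_)
    by_cases hu : u ∈ Ioc 0 t <;> simp [indicator, hu]
  · exact Eventually.of_forall fun u => (tendsto_stepFun ht hc u).mul (tendsto_stepFun hs hd u)

/-- The right-hand side is the covariance of two Brownian increments, expanded with `min`; the
left-hand side is the overlap of the time intervals. -/
theorem volume_real_Ioc_inter_Ioc {a b c d : ℝ} (hab : a ≤ b) (hcd : c ≤ d) :
    volume.real (Ioc a b ∩ Ioc c d) = min b d - min b c - min a d + min a c := by
  rw [Ioc_inter_Ioc, Real.volume_real_Ioc]
  grind

/-! ### The Itô isometry for step functions -/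

section CylindricalBM

variable {Ω : Type*} [MeasurableSpace Ω] {P : Measure Ω} [IsProbabilityMeasure P] {ι : Type*}
  {W : ι → ℝ≥0 → Ω → ℝ}

namespace IsCylindricalBM

/-- The Wiener integral of the step function `stepFun t c N` against `W^k`. -/
def stepLp (hW : IsCylindricalBM W P) (k : ι) (t : ℝ) (c : ℝ → ℝ) (N : ℕ) : Lp ℝ 2 P :=
  ∑ j ∈ Finset.range N, c (j * t / N) •
    (hW.bm k (Real.toNNReal ((j + 1) * t / N)) - hW.bm k (Real.toNNReal (j * t / N)))

theorem stepLp_mem (hW : IsCylindricalBM W P) (k : ι) (t : ℝ) (c : ℝ → ℝ) (N : ℕ) :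
    hW.stepLp k t c N ∈ hW.space := by
  have h : ∀ s, hW.bm k s ∈ hW.space := fun s =>
    Submodule.le_topologicalClosure _ (Submodule.subset_span ⟨(k, s), rfl⟩)
  exact Submodule.sum_mem _ fun j _ => Submodule.smul_mem _ _ (Submodule.sub_mem _ (h _) (h _))

theorem inner_bm_sub (hW : IsCylindricalBM W P) (k : ι) {a b c d : ℝ} (ha : 0 ≤ a) (hab : a ≤ b)
    (hc : 0 ≤ c) (hcd : c ≤ d) :
    inner ℝ (hW.bm k b.toNNReal - hW.bm k a.toNNReal) (hW.bm k d.toNNReal - hW.bm k c.toNNReal)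
      = volume.real (Ioc a b ∩ Ioc c d) := by
  rw [volume_real_Ioc_inter_Ioc hab hcd, inner_sub_left, inner_sub_right, inner_sub_right]
  simp only [hW.inner_bm, Real.coe_toNNReal _ ha, Real.coe_toNNReal _ hc,
    Real.coe_toNNReal _ (ha.trans hab), Real.coe_toNNReal _ (hc.trans hcd)]
  ring

theorem inner_stepLp_of_ne (hW : IsCylindricalBM W P) {k l : ι} (hkl : k ≠ l) (t s : ℝ)
    (c d : ℝ → ℝ) (N M : ℕ) : inner ℝ (hW.stepLp k t c N) (hW.stepLp l s d M) = 0 := by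
  simp only [stepLp, sum_inner, inner_sum, real_inner_smul_left, real_inner_smul_right,
    inner_sub_left, inner_sub_right, hW.inner_bm_of_ne hkl, sub_zero, mul_zero,
    Finset.sum_const_zero]

/-- By bilinearity the claim reduces to pairs of cells, where both sides are the length of the
overlap. The two partitions may have different endpoints `t` and `s`, as needed for covariances at
different times. -/
theorem inner_stepLp (hW : IsCylindricalBM W P) (k : ι) {t s : ℝ} (ht : 0 ≤ t) (hs : 0 ≤ s)
    (c d : ℝ → ℝ) (N : ℕ) : inner ℝ (hW.stepLp k t c N) (hW.stepLp k s d N)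
      = ∫ u, stepFun t c N u * stepFun s d N u := by
  have hle : ∀ {t : ℝ}, 0 ≤ t → ∀ j : ℕ, (j : ℝ) * t / N ≤ (j + 1) * t / N := fun {t} ht j => by
    gcongr
    linarith
  have hint : ∀ i j : ℕ, Integrable (fun u =>
      (Ioc (i * t / N) ((i + 1) * t / N)).indicator (fun _ => c (i * t / N)) u *
      (Ioc (j * s / N) ((j + 1) * s / N)).indicator (fun _ => d (j * s / N)) u) := fun i j => by
    simp only [← inter_indicator_mul]
    exact (integrable_indicator_iff (measurableSet_Ioc.inter measurableSet_Ioc)).2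
      (integrableOn_const (by
        rw [Ioc_inter_Ioc]; simp))
  simp only [stepFun, Finset.sum_mul_sum]
  rw [integral_finsetSum _ fun i _ => integrable_finsetSum _ fun j _ => hint i j]
  rw [stepLp, stepLp, sum_inner]
  refine Finset.sum_congr rfl fun i _ => ?_
  rw [inner_sum, integral_finsetSum _ fun j _ => hint i j]
  refine Finset.sum_congr rfl fun j _ => ?_
  rw [real_inner_smul_left, real_inner_smul_right,
    hW.inner_bm_sub k (by positivity) (hle ht i) (by positivity) (hle hs j)]
  simp only [← inter_indicator_mul]
  rw [integral_indicator (measurableSet_Ioc.inter measurableSet_Ioc), setIntegral_const, smul_eq_mul]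
  ring

end IsCylindricalBM

end CylindricalBM

/-! ### Coordinates of square integrable random vectors -/

section Coordinates

variable {H : Type*} [NormedAddCommGroup H] [InnerProductSpace ℝ H]
  {Ω : Type*} [MeasurableSpace Ω] {P : Measure Ω} {V : Ω → H}

/-- The coordinate `⟨h, V⟩` of a square integrable random vector, as an element of `L²(P)`. -/
def coord (hV : MemLp V 2 P) (h : H) : Lp ℝ 2 P := (hV.const_inner h).toLp

theorem coeFn_coord (hV : MemLp V 2 P) (h : H) : coord hV h =ᵐ[P] fun ω => inner ℝ h (V ω) :=
  (hV.const_inner h).coeFn_toLp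

/-- Pairing with `h` is Lipschitz with constant `‖h‖`, so `L²` convergence of vectors passes to
coordinates. -/
theorem tendsto_coord {β : Type*} {l : Filter β} {X : β → Lp ℝ 2 P} {U : β → Ω → H} (h : H)
    (hX : ∀ i, X i =ᵐ[P] fun ω => inner ℝ h (U i ω)) (hV : MemLp V 2 P)
    (hlim : Tendsto (fun i => eLpNorm (fun ω => U i ω - V ω) 2 P) l (𝓝 0)) :
    Tendsto X l (𝓝 (coord hV h)) := by
  rw [Lp.tendsto_Lp_iff_tendsto_eLpNorm']
  have h1 : Tendsto (fun i => ENNReal.ofReal ‖h‖ * eLpNorm (fun ω => U i ω - V ω) 2 P) l (𝓝 0) := by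
    simpa using ENNReal.Tendsto.const_mul (a := ENNReal.ofReal ‖h‖) hlim
      (Or.inr ENNReal.ofReal_ne_top)
  refine tendsto_of_tendsto_of_tendsto_of_le_of_le tendsto_const_nhds h1 (fun _ => zero_le) fun i => ?_
  refine eLpNorm_le_mul_eLpNorm_of_ae_le_mul ?_ _
  filter_upwards [hX i, coeFn_coord hV h] with ω h2 h3
  rw [Pi.sub_apply, h2, h3, ← inner_sub_right]
  exact norm_inner_le_norm _ _

end Coordinates

/-! ### Covariances of Wiener integrals and of the stochastic convolution -/

section StochasticConvolution

variable {H : Type*} [NormedAddCommGroup H] [InnerProductSpace ℝ H] [CompleteSpace H]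
  {Ω : Type*} [MeasurableSpace Ω] {P : Measure Ω} [IsProbabilityMeasure P]
  {ι : Type*} {W : ι → ℝ≥0 → Ω → ℝ} {T : ℝ → H →L[ℝ] H} {Q : H →L[ℝ] H}

theorem IsWienerIntegral.tendsto_stepLp (hW : IsCylindricalBM W P) {k : ι} {f : ℝ → H} {t : ℝ}
    {I : Ω → H} (hI : IsWienerIntegral P (W k) f t I) (h : H) :
    Tendsto (hW.stepLp k t fun u => inner ℝ h (f u)) atTop (𝓝 (coord hI.1 h)) := by
  refine tendsto_coord h (fun N => ?_) hI.1 hI.2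
  refine (Lp.coeFn_fun_finsetSum _ _).trans ?_
  have h1 : ∀ᵐ ω ∂P, ∀ j ∈ Finset.range N, (inner ℝ h (f (j * t / N)) •
      (hW.bm k (Real.toNNReal ((j + 1) * t / N)) - hW.bm k (Real.toNNReal (j * t / N))) :
        Lp ℝ 2 P) ω = inner ℝ h ((W k (Real.toNNReal ((j + 1) * t / N)) ω
          - W k (Real.toNNReal (j * t / N)) ω) • f (j * t / N)) := by
    rw [eventually_all_finset]
    intro j _
    filter_upwards [Lp.coeFn_smul (inner ℝ h (f (j * t / N)))
        (hW.bm k (Real.toNNReal ((j + 1) * t / N)) - hW.bm k (Real.toNNReal (j * t / N))),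
      Lp.coeFn_sub (hW.bm k (Real.toNNReal ((j + 1) * t / N))) (hW.bm k (Real.toNNReal (j * t / N))),
      (hW.memLp k (Real.toNNReal ((j + 1) * t / N))).coeFn_toLp,
      (hW.memLp k (Real.toNNReal (j * t / N))).coeFn_toLp] with ω h1 h2 h3 h4
    rw [h1, Pi.smul_apply, h2, Pi.sub_apply, IsCylindricalBM.bm, h3, IsCylindricalBM.bm, h4,
      real_inner_smul_right, smul_eq_mul, mul_comm]
  filter_upwards [h1] with ω hω
  rw [inner_sum]
  exact Finset.sum_congr rfl hω

theorem IsWienerIntegral.coord_mem (hW : IsCylindricalBM W P) {k : ι} {f : ℝ → H} {t : ℝ}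
    {I : Ω → H} (hI : IsWienerIntegral P (W k) f t I) (h : H) : coord hI.1 h ∈ hW.space :=
  (Submodule.isClosed_topologicalClosure _).mem_of_tendsto (hI.tendsto_stepLp hW h)
    (Eventually.of_forall fun N => hW.stepLp_mem k t _ N)

theorem IsWienerIntegral.inner_coord_of_ne (hW : IsCylindricalBM W P) {k l : ι} (hkl : k ≠ l)
    {f g : ℝ → H} {t s : ℝ} {I J : Ω → H} (hI : IsWienerIntegral P (W k) f t I)
    (hJ : IsWienerIntegral P (W l) g s J) (h h' : H) :
    inner ℝ (coord hI.1 h) (coord hJ.1 h') = 0 := by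
  refine tendsto_nhds_unique ((hI.tendsto_stepLp hW h).inner (hJ.tendsto_stepLp hW h')) ?_
  simp only [hW.inner_stepLp_of_ne hkl]
  exact tendsto_const_nhds

/-- The isometry for step functions passes to the limit on both sides: in `L²(P)` by definition of
the Wiener integral, and in the time integral by continuity of the integrands. -/
theorem IsWienerIntegral.inner_coord (hW : IsCylindricalBM W P) {k : ι} {f g : ℝ → H} {t s : ℝ}
    (ht : 0 ≤ t) (hs : 0 ≤ s) {I J : Ω → H} (hI : IsWienerIntegral P (W k) f t I)
    (hJ : IsWienerIntegral P (W k) g s J) (hf : ContinuousOn f (Icc 0 t))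
    (hg : ContinuousOn g (Icc 0 s)) (h h' : H) :
    inner ℝ (coord hI.1 h) (coord hJ.1 h')
      = ∫ u in Ioc 0 (min t s), inner ℝ h (f u) * inner ℝ h' (g u) := by
  refine tendsto_nhds_unique ((hI.tendsto_stepLp hW h).inner (hJ.tendsto_stepLp hW h')) ?_
  simp only [hW.inner_stepLp k ht hs]
  -- The convergence of step functions assumes positive length, so the degenerate times are treated
  -- directly.
  have hz : ∀ (c : ℝ → ℝ) N u, stepFun 0 c N u = 0 := fun c N u =>
    stepFun_of_notMem le_rfl c N (by simp)
  rcases ht.eq_or_lt with rfl | ht'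
  · simp only [hz, zero_mul,
      integral_zero, min_eq_left hs, Ioc_self, Measure.restrict_empty, integral_zero_measure]
    exact tendsto_const_nhds
  rcases hs.eq_or_lt with rfl | hs'
  · simp only [hz, mul_zero,
      integral_zero, min_eq_right ht, Ioc_self, Measure.restrict_empty, integral_zero_measure]
    exact tendsto_const_nhds
  exact tendsto_integral_stepFun_mul ht' hs' (continuousOn_const.inner hf) (continuousOn_const.inner hg)

variable {e : HilbertBasis ι ℝ H} {WA : ℝ → Ω → H}

namespace IsStochasticConvolution

theorem memLp (hWA : IsStochasticConvolution P T Q e W WA) {t : ℝ} (ht : 0 ≤ t) :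
    MemLp (WA t) 2 P := (hWA t ht).1

theorem exists_tendsto_coord (hWA : IsStochasticConvolution P T Q e W WA) {t : ℝ} (ht : 0 ≤ t) :
    ∃ I : ι → Ω → H,
      ∃ hI : ∀ k, IsWienerIntegral P (W k) (fun s => T (t - s) (opSqrt Q (e k))) t (I k),
      ∀ h, Tendsto (fun F : Finset ι => ∑ k ∈ F, coord (hI k).1 h) atTop
        (𝓝 (coord (hWA.memLp ht) h)) := by
  obtain ⟨-, I, hI, hlim⟩ := hWA t ht
  refine ⟨I, hI, fun h => tendsto_coord h (fun F => ?_) _ hlim⟩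
  refine (Lp.coeFn_fun_finsetSum _ _).trans ?_
  have h1 : ∀ᵐ ω ∂P, ∀ k ∈ F, coord (hI k).1 h ω = inner ℝ h (I k ω) := by
    rw [eventually_all_finset]
    exact fun k _ => coeFn_coord (hI k).1 h
  filter_upwards [h1] with ω hω
  rw [inner_sum]
  exact Finset.sum_congr rfl hω

theorem coord_mem (hW : IsCylindricalBM W P) (hWA : IsStochasticConvolution P T Q e W WA) {t : ℝ}
    (ht : 0 ≤ t) (h : H) : coord (hWA.memLp ht) h ∈ hW.space := by
  obtain ⟨I, hI, hlim⟩ := hWA.exists_tendsto_coord ht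
  exact (Submodule.isClosed_topologicalClosure _).mem_of_tendsto (hlim h)
    (Eventually.of_forall fun F => Submodule.sum_mem _ fun k _ => (hI k).coord_mem hW h)

variable [SecondCountableTopology H]

/-- The covariance of the stochastic convolution. -/
theorem inner_coord (hT : IsC0Semigroup T) (hQ : Q.IsPositive) (hW : IsCylindricalBM W P)
    (hWA : IsStochasticConvolution P T Q e W WA) {t s : ℝ} (ht : 0 ≤ t) (hs : 0 ≤ s) (h g : H) :
    inner ℝ (coord (hWA.memLp ht) h) (coord (hWA.memLp hs) g)
      = ∫ u in Ioc 0 (min t s), inner ℝ (opSqrt Q ((T (t - u)).adjoint h))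
          (opSqrt Q ((T (s - u)).adjoint g)) := by
  classical
  -- Countability makes the filter of finite subsets of `ι` countably generated, as dominated
  -- convergence requires.
  have hι : Countable ι := countable_of_hilbertBasis e
  obtain ⟨I, hI, hIlim⟩ := hWA.exists_tendsto_coord ht
  obtain ⟨J, hJ, hJlim⟩ := hWA.exists_tendsto_coord hs
  have hcont : ∀ (t : ℝ) (z : H), ContinuousOn (fun u => T (t - u) z) (Icc 0 t) := fun t z =>
    (hT.strongly_continuous z).comp (by fun_prop) fun u hu => sub_nonneg.2 hu.2
  have hφ : ∀ (t : ℝ) (h : H) (k : ι) (u : ℝ), inner ℝ h (T (t - u) (opSqrt Q (e k)))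
      = inner ℝ (opSqrt Q ((T (t - u)).adjoint h)) (e k) := fun t h k u => by
    rw [(opSqrt_spec hQ).1.inner_left_eq_inner_right, ContinuousLinearMap.adjoint_inner_left]
  have e1 : ∀ F : Finset ι, inner ℝ (∑ k ∈ F, coord (hI k).1 h) (∑ k ∈ F, coord (hJ k).1 g)
      = ∫ u in Ioc 0 (min t s), ∑ k ∈ F, inner ℝ (opSqrt Q ((T (t - u)).adjoint h)) (e k) *
          inner ℝ (opSqrt Q ((T (s - u)).adjoint g)) (e k) := fun F => by
    rw [integral_finsetSum, sum_inner]
    · refine Finset.sum_congr rfl fun k hk => ?_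
      rw [inner_sum, Finset.sum_eq_single k]
      · rw [(hI k).inner_coord hW ht hs (hJ k) (hcont t _) (hcont s _)]
        simp only [hφ]
      · exact fun l _ hlk => (hI k).inner_coord_of_ne hW hlk.symm (hJ l) h g
      · exact fun hk' => absurd hk hk'
    · intro k _
      simp only [← hφ]
      have hc : ContinuousOn (fun u => inner ℝ h (T (t - u) (opSqrt Q (e k))) *
          inner ℝ g (T (s - u) (opSqrt Q (e k)))) (Icc 0 (min t s)) :=
        (continuousOn_const.inner ((hcont t _).mono (Icc_subset_Icc_right (min_le_left _ _)))).mul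
          (continuousOn_const.inner ((hcont s _).mono (Icc_subset_Icc_right (min_le_right _ _))))
      exact (hc.integrableOn_Icc).mono_set Ioc_subset_Icc_self
  refine tendsto_nhds_unique ((hIlim h).inner (hJlim g)) ?_
  simp only [e1]
  obtain ⟨C, hC0, hC⟩ := hT.exists_norm_le (max t s)
  have hb : ∀ (h : H) (r : ℝ), 0 ≤ r → r ≤ max t s →
      ‖opSqrt Q ((T r).adjoint h)‖ ≤ ‖opSqrt Q‖ * (C * ‖h‖) := fun h r hr hr' => by
    refine (ContinuousLinearMap.le_opNorm _ _).trans (mul_le_mul_of_nonneg_left ?_ (norm_nonneg _))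
    exact (T r).adjoint.le_of_opNorm_le (by
      rw [LinearIsometryEquiv.norm_map]; exact hC r hr hr') _
  -- Bessel's inequality bounds the partial sums independently of `F`; the pointwise limit is then
  -- Parseval's identity.
  have hbessel : ∀ (z : H) (F : Finset ι), ∑ k ∈ F, inner ℝ z (e k) ^ 2 ≤ ‖z‖ ^ 2 := fun z F => by
    refine le_trans (Finset.sum_le_sum fun k _ => ?_) (e.orthonormal.sum_inner_products_le z (s := F))
    rw [real_inner_comm, Real.norm_eq_abs, sq_abs]
  refine tendsto_integral_filter_of_dominated_convergence
    (fun _ => (‖opSqrt Q‖ * (C * ‖h‖)) ^ 2 + (‖opSqrt Q‖ * (C * ‖g‖)) ^ 2)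
    (Eventually.of_forall fun F => ?_) (Eventually.of_forall fun F => ?_)
    (integrableOn_const (by simp)) ?_
  · refine Finset.aestronglyMeasurable_fun_sum _ fun k _ => ?_
    simp only [← hφ]
    have hc : ContinuousOn (fun u => inner ℝ h (T (t - u) (opSqrt Q (e k))) *
        inner ℝ g (T (s - u) (opSqrt Q (e k)))) (Icc 0 (min t s)) :=
      (continuousOn_const.inner ((hcont t _).mono (Icc_subset_Icc_right (min_le_left _ _)))).mul
        (continuousOn_const.inner ((hcont s _).mono (Icc_subset_Icc_right (min_le_right _ _))))
    exact (hc.integrableOn_Icc.mono_set Ioc_subset_Icc_self).aestronglyMeasurable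
  · filter_upwards [ae_restrict_mem measurableSet_Ioc] with u hu
    have hut : u ≤ t := hu.2.trans (min_le_left _ _)
    have hus : u ≤ s := hu.2.trans (min_le_right _ _)
    have h1 := hb h (t - u) (sub_nonneg.2 hut) (by linarith [hu.1, le_max_left t s])
    have h2 := hb g (s - u) (sub_nonneg.2 hus) (by linarith [hu.1, le_max_right t s])
    refine (norm_sum_le _ _).trans ?_
    have h3 : ∀ k ∈ F, ‖inner ℝ (opSqrt Q ((T (t - u)).adjoint h)) (e k) *
        inner ℝ (opSqrt Q ((T (s - u)).adjoint g)) (e k)‖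
        ≤ inner ℝ (opSqrt Q ((T (t - u)).adjoint h)) (e k) ^ 2 +
          inner ℝ (opSqrt Q ((T (s - u)).adjoint g)) (e k) ^ 2 := fun k _ => by
      rw [Real.norm_eq_abs, abs_le]
      constructor <;> nlinarith [sq_nonneg (inner ℝ (opSqrt Q ((T (t - u)).adjoint h)) (e k) +
        inner ℝ (opSqrt Q ((T (s - u)).adjoint g)) (e k)),
        sq_nonneg (inner ℝ (opSqrt Q ((T (t - u)).adjoint h)) (e k) -
        inner ℝ (opSqrt Q ((T (s - u)).adjoint g)) (e k))]
    refine (Finset.sum_le_sum h3).trans ?_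
    rw [Finset.sum_add_distrib]
    exact add_le_add ((hbessel _ F).trans (pow_le_pow_left₀ (norm_nonneg _) h1 2))
      ((hbessel _ F).trans (pow_le_pow_left₀ (norm_nonneg _) h2 2))
  · refine Eventually.of_forall fun u => ?_
    have h1 := e.hasSum_inner_mul_inner (opSqrt Q ((T (t - u)).adjoint h))
      (opSqrt Q ((T (s - u)).adjoint g))
    simp only [real_inner_comm (opSqrt Q ((T (s - u)).adjoint g)) (e _)] at h1
    exact h1

end IsStochasticConvolution

end StochasticConvolution

section GaussianVectors

variable {H : Type*} [NormedAddCommGroup H] [InnerProductSpace ℝ H] [CompleteSpace H]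
  [SecondCountableTopology H] [MeasurableSpace H] [BorelSpace H]
  {Ω : Type*} [MeasurableSpace Ω] {P : Measure Ω} [IsProbabilityMeasure P]
  {G : Submodule ℝ (Lp ℝ 2 P)} {V : Ω → H} {R : H →L[ℝ] H}

/-! ### Random vectors with coordinates in a Gaussian space -/

theorem integral_exp_inner (hG : IsGaussianSpace P G) (hV : MemLp V 2 P)
    (hVG : ∀ h, coord hV h ∈ G) (h : H) :
    ∫ ω, Complex.exp ((inner ℝ h (V ω) : ℝ) * Complex.I) ∂P
      = Complex.exp (-(‖coord hV h‖ ^ 2 / 2 : ℝ)) := by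
  rw [← hG _ (hVG h)]
  refine integral_congr_ae ?_
  filter_upwards [coeFn_coord hV h] with ω hω
  rw [hω]

theorem charFun_map_eq (hG : IsGaussianSpace P G) (hV : MemLp V 2 P)
    (hVG : ∀ h, coord hV h ∈ G) (h : H) :
    charFun (P.map V) h = Complex.exp (-(‖coord hV h‖ ^ 2 / 2 : ℝ)) := by
  rw [charFun_apply, integral_map hV.1.aemeasurable (by fun_prop), ← integral_exp_inner hG hV hVG]
  simp only [real_inner_comm]

theorem isCenteredGaussian_map (hG : IsGaussianSpace P G) (hV : MemLp V 2 P)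
    (hVG : ∀ h, coord hV h ∈ G) (hR : R.IsPositive) (hinj : ∀ x, R x = 0 → x = 0)
    (hcov : ∀ h, ‖coord hV h‖ ^ 2 = inner ℝ (R h) h) : IsCenteredGaussian (P.map V) R where
  isPositive := hR
  injective := hinj
  memLp := (memLp_map_measure_iff (aestronglyMeasurable_id) hV.1.aemeasurable).2 hV
  integral_sq c := by
    rw [integral_map hV.1.aemeasurable (by fun_prop), ← hcov, norm_sq_Lp_eq]
    refine integral_congr_ae ?_
    filter_upwards [coeFn_coord hV c] with ω hω
    rw [hω]
  integral_exp c := by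
    rw [integral_map hV.1.aemeasurable (by fun_prop), integral_exp_inner hG hV hVG, hcov]

/-- The characteristic function of such a vector depends only on the variances of its coordinates,
and it determines the law. -/
theorem map_eq_of_norm_coord_eq (hG : IsGaussianSpace P G) (hV : MemLp V 2 P)
    (hVG : ∀ h, coord hV h ∈ G) {U : Ω → H} (hU : MemLp U 2 P) (hUG : ∀ h, coord hU h ∈ G)
    (hcov : ∀ h, ‖coord hV h‖ ^ 2 = ‖coord hU h‖ ^ 2) : P.map V = P.map U := by
  have := Measure.isProbabilityMeasure_map hV.1.aemeasurable
  have := Measure.isProbabilityMeasure_map hU.1.aemeasurable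
  refine Measure.ext_of_charFun (funext fun h => ?_)
  rw [charFun_map_eq hG hV hVG, charFun_map_eq hG hU hUG, hcov]

/-- Every continuous functional of the pair splits, by Riesz, into inner products with the `U j` and
with `V`. The two parts are orthogonal elements of `G`, so their squared norms add and the
characteristic function factorises. -/
theorem indepFun_of_inner_coord_eq_zero (hG : IsGaussianSpace P G) {m : ℕ} {U : Fin m → Ω → H}
    (hU : ∀ j, MemLp (U j) 2 P) (hUG : ∀ j h, coord (hU j) h ∈ G) (hV : MemLp V 2 P)
    (hVG : ∀ h, coord hV h ∈ G)
    (horth : ∀ j h g, inner ℝ (coord (hU j) h) (coord hV g) = 0) :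
    IndepFun (fun ω j => U j ω) V P := by
  have hUm : AEMeasurable (fun ω j => U j ω) P :=
    aemeasurable_pi_lambda _ fun j => (hU j).1.aemeasurable
  rw [indepFun_iff_charFunDual_prod hUm hV.1.aemeasurable]
  intro L
  obtain ⟨g, hg⟩ := (InnerProductSpace.toDual ℝ H).surjective (L.comp (.inr ℝ (Fin m → H) H))
  have hg' : ∀ y, L (0, y) = inner ℝ g y := fun y => by
    have := congrArg (fun f : H →L[ℝ] ℝ => f y) hg
    simpa using this.symm
  have hex : ∀ j, ∃ c : H, ∀ y, L (Pi.single j y, 0) = inner ℝ c y := fun j => by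
    obtain ⟨c, hc⟩ := (InnerProductSpace.toDual ℝ H).surjective
      ((L.comp (.inl ℝ (Fin m → H) H)).comp (ContinuousLinearMap.single ℝ (fun _ => H) j))
    refine ⟨c, fun y => ?_⟩
    have := congrArg (fun f : H →L[ℝ] ℝ => f y) hc
    simpa using this.symm
  choose c hc using hex
  have hL1 : ∀ u : Fin m → H, L (u, 0) = ∑ j, inner ℝ (c j) (u j) := fun u => by
    have h1 : (L.comp (.inl ℝ (Fin m → H) H)) u = L (u, 0) := rfl
    rw [← h1]
    conv_lhs => rw [← Finset.univ_sum_single u]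
    rw [map_sum]
    exact Finset.sum_congr rfl fun j _ => hc j (u j)
  set X : Lp ℝ 2 P := ∑ j, coord (hU j) (c j) with hX
  have hXG : X ∈ G := Submodule.sum_mem _ fun j _ => hUG j _
  have hXeq : X =ᵐ[P] fun ω => L ((fun j => U j ω), 0) := by
    refine (Lp.coeFn_fun_finsetSum _ _).trans ?_
    have h1 : ∀ᵐ ω ∂P, ∀ j, coord (hU j) (c j) ω = inner ℝ (c j) (U j ω) :=
      ae_all_iff.2 fun j => coeFn_coord (hU j) (c j)
    filter_upwards [h1] with ω hω
    rw [hL1]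
    exact Finset.sum_congr rfl fun j _ => hω j
  have hXY : inner ℝ X (coord hV g) = 0 := by
    rw [hX, sum_inner]
    exact Finset.sum_eq_zero fun j _ => horth j _ _
  rw [charFunDual_apply, charFunDual_apply, charFunDual_apply,
    integral_map (hUm.prodMk hV.1.aemeasurable) (by fun_prop), integral_map hUm (by fun_prop),
    integral_map hV.1.aemeasurable (by fun_prop)]
  have e1 : ∫ ω, Complex.exp (L ((fun j => U j ω), V ω) * Complex.I) ∂P
      = Complex.exp (-(‖X + coord hV g‖ ^ 2 / 2 : ℝ)) := by
    rw [← hG _ (G.add_mem hXG (hVG g))]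
    refine integral_congr_ae ?_
    filter_upwards [hXeq, coeFn_coord hV g, Lp.coeFn_add X (coord hV g)] with ω h1 h2 h3
    rw [h3, Pi.add_apply, h1, h2, ← hg', ← map_add, Prod.mk_add_mk, add_zero, zero_add]
  have e2 : ∫ ω, Complex.exp (((L.comp (.inl ℝ (Fin m → H) H)) fun j => U j ω) * Complex.I) ∂P
      = Complex.exp (-(‖X‖ ^ 2 / 2 : ℝ)) := by
    rw [← hG _ hXG]
    refine integral_congr_ae ?_
    filter_upwards [hXeq] with ω h1
    rw [h1]
    rfl
  have e3 : ∫ ω, Complex.exp (((L.comp (.inr ℝ (Fin m → H) H)) (V ω)) * Complex.I) ∂P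
      = Complex.exp (-(‖coord hV g‖ ^ 2 / 2 : ℝ)) := by
    rw [← integral_exp_inner hG hV hVG]
    simp only [← hg']
    rfl
  rw [e1, e2, e3, ← Complex.exp_add, norm_add_sq_real, hXY]
  congr 1
  push_cast
  ring

end GaussianVectors

/-! ### Independence and law of the increments -/

section StochasticConvolution

variable {H : Type*} [NormedAddCommGroup H] [InnerProductSpace ℝ H] [CompleteSpace H]
  [SecondCountableTopology H] [MeasurableSpace H] [BorelSpace H]
  {Ω : Type*} [MeasurableSpace Ω] {P : Measure Ω} [IsProbabilityMeasure P]
  {ι : Type*} {W : ι → ℝ≥0 → Ω → ℝ} {T : ℝ → H →L[ℝ] H} {Q : H →L[ℝ] H}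
  {e : HilbertBasis ι ℝ H} {WA : ℝ → Ω → H}

namespace IsStochasticConvolution

theorem norm_coord_sq (hT : IsC0Semigroup T) (hQ : Q.IsPositive) (hW : IsCylindricalBM W P)
    (hWA : IsStochasticConvolution P T Q e W WA) {t : ℝ} (ht : 0 ≤ t) (h : H) :
    ‖coord (hWA.memLp ht) h‖ ^ 2 = inner ℝ (covOp T Q t h) h := by
  rw [← real_inner_self_eq_norm_sq, hWA.inner_coord hT hQ hW ht ht, min_self,
    inner_covOp hT hQ h h ht, intervalIntegral.integral_of_le ht,
    ← setIntegral_Ioc_comp_sub (covDensity T Q h h) ht]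
  rfl

theorem isCenteredGaussian (hT : IsC0Semigroup T) (hQ : Q.IsPositive)
    (hQker : LinearMap.ker Q.toLinearMap = ⊥) (hW : IsCylindricalBM W P)
    (hWA : IsStochasticConvolution P T Q e W WA) {t : ℝ} (ht : 0 < t) :
    IsCenteredGaussian (P.map (WA t)) (covOp T Q t) :=
  isCenteredGaussian_map hW.isGaussianSpace (hWA.memLp ht.le) (hWA.coord_mem hW ht.le)
    (covOp_isPositive hT hQ ht.le) (covOp_injective hT hQ hQker ht)
    (hWA.norm_coord_sq hT hQ hW ht.le)

/-- The increment `W_A(t) - e^{(t-s)A} W_A(s)`. -/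
def increment (T : ℝ → H →L[ℝ] H) (WA : ℝ → Ω → H) (s t : ℝ) (ω : Ω) : H :=
  WA t ω - T (t - s) (WA s ω)

variable {s t : ℝ}

theorem memLp_increment (hWA : IsStochasticConvolution P T Q e W WA) (hs : 0 ≤ s) (hst : s ≤ t) :
    MemLp (increment T WA s t) 2 P :=
  (hWA.memLp (hs.trans hst)).sub ((T (t - s)).comp_memLp' (hWA.memLp hs))

theorem coord_increment (hWA : IsStochasticConvolution P T Q e W WA) (hs : 0 ≤ s) (hst : s ≤ t)
    (h : H) : coord (hWA.memLp_increment hs hst) h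
      = coord (hWA.memLp (hs.trans hst)) h - coord (hWA.memLp hs) ((T (t - s)).adjoint h) := by
  refine Lp.ext ?_
  filter_upwards [coeFn_coord (hWA.memLp_increment hs hst) h,
    coeFn_coord (hWA.memLp (hs.trans hst)) h, coeFn_coord (hWA.memLp hs) ((T (t - s)).adjoint h),
    Lp.coeFn_sub (coord (hWA.memLp (hs.trans hst)) h)
      (coord (hWA.memLp hs) ((T (t - s)).adjoint h))] with ω h1 h2 h3 h4
  rw [h1, h4, Pi.sub_apply, h2, h3, increment, inner_sub_right,
    ContinuousLinearMap.adjoint_inner_left]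

theorem coord_increment_mem (hW : IsCylindricalBM W P)
    (hWA : IsStochasticConvolution P T Q e W WA) (hs : 0 ≤ s) (hst : s ≤ t) (h : H) :
    coord (hWA.memLp_increment hs hst) h ∈ hW.space := by
  rw [hWA.coord_increment hs hst]
  exact Submodule.sub_mem _ (hWA.coord_mem hW (hs.trans hst) _) (hWA.coord_mem hW hs _)

/-- For `u ≤ r ≤ s` the semigroup law gives `e^{(t-u)A*} = e^{(s-u)A*} e^{(t-s)A*}`. Hence `W_A(t)`
and `e^{(t-s)A} W_A(s)` have the same covariance with `W_A(r)`. -/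
theorem inner_coord_increment (hT : IsC0Semigroup T) (hQ : Q.IsPositive)
    (hW : IsCylindricalBM W P) (hWA : IsStochasticConvolution P T Q e W WA) {r : ℝ} (hr : 0 ≤ r)
    (hrs : r ≤ s) (hst : s ≤ t) (g h : H) : inner ℝ (coord (hWA.memLp hr) g)
      (coord (hWA.memLp_increment (hr.trans hrs) hst) h) = 0 := by
  rw [hWA.coord_increment (hr.trans hrs) hst, inner_sub_right,
    hWA.inner_coord hT hQ hW hr ((hr.trans hrs).trans hst),
    hWA.inner_coord hT hQ hW hr (hr.trans hrs),
    min_eq_left hrs, min_eq_left (hrs.trans hst), sub_eq_zero]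
  refine setIntegral_congr_fun measurableSet_Ioc fun u hu => ?_
  have h1 : t - u = (t - s) + (s - u) := by ring
  simp only [h1]
  rw [hT.adjoint_apply_add (sub_nonneg.2 hst) (sub_nonneg.2 (hu.2.trans hrs))]

/-- Pythagoras for `W_A(t) = e^{(t-s)A} W_A(s) + increment`, compared with `Q_t = Q_{t-s} +
e^{(t-s)A} Q_s e^{(t-s)A*}`. -/
theorem norm_coord_increment_sq (hT : IsC0Semigroup T) (hQ : Q.IsPositive)
    (hW : IsCylindricalBM W P) (hWA : IsStochasticConvolution P T Q e W WA) (hs : 0 ≤ s)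
    (hst : s ≤ t) (h : H) : ‖coord (hWA.memLp_increment hs hst) h‖ ^ 2
      = ‖coord (hWA.memLp (sub_nonneg.2 hst)) h‖ ^ 2 := by
  have h1 := hWA.inner_coord_increment hT hQ hW hs le_rfl hst ((T (t - s)).adjoint h) h
  have h2 : coord (hWA.memLp (hs.trans hst)) h = coord (hWA.memLp hs) ((T (t - s)).adjoint h)
      + coord (hWA.memLp_increment hs hst) h := by
    rw [hWA.coord_increment hs hst, add_sub_cancel]
  have h3 := congrArg (fun X => ‖X‖ ^ 2) h2
  simp only [norm_add_sq_real, h1] at h3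
  rw [hWA.norm_coord_sq hT hQ hW (hs.trans hst), hWA.norm_coord_sq hT hQ hW hs] at h3
  rw [hWA.norm_coord_sq hT hQ hW (sub_nonneg.2 hst)]
  have h4 := inner_covOp_add hT hQ h h (sub_nonneg.2 hst) hs
  rw [sub_add_cancel] at h4
  linarith

/-- The increment is independent of the past, with the law of `W_A(t - s)`. -/
theorem map_prodMk_increment (hT : IsC0Semigroup T) (hQ : Q.IsPositive)
    (hW : IsCylindricalBM W P) (hWA : IsStochasticConvolution P T Q e W WA) {m : ℕ}
    {τ : Fin m → ℝ} (hτ : ∀ j, 0 ≤ τ j) (hτs : ∀ j, τ j ≤ s) (hs : 0 ≤ s) (hst : s ≤ t) :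
    P.map (fun ω => ((fun j => WA (τ j) ω), increment T WA s t ω))
      = (P.map fun ω j => WA (τ j) ω).prod (P.map (WA (t - s))) := by
  have hind := indepFun_of_inner_coord_eq_zero hW.isGaussianSpace (U := fun j => WA (τ j))
    (fun j => hWA.memLp (hτ j)) (fun j => hWA.coord_mem hW (hτ j)) (hWA.memLp_increment hs hst)
    (hWA.coord_increment_mem hW hs hst)
    fun j g h => hWA.inner_coord_increment hT hQ hW (hτ j) (hτs j) hst g h
  rw [indepFun_iff_map_prod_eq_prod_map_map
    (aemeasurable_pi_lambda _ fun j => (hWA.memLp (hτ j)).1.aemeasurable)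
    (hWA.memLp_increment hs hst).1.aemeasurable] at hind
  rw [hind, map_eq_of_norm_coord_eq hW.isGaussianSpace (hWA.memLp_increment hs hst)
    (hWA.coord_increment_mem hW hs hst) (hWA.memLp (sub_nonneg.2 hst)) (hWA.coord_mem hW (sub_nonneg.2 hst))
    (hWA.norm_coord_increment_sq hT hQ hW hs hst)]

end IsStochasticConvolution

end StochasticConvolution

section Measurability

variable {H : Type*} [NormedAddCommGroup H] [InnerProductSpace ℝ H] [CompleteSpace H]
  [SecondCountableTopology H] [MeasurableSpace H] [BorelSpace H]

/-! ### Measurable families of measures -/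

/-- Closed sets form a generating π-system, and the indicator of a closed set is a limit of bounded
continuous functions. -/
theorem measurable_of_measurable_integral {α : Type*} [MeasurableSpace α] {μ : α → Measure H}
    [∀ a, IsProbabilityMeasure (μ a)]
    (h : ∀ g : BoundedContinuousFunction H ℝ, Measurable fun a => ∫ y, g y ∂μ a) :
    Measurable μ := by
  refine Measurable.measure_of_isPiSystem_of_isProbabilityMeasure
    ((BorelSpace.measurable_eq (α := H)).trans borel_eq_generateFrom_isClosed) isPiSystem_isClosed
    fun F hF => ?_
  have hF : IsClosed F := hF
  refine measurable_of_tendsto_metrizable (f := fun n a => ∫⁻ y, hF.apprSeq n y ∂μ a) (fun n => ?_)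
    (tendsto_pi_nhds.2 fun a => HasOuterApproxClosed.tendsto_lintegral_apprSeq hF (μ a))
  have h1 : (fun a => ∫⁻ y, (hF.apprSeq n y : ℝ≥0∞) ∂μ a)
      = fun a => ENNReal.ofReal (∫ y, (hF.apprSeq n y : ℝ) ∂μ a) := by
    funext a
    rw [← BoundedContinuousFunction.toReal_lintegral_coe_eq_integral, ENNReal.ofReal_toReal]
    exact (BoundedContinuousFunction.lintegral_lt_top_of_nnreal (μ a) (hF.apprSeq n)).ne
  rw [h1]
  refine ENNReal.measurable_ofReal.comp ?_
  exact h (BoundedContinuousFunction.ofNormedAddCommGroup (fun y => (hF.apprSeq n y : ℝ))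
    (NNReal.continuous_coe.comp (hF.apprSeq n).continuous) 1 fun y => by
      have := HasOuterApproxClosed.apprSeq_apply_le_one hF n y
      simpa using this)

/-- After projection to a finite-dimensional space, pointwise convergence of characteristic
functions implies weak convergence. In infinite dimensions this would fail without tightness, so
test functions are first composed with projections. -/
theorem tendsto_integral_starProjection {ν : ℕ → Measure H} {ν₀ : Measure H}
    [∀ n, IsProbabilityMeasure (ν n)] [IsProbabilityMeasure ν₀]
    (h : ∀ c, Tendsto (fun n => charFun (ν n) c) atTop (𝓝 (charFun ν₀ c)))
    (S : Submodule ℝ H) [FiniteDimensional ℝ S] (g : BoundedContinuousFunction H ℝ) :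
    Tendsto (fun n => ∫ y, g (S.starProjection y) ∂ν n) atTop
      (𝓝 (∫ y, g (S.starProjection y) ∂ν₀)) := by
  have hm : Measurable S.orthogonalProjectionOnto := S.orthogonalProjectionOnto.continuous.measurable
  have hpm : ∀ ν : Measure H, IsProbabilityMeasure ν →
      IsProbabilityMeasure (ν.map S.orthogonalProjectionOnto) := fun ν _ =>
    Measure.isProbabilityMeasure_map hm.aemeasurable
  have hchar : ∀ (ν : Measure H) (c : S),
      charFun (ν.map S.orthogonalProjectionOnto) c = charFun ν (c : H) := fun ν c => by
    rw [charFun_apply, charFun_apply, integral_map hm.aemeasurable (by fun_prop)]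
    simp only [Submodule.coe_inner, ← Submodule.starProjection_apply]
    congr 1
    funext y
    have h1 := Submodule.starProjection_inner_eq_zero (K := S) y c c.2
    rw [inner_sub_left, sub_eq_zero] at h1
    rw [h1]
  have hint : ∀ ν : Measure H, ∫ y, g (S.starProjection y) ∂ν
      = ∫ z : S, g z ∂(ν.map S.orthogonalProjectionOnto) := fun ν => by
    have hg : Measurable fun z : S => g z := (g.continuous.comp continuous_subtype_val).measurable
    rw [integral_map hm.aemeasurable hg.aestronglyMeasurable]
    rfl
  let p : (ν : Measure H) → IsProbabilityMeasure ν → ProbabilityMeasure S := fun ν hν =>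
    ⟨ν.map S.orthogonalProjectionOnto, hpm ν hν⟩
  have hlim : Tendsto (fun n => p (ν n) inferInstance) atTop (𝓝 (p ν₀ inferInstance)) := by
    refine ProbabilityMeasure.tendsto_of_tendsto_charFun fun c => ?_
    simp only [p, ProbabilityMeasure.coe_mk, hchar]
    exact h c
  have h2 := ProbabilityMeasure.tendsto_iff_forall_integral_tendsto.1 hlim
    (g.compContinuous ⟨Subtype.val, continuous_subtype_val⟩)
  simp only [hint]
  exact h2

theorem exists_finiteDimensional_tendsto (H : Type*) [NormedAddCommGroup H]
    [InnerProductSpace ℝ H] [CompleteSpace H] [SecondCountableTopology H] :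
    ∃ U : ℕ → Submodule ℝ H, ∃ _ : ∀ n, FiniteDimensional ℝ (U n),
      ∀ x, Tendsto (fun n => (U n).starProjection x) atTop (𝓝 x) := by
  let U : ℕ → Submodule ℝ H := fun n => Submodule.span ℝ (TopologicalSpace.denseSeq H '' Iic n)
  have hU : ∀ n, FiniteDimensional ℝ (U n) := fun n =>
    FiniteDimensional.span_of_finite ℝ ((finite_Iic n).image _)
  refine ⟨U, hU, fun x => Submodule.starProjection_tendsto_self U (fun m n hmn =>
    Submodule.span_mono (image_mono (Iic_subset_Iic.2 hmn))) x ?_⟩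
  intro y _
  refine closure_mono ?_ (TopologicalSpace.denseRange_denseSeq H y)
  rintro _ ⟨n, rfl⟩
  exact Submodule.mem_iSup_of_mem n (Submodule.subset_span ⟨n, mem_Iic.2 le_rfl, rfl⟩)

end Measurability

/-! ### The transition kernel and its smoothing property -/

section StochasticConvolution

variable {H : Type*} [NormedAddCommGroup H] [InnerProductSpace ℝ H] [CompleteSpace H]
  [SecondCountableTopology H] [MeasurableSpace H] [BorelSpace H]
  {Ω : Type*} [MeasurableSpace Ω] {P : Measure Ω} [IsProbabilityMeasure P]
  {ι : Type*} {W : ι → ℝ≥0 → Ω → ℝ} {T : ℝ → H →L[ℝ] H} {Q : H →L[ℝ] H}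
  {e : HilbertBasis ι ℝ H} {WA : ℝ → Ω → H}

theorem continuous_inner_covOp (hT : IsC0Semigroup T) (hQ : Q.IsPositive) (h : H) :
    Continuous fun t => inner ℝ (covOp T Q (max t 0) h) h := by
  have h1 : ContinuousOn (fun t => inner ℝ (covOp T Q t h) h) (Ici 0) := by
    intro a ha
    have ha1 : (0 : ℝ) ≤ a + 1 := by linarith [mem_Ici.1 ha]
    have h2 := intervalIntegral.continuousOn_primitive_interval'
      (intervalIntegrable_covDensity hT hQ h h ha1) left_mem_uIcc
    rw [uIcc_of_le ha1] at h2
    have h3 : ContinuousOn (fun t => inner ℝ (covOp T Q t h) h) (Icc 0 (a + 1)) :=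
      h2.congr fun t ht => inner_covOp hT hQ h h ht.1
    refine (h3 a ⟨ha, by linarith⟩).mono_of_mem_nhdsWithin ?_
    rw [← Ici_inter_Iic]
    exact inter_mem_nhdsWithin _ (Iic_mem_nhds (by linarith))
  exact h1.comp_continuous (by fun_prop) fun t => le_max_right t 0

theorem IsC0Semigroup.continuous_apply (hT : IsC0Semigroup T) (x : H) :
    Continuous fun t => T (max t 0) x :=
  (hT.strongly_continuous x).comp_continuous (by fun_prop) fun t => le_max_right t 0

namespace IsStochasticConvolution

theorem aemeasurable_proc (hWA : IsStochasticConvolution P T Q e W WA) {t : ℝ} (ht : 0 ≤ t)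
    (x : H) : AEMeasurable (proc T WA x t) P :=
  (hWA.memLp ht).1.aemeasurable.const_add _

theorem charFun_map_proc (hT : IsC0Semigroup T) (hQ : Q.IsPositive) (hW : IsCylindricalBM W P)
    (hWA : IsStochasticConvolution P T Q e W WA) {t : ℝ} (ht : 0 ≤ t) (x h : H) :
    charFun (P.map (proc T WA x t)) h
      = Complex.exp ((inner ℝ (T t x) h : ℝ) * Complex.I)
        * Complex.exp (-(inner ℝ (covOp T Q t h) h / 2 : ℝ)) := by
  rw [← hWA.norm_coord_sq hT hQ hW ht, ← charFun_map_eq hW.isGaussianSpace (hWA.memLp ht)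
    (hWA.coord_mem hW ht), charFun_apply, charFun_apply,
    integral_map (hWA.aemeasurable_proc ht x) (by fun_prop),
    integral_map (hWA.memLp ht).1.aemeasurable (by fun_prop), ← integral_const_mul]
  congr 1
  funext ω
  rw [proc, inner_add_left, ← Complex.exp_add]
  congr 1
  push_cast
  ring

theorem continuous_integral_starProjection (hT : IsC0Semigroup T) (hQ : Q.IsPositive)
    (hW : IsCylindricalBM W P) (hWA : IsStochasticConvolution P T Q e W WA) (S : Submodule ℝ H)
    [FiniteDimensional ℝ S] (g : BoundedContinuousFunction H ℝ) (x : H) :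
    Continuous fun t => ∫ y, g (S.starProjection y) ∂(P.map (proc T WA x (max t 0))) := by
  rw [continuous_iff_seqContinuous]
  intro u a hu
  have hpm : ∀ t : ℝ, IsProbabilityMeasure (P.map (proc T WA x (max t 0))) := fun t =>
    Measure.isProbabilityMeasure_map (hWA.aemeasurable_proc (le_max_right t 0) x)
  refine tendsto_integral_starProjection (fun c => ?_) S g
  simp only [hWA.charFun_map_proc hT hQ hW (le_max_right _ 0)]
  have h1 : Continuous fun t => Complex.exp ((inner ℝ (T (max t 0) x) c : ℝ) * Complex.I)
        * Complex.exp (-(inner ℝ (covOp T Q (max t 0) c) c / 2 : ℝ)) := by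
    have h2 := continuous_inner_covOp hT hQ c
    have h3 : Continuous fun t => inner ℝ (T (max t 0) x) c :=
      (hT.continuous_apply x).inner continuous_const
    fun_prop
  exact (h1.tendsto a).comp hu

/-- Each `W_A(t)` is given only up to a version, so no path regularity in `t` is available and the
argument uses laws alone. For bounded continuous `g` the expectation is continuous in `x`. In `t` it
is a limit of the continuous functions obtained by projecting to finite dimensions. Continuity in
one variable and measurability in the other give joint measurability. -/
theorem measurable_map_proc (hT : IsC0Semigroup T) (hQ : Q.IsPositive)
    (hW : IsCylindricalBM W P) (hWA : IsStochasticConvolution P T Q e W WA) :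
    Measurable fun q : ℝ × H => P.map (proc T WA q.2 (max q.1 0)) := by
  have hpm : ∀ q : ℝ × H, IsProbabilityMeasure (P.map (proc T WA q.2 (max q.1 0))) := fun q =>
    Measure.isProbabilityMeasure_map (hWA.aemeasurable_proc (le_max_right q.1 0) q.2)
  obtain ⟨U, hU, hUx⟩ := exists_finiteDimensional_tendsto H
  refine measurable_of_measurable_integral fun g => ?_
  have h1 : ∀ x, Measurable fun t => ∫ y, g y ∂(P.map (proc T WA x (max t 0))) := fun x => by
    refine measurable_of_tendsto_metrizable (fun n =>
      (hWA.continuous_integral_starProjection hT hQ hW (U n) g x).measurable)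
      (tendsto_pi_nhds.2 fun t => ?_)
    have := hpm (t, x)
    refine tendsto_integral_of_dominated_convergence (fun _ => ‖g‖) (fun n => ?_)
      (integrable_const _) (fun n => Eventually.of_forall fun y => g.norm_coe_le_norm _)
      (Eventually.of_forall fun y => (g.continuous.tendsto y).comp (hUx y))
    exact (g.continuous.comp (U n).starProjection.continuous).measurable.aestronglyMeasurable
  have h2 : ∀ t, Continuous fun x => ∫ y, g y ∂(P.map (proc T WA x (max t 0))) := fun t => by
    have h3 : ∀ x, ∫ y, g y ∂(P.map (proc T WA x (max t 0)))
        = ∫ ω, g (T (max t 0) x + WA (max t 0) ω) ∂P := fun x =>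
      integral_map (hWA.aemeasurable_proc (le_max_right t 0) x)
        g.continuous.measurable.aestronglyMeasurable
    simp only [h3]
    refine continuous_of_dominated (bound := fun _ => ‖g‖) (fun x => ?_)
      (fun x => Eventually.of_forall fun ω => g.norm_coe_le_norm _) (integrable_const _)
      (Eventually.of_forall fun ω => by fun_prop)
    exact (g.continuous.measurable.comp_aemeasurable
      (hWA.aemeasurable_proc (le_max_right t 0) x)).aestronglyMeasurable
  exact ((stronglyMeasurable_uncurry_of_continuous_of_stronglyMeasurable
    (u := fun x t => ∫ y, g y ∂(P.map (proc T WA x (max t 0)))) h2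
    fun x => (h1 x).stronglyMeasurable).measurable.comp measurable_swap)

/-- The transition kernel of the process `Z`. -/
def kernel (hT : IsC0Semigroup T) (hQ : Q.IsPositive) (hW : IsCylindricalBM W P)
    (hWA : IsStochasticConvolution P T Q e W WA) : Kernel (ℝ × H) H where
  toFun q := P.map (proc T WA q.2 (max q.1 0))
  measurable' := hWA.measurable_map_proc hT hQ hW

variable (hT : IsC0Semigroup T) (hQ : Q.IsPositive) (hW : IsCylindricalBM W P)
  (hWA : IsStochasticConvolution P T Q e W WA)

instance : IsMarkovKernel (hWA.kernel hT hQ hW) where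
  isProbabilityMeasure q :=
    Measure.isProbabilityMeasure_map (hWA.aemeasurable_proc (le_max_right q.1 0) q.2)

theorem transOp_eq_semi {t : ℝ} (ht : 0 ≤ t) {f : H → ℝ} (hf : Measurable f) (x : H) :
    transOp P T WA t f x = semi (hWA.kernel hT hQ hW) t f x := by
  have h : hWA.kernel hT hQ hW (t, x) = P.map (proc T WA x (max t 0)) := rfl
  rw [semi, h, max_eq_left ht,
    integral_map (hWA.aemeasurable_proc ht x) hf.stronglyMeasurable.aestronglyMeasurable]
  rfl

theorem semi_eq_integral {t : ℝ} (ht : 0 ≤ t) {f : H → ℝ} (hf : Measurable f) :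
    semi (hWA.kernel hT hQ hW) t f = fun x => ∫ y, f (T t x + y) ∂(P.map (WA t)) := by
  funext x
  rw [← hWA.transOp_eq_semi hT hQ hW ht hf, transOp, integral_map (hWA.memLp ht).1.aemeasurable
    (by fun_prop : Measurable fun y => f (T t x + y)).stronglyMeasurable.aestronglyMeasurable]
  rfl

open Classical in
/-- The function `t ↦ ‖Λ(t)‖`, extended by `0` to `t ≤ 0`. -/
def lamNorm (T : ℝ → H →L[ℝ] H) (Q : H →L[ℝ] H) (t : ℝ) : ℝ := if 0 < t then ‖Lam T Q t‖ else 0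

theorem lamNorm_of_pos {t : ℝ} (ht : 0 < t) : lamNorm T Q t = ‖Lam T Q t‖ := if_pos ht

theorem lamNorm_nonneg (t : ℝ) : 0 ≤ lamNorm T Q t := by
  rw [lamNorm]
  split_ifs
  · exact norm_nonneg _
  · exact le_rfl

/-- For `a > 0` the set where the function is at least `a` is an interval, because `‖Λ‖` is antitone
on positive times; for `a ≤ 0` it is everything. -/
theorem isSingular_lamNorm (hT : IsC0Semigroup T) (hQ : Q.IsPositive)
    (hQker : LinearMap.ker Q.toLinearMap = ⊥)
    (hrange : ∀ t : ℝ, 0 < t → range (T t) ⊆ range (opSqrt (covOp T Q t))) {δ C : ℝ} (hC : 0 < C)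
    (hΛ : ∀ t : ℝ, 0 < t → ‖Lam T Q t‖ ≤ C / t ^ δ) : IsSingular δ (lamNorm T Q) where
  measurable := by
    refine measurable_of_Ici fun a => ?_
    rcases le_or_gt a 0 with ha | ha
    · have : lamNorm T Q ⁻¹' Ici a = univ := eq_univ_of_forall fun t =>
        ha.trans (lamNorm_nonneg t)
      rw [this]
      exact MeasurableSet.univ
    · refine OrdConnected.measurableSet ⟨fun s hs t ht u hu => ?_⟩
      have hpos : ∀ {r}, r ∈ lamNorm T Q ⁻¹' Ici a → 0 < r := fun {r} hr => by
        by_contra h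
        have hr : a ≤ lamNorm T Q r := hr
        rw [lamNorm, if_neg h] at hr
        linarith
      have hu0 : 0 < u := (hpos hs).trans_le hu.1
      have h1 : a ≤ lamNorm T Q t := ht
      rw [mem_preimage, mem_Ici, lamNorm_of_pos hu0]
      rw [lamNorm_of_pos (hpos ht)] at h1
      exact h1.trans (antitoneOn_norm_Lam hT hQ hQker hrange hu0 (hpos ht) hu.2)
  nonneg := lamNorm_nonneg
  bound t₀ _ := ⟨C, hC.le, fun t ht _ => by
    rw [lamNorm_of_pos ht, Real.rpow_neg ht.le, ← div_eq_mul_inv]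
    exact hΛ t ht⟩

theorem isSmoothing (hQker : LinearMap.ker Q.toLinearMap = ⊥)
    (hrange : ∀ t : ℝ, 0 < t → range (T t) ⊆ range (opSqrt (covOp T Q t))) {δ C : ℝ}
    (hδ0 : 0 < δ) (hδ1 : δ < 1) (hC : 0 < C) (hΛ : ∀ t : ℝ, 0 < t → ‖Lam T Q t‖ ≤ C / t ^ δ) :
    IsSmoothing (hWA.kernel hT hQ hW) δ (lamNorm T Q) where
  pos := hδ0
  lt_one := hδ1
  isSingular := isSingular_lamNorm hT hQ hQker hrange hC hΛ
  differentiable t ht f hf M hM0 hM := by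
    have := Measure.isProbabilityMeasure_map (hWA.memLp ht.le).1.aemeasurable
    rw [hWA.semi_eq_integral hT hQ hW ht.le hf]
    exact (hWA.isCenteredGaussian hT hQ hQker hW ht).differentiable_integral
      (opSqrt_Lam_apply (hrange t ht)) hf hM0 hM
  norm_fderiv_le t ht f hf M hM0 hM x := by
    have := Measure.isProbabilityMeasure_map (hWA.memLp ht.le).1.aemeasurable
    rw [hWA.semi_eq_integral hT hQ hW ht.le hf, lamNorm_of_pos ht]
    exact (hWA.isCenteredGaussian hT hQ hQker hW ht).norm_fderiv_integral_le
      (opSqrt_Lam_apply (hrange t ht)) hf hM0 hM x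

end IsStochasticConvolution

end StochasticConvolution

/-! ### Integrals over the simplex -/

section Simplex

theorem measurable_times {n : ℕ} (t : ℝ) (j : Fin (n + 2)) :
    Measurable fun r : Fin n → ℝ => times t r j := by
  refine Fin.cases ?_ (fun j => ?_) j
  · exact measurable_const
  · refine Fin.lastCases ?_ (fun i => ?_) j
    · simp only [times, Fin.cons_succ, Fin.snoc_last]
      exact measurable_const
    · simp only [times, Fin.cons_succ, Fin.snoc_castSucc]
      exact measurable_pi_apply i

theorem measurable_gap {n : ℕ} (t : ℝ) (i : Fin (n + 1)) :
    Measurable fun r : Fin n → ℝ => gap t r i :=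
  (measurable_times t _).sub (measurable_times t _)

theorem mem_simplex_iff {n : ℕ} {t : ℝ} {r : Fin n → ℝ} :
    r ∈ simplex n t ↔ ∀ i, 0 < gap t r i := by
  simp only [simplex, mem_ofPred_eq, Fin.strictMono_iff_lt_succ, gap, sub_pos]

theorem measurableSet_simplex (n : ℕ) (t : ℝ) : MeasurableSet (simplex n t) := by
  have h : simplex n t = ⋂ i, {r | 0 < gap t r i} := by
    ext r
    simp only [mem_simplex_iff, mem_iInter, mem_ofPred_eq]
  rw [h]
  exact MeasurableSet.iInter fun i => measurableSet_lt measurable_const (measurable_gap t i)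

/-- Tonelli after splitting off the last coordinate, whose sections are smaller simplices. -/
theorem lintegral_simplex_succ {n : ℕ} {t : ℝ} {F : (Fin (n + 1) → ℝ) → ℝ≥0∞}
    (hF : Measurable F) :
    ∫⁻ r in simplex (n + 1) t, F r
      = ∫⁻ s in Ioo 0 t, ∫⁻ r in simplex n s, F (Fin.snoc (α := fun _ => ℝ) r s) := by
  have hG : Measurable ((simplex (n + 1) t).indicator F) :=
    hF.indicator (measurableSet_simplex _ _)
  have hmp := (volume_preserving_piFinSuccAbove (fun _ : Fin (n + 1) => ℝ) (Fin.last n)).symm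
  rw [← lintegral_indicator (measurableSet_simplex _ _), ← hmp.lintegral_comp hG,
    Measure.volume_eq_prod]
  rw [lintegral_prod (fun a => (simplex (n + 1) t).indicator F
      ((MeasurableEquiv.piFinSuccAbove (fun _ => ℝ) (Fin.last n)).symm a))
      (hG.comp hmp.measurable).aemeasurable,
    ← lintegral_indicator measurableSet_Ioo]
  refine lintegral_congr fun s => ?_
  have hsymm : ∀ r : Fin n → ℝ,
      (MeasurableEquiv.piFinSuccAbove (fun _ : Fin (n + 1) => ℝ) (Fin.last n)).symm (s, r)
        = Fin.snoc (α := fun _ => ℝ) r s := fun r =>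
    Fin.insertNth_last' s r
  by_cases hs : s ∈ Ioo 0 t
  · rw [indicator_of_mem hs, ← lintegral_indicator (measurableSet_simplex _ _)]
    refine lintegral_congr fun r => ?_
    rw [hsymm]
    by_cases hr : r ∈ simplex n s
    · rw [indicator_of_mem hr, indicator_of_mem (mem_simplex_snoc.2 ⟨hr, hs.2⟩)]
    · rw [indicator_of_notMem hr, indicator_of_notMem fun h => hr (mem_simplex_snoc.1 h).1]
  · rw [indicator_of_notMem hs]
    refine (lintegral_congr fun r => ?_).trans lintegral_zero
    rw [hsymm]
    refine indicator_of_notMem (fun h => hs ?_) _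
    obtain ⟨h1, h2⟩ := mem_simplex_snoc.1 h
    exact ⟨pos_of_mem_simplex h1, h2⟩

variable {δ : ℝ} {lam : ℝ → ℝ}

/-- Working with `lintegral` avoids presupposing integrability over the simplex, which is then read
off from the finite value. -/
theorem lintegral_simplex_prod_gap (hδ0 : 0 < δ) (hδ : δ < 1) (hl : IsSingular δ lam) (n : ℕ) :
    ∀ {t : ℝ}, 0 < t → ∫⁻ r in simplex n t, ENNReal.ofReal (∏ i : Fin n, lam (gap t r i.succ))
      = ENNReal.ofReal (convPow lam (fun _ => 1) n t) := by
  have hm : ∀ {m : ℕ} (t : ℝ), Measurable fun r : Fin m → ℝ =>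
      ENNReal.ofReal (∏ i : Fin m, lam (gap t r i.succ)) := fun t =>
    ENNReal.measurable_ofReal.comp (Finset.measurable_fun_prod _ fun i _ =>
      hl.measurable.comp (measurable_gap t _))
  induction n with
  | zero =>
    intro t ht
    have h : simplex 0 t = univ := eq_univ_of_forall fun r => mem_simplex_iff.2 fun i => by
      fin_cases i
      simpa [gap, times, Fin.snoc] using ht
    rw [h]
    simp [convPow, volume_pi, Measure.pi_of_empty _ (Fin.elim0 : Fin 0 → ℝ)]
  | succ n ih =>
    intro t ht
    have hs := hl.convPow hδ0 hδ (isSingular_one hδ0) n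
    rw [lintegral_simplex_succ (hm t), convPow, causalConv,
      ofReal_integral_eq_lintegral_ofReal (hl.integrableOn_conv hδ0 hδ hs ht)
        (Eventually.of_forall fun s => mul_nonneg (hl.nonneg _) (hs.nonneg _)),
      restrict_Ioo_eq_restrict_Ioc]
    refine setLIntegral_congr_fun measurableSet_Ioc fun s hs => ?_
    simp only [Fin.prod_univ_castSucc (n := n), Fin.succ_last, gap_snoc_last, Fin.succ_castSucc,
      gap_snoc_castSucc]
    rw [ENNReal.ofReal_mul (hl.nonneg _), ← ih hs.1, ← lintegral_const_mul _ (hm s)]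
    refine lintegral_congr fun r => ?_
    rw [mul_comm, ENNReal.ofReal_mul (hl.nonneg _)]

theorem integrableOn_simplex_prod_gap (hδ0 : 0 < δ) (hδ : δ < 1) (hl : IsSingular δ lam) (n : ℕ)
    {t : ℝ} (ht : 0 < t) :
    IntegrableOn (fun r : Fin n → ℝ => ∏ i : Fin n, lam (gap t r i.succ)) (simplex n t) := by
  refine ⟨(Finset.measurable_fun_prod _ fun i _ =>
    hl.measurable.comp (measurable_gap t _)).aestronglyMeasurable, ?_⟩
  rw [hasFiniteIntegral_iff_ofReal (Eventually.of_forall fun r =>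
    Finset.prod_nonneg fun i _ => hl.nonneg _), lintegral_simplex_prod_gap hδ0 hδ hl n ht]
  exact ENNReal.ofReal_lt_top

end Simplex

/-! ### The integrand of the series on the simplex -/

section Chain

variable {H : Type*} [NormedAddCommGroup H] [InnerProductSpace ℝ H] [CompleteSpace H]
  [SecondCountableTopology H] [MeasurableSpace H] [BorelSpace H]
  {κ : Kernel (ℝ × H) H} [IsMarkovKernel κ] {δ : ℝ} {lam : ℝ → ℝ} {B : H → H} {b : ℝ}

/-- The function
`S_{r₁} ⟨B, D S_{r₂ - r₁} ⟨B, D S_{r₃ - r₂} ⋯ ⟨B, D S_{t - rₙ} f⟩⟩⟩` of `r₁, …, rₙ` whose iterated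
integral is `term κ B n t f`. -/
def chain (κ : Kernel (ℝ × H) H) (B : H → H) :
    (n : ℕ) → ℝ → (H → ℝ) → (Fin n → ℝ) → H → ℝ
  | 0, t, f, _, x => semi κ t f x
  | n + 1, t, f, r, x => chain κ B n (r (Fin.last n)) (gradB κ B (t - r (Fin.last n)) f)
      (fun i => r i.castSucc) x

theorem chain_snoc (n : ℕ) (t s : ℝ) (f : H → ℝ) (r : Fin n → ℝ) (x : H) :
    chain κ B (n + 1) t f (Fin.snoc (α := fun _ => ℝ) r s) x
      = chain κ B n s (gradB κ B (t - s) f) r x := by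
  simp only [chain, Fin.snoc_last, Fin.snoc_castSucc]

theorem iteratedIntegral_chain (n : ℕ) : ∀ {t : ℝ}, 0 < t → ∀ (f : H → ℝ) (x : H),
    iteratedIntegral n t (fun r => chain κ B n t f r x) = term κ B n t f x := by
  induction n with
  | zero => intro t _ f x; rfl
  | succ n ih =>
    intro t ht f x
    rw [iteratedIntegral, term, intervalIntegral.integral_of_le ht.le]
    refine setIntegral_congr_fun measurableSet_Ioc fun s hs => ?_
    simp only [chain_snoc]
    exact ih hs.1 _ x

/-- No ordering of the times is required: `gradB` vanishes when its time is not positive and `lam`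
is nonnegative everywhere. -/
theorem IsSmoothing.abs_chain_le (hκ : IsSmoothing κ δ lam) (hB : Measurable B)
    (hBb : ∀ x, ‖B x‖ ≤ b) (n : ℕ) : ∀ {f : H → ℝ}, Measurable f → ∀ {M : ℝ}, 0 ≤ M →
    (∀ y, |f y| ≤ M) → ∀ (t : ℝ) (r : Fin n → ℝ) (x : H),
    |chain κ B n t f r x| ≤ M * b ^ n * ∏ i : Fin n, lam (gap t r i.succ) := by
  have hb : 0 ≤ b := (norm_nonneg _).trans (hBb 0)
  induction n with
  | zero =>
    intro f _ M _ hM t r x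
    simpa [chain] using abs_semi_le (κ := κ) hM t x
  | succ n ih =>
    intro f hf M hM0 hM t r x
    obtain ⟨r, s, rfl⟩ : ∃ (r' : Fin n → ℝ) (s : ℝ), r = Fin.snoc (α := fun _ => ℝ) r' s :=
      ⟨fun i => r i.castSucc, r (Fin.last n), (Fin.snoc_init_self r).symm⟩
    rw [chain_snoc]
    have hl := hκ.isSingular.nonneg (t - s)
    refine (ih (hκ.measurable_gradB_apply hB hf hM _) (by positivity)
      (hκ.abs_gradB_le hBb hf hM0 hM (t - s)) s r x).trans (le_of_eq ?_)
    simp only [Fin.prod_univ_castSucc (n := n), Fin.succ_last, gap_snoc_last, Fin.succ_castSucc,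
      gap_snoc_castSucc]
    ring

theorem IsSmoothing.measurable_chain (hκ : IsSmoothing κ δ lam) (hB : Measurable B)
    (hBb : ∀ x, ‖B x‖ ≤ b) (n : ℕ) :
    ∀ {α : Type} [MeasurableSpace α] {f : α → H → ℝ}, Measurable (Function.uncurry f) →
      (∀ a, ∃ M, ∀ y, |f a y| ≤ M) → ∀ x,
      Measurable fun q : α × ℝ × (Fin n → ℝ) => chain κ B n q.2.1 (f q.1) q.2.2 x := by
  induction n with
  | zero =>
    intro α _ f hf _ x
    exact (measurable_semi hf).comp
      (by fun_prop : Measurable fun q : α × ℝ × (Fin 0 → ℝ) => (q.1, q.2.1, x))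
  | succ n ih =>
    intro α _ f hf hfb x
    have h1 : Measurable (Function.uncurry fun (a : α × ℝ) => gradB κ B a.2 (f a.1)) :=
      (hκ.measurable_gradB hB hf hfb).comp
        (by fun_prop : Measurable fun q : (α × ℝ) × H => (q.1.1, q.1.2, q.2))
    have h2 := ih h1 (fun a => by
      obtain ⟨M, hM⟩ := hfb a.1
      have hfa : Measurable (f a.1) := hf.comp measurable_prodMk_left
      exact ⟨_, hκ.abs_gradB_le hBb hfa ((abs_nonneg _).trans (hM 0)) hM a.2⟩) x
    exact h2.comp (by fun_prop : Measurable fun q : α × ℝ × (Fin (n + 1) → ℝ) =>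
      (((q.1, q.2.1 - q.2.2 (Fin.last n)) : α × ℝ), q.2.2 (Fin.last n),
        fun i : Fin n => q.2.2 i.castSucc))

theorem IsSmoothing.integrableOn_chain (hκ : IsSmoothing κ δ lam) (hB : Measurable B)
    (hBb : ∀ x, ‖B x‖ ≤ b) (n : ℕ) {f : H → ℝ} (hf : Measurable f) {M : ℝ} (hM : ∀ y, |f y| ≤ M)
    {t : ℝ} (ht : 0 < t) (x : H) :
    IntegrableOn (fun r : Fin n → ℝ => chain κ B n t f r x) (simplex n t) := by
  have h := (hκ.measurable_chain hB hBb n (α := Unit) (f := fun _ => f) (hf.comp measurable_snd)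
    (fun _ => ⟨M, hM⟩) x).comp (by fun_prop : Measurable fun r : Fin n → ℝ => ((), t, r))
  exact Integrable.mono' ((integrableOn_simplex_prod_gap hκ.pos hκ.lt_one hκ.isSingular n
    ht).const_mul (M * b ^ n)) h.aestronglyMeasurable
    (Eventually.of_forall fun r => hκ.abs_chain_le hB hBb n hf ((abs_nonneg _).trans (hM 0)) hM t r x)

end Chain

section Integrand

variable {H : Type*} [NormedAddCommGroup H] [InnerProductSpace ℝ H] [CompleteSpace H]
  [SecondCountableTopology H] [MeasurableSpace H] [BorelSpace H]
  {Ω : Type*} [MeasurableSpace Ω] {P : Measure Ω} [IsProbabilityMeasure P]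
  {ι : Type*} {W : ι → ℝ≥0 → Ω → ℝ} {T : ℝ → H →L[ℝ] H} {Q : H →L[ℝ] H}
  {e : HilbertBasis ι ℝ H} {WA : ℝ → Ω → H} {B : H → H} {b : ℝ}

/-! ### The expectation of the integrand -/

/-- The pairing `⟨Λ(t - s) B(Z_s^x), Q_{t-s}^{-1/2} (Z_t^x - e^{(t-s)A} Z_s^x)⟩`. -/
def transitionPairing (P : Measure Ω) (T : ℝ → H →L[ℝ] H) (Q : H →L[ℝ] H) (WA : ℝ → Ω → H)
    (B : H → H) (x : H) (s t : ℝ) : Ω → ℝ :=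
  gaussPairing P (covOp T Q (t - s)) (fun ω => Lam T Q (t - s) (B (proc T WA x s ω)))
    (fun ω => proc T WA x t ω - T (t - s) (proc T WA x s ω))

/-- The product of the pairings in `integrand`. -/
def pairingProd (P : Measure Ω) (T : ℝ → H →L[ℝ] H) (Q : H →L[ℝ] H) (WA : ℝ → Ω → H)
    (B : H → H) (x : H) {n : ℕ} (t : ℝ) (r : Fin n → ℝ) (ω : Ω) : ℝ :=
  ∏ i : Fin n, transitionPairing P T Q WA B x (times t r i.succ.castSucc)
    (times t r i.succ.succ) ω

theorem integrand_eq (u₀ : H → ℝ) (x : H) {n : ℕ} (t : ℝ) (r : Fin n → ℝ) (ω : Ω) :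
    integrand P T Q WA u₀ B x t r ω
      = u₀ (proc T WA x t ω) * pairingProd P T Q WA B x t r ω := rfl

theorem times_last {n : ℕ} (t : ℝ) (r : Fin n → ℝ) : times t r (Fin.last (n + 1)) = t := by
  rw [times, ← Fin.succ_last, Fin.cons_succ, Fin.snoc_last]

theorem pairingProd_snoc (x : H) {n : ℕ} (t s : ℝ) (r : Fin n → ℝ) (ω : Ω) :
    pairingProd P T Q WA B x t (Fin.snoc (α := fun _ => ℝ) r s) ω
      = pairingProd P T Q WA B x s r ω * transitionPairing P T Q WA B x s t ω := by
  simp only [pairingProd, Fin.prod_univ_castSucc (n := n), times_snoc, Fin.succ_last,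
    Fin.snoc_castSucc, Fin.snoc_last, Fin.succ_castSucc, times_last]

theorem times_zero {n : ℕ} (t : ℝ) (r : Fin n → ℝ) : times t r 0 = 0 := rfl

theorem times_nonneg {n : ℕ} {t : ℝ} {r : Fin n → ℝ} (hr : r ∈ simplex n t) (j : Fin (n + 2)) :
    0 ≤ times t r j := by
  rw [← times_zero t r]
  exact hr.monotone (Fin.zero_le j)

theorem times_le {n : ℕ} {t : ℝ} {r : Fin n → ℝ} (hr : r ∈ simplex n t) (j : Fin (n + 2)) :
    times t r j ≤ t := by
  conv_rhs => rw [← times_last t r]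
  exact hr.monotone (Fin.le_last j)

namespace IsStochasticConvolution

/-- One conditional expectation. The past is recorded by finitely many values `W_A(τ j)`, the last
at time `s`, and `φ` stands for the product of earlier pairings. The joint law of past and increment
is a product, so on each fibre the pairing is the white noise of a fixed vector. Integrating
`f(Z_t)` against it gives the derivative of `S_{t-s} f` at `Z_s` in direction `B(Z_s)`. -/
theorem exists_transitionPairing (hT : IsC0Semigroup T) (hQ : Q.IsPositive)
    (hQker : LinearMap.ker Q.toLinearMap = ⊥)
    (hrange : ∀ t : ℝ, 0 < t → range (T t) ⊆ range (opSqrt (covOp T Q t)))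
    (hW : IsCylindricalBM W P) (hWA : IsStochasticConvolution P T Q e W WA)
    (hB : Measurable B) (hBb : ∀ x, ‖B x‖ ≤ b) (x : H) {m : ℕ} {τ : Fin (m + 1) → ℝ} {s t : ℝ}
    (hτ : ∀ j, 0 ≤ τ j) (hτs : ∀ j, τ j ≤ s) (hlast : τ (Fin.last m) = s) (hst : s < t)
    {φ : (Fin (m + 1) → H) → ℝ} (hφ : Measurable φ)
    (hφ2 : MemLp (fun ω => φ fun j => WA (τ j) ω) 2 P) :
    ∃ ψ : (Fin (m + 1) → H) × H → ℝ, Measurable ψ ∧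
      transitionPairing P T Q WA B x s t
        =ᵐ[P] (fun ω => ψ ((fun j => WA (τ j) ω), increment T WA s t ω)) ∧
      MemLp (fun ω => (φ fun j => WA (τ j) ω)
        * ψ ((fun j => WA (τ j) ω), increment T WA s t ω)) 2 P ∧
      ∀ f : H → ℝ, Measurable f → ∀ M, (∀ y, |f y| ≤ M) →
        Measurable (gradB (hWA.kernel hT hQ hW) B (t - s) f) →
        ∫ ω, f (proc T WA x t ω) * ((φ fun j => WA (τ j) ω)
            * ψ ((fun j => WA (τ j) ω), increment T WA s t ω)) ∂P
          = ∫ ω, gradB (hWA.kernel hT hQ hW) B (t - s) f (proc T WA x s ω)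
            * φ (fun j => WA (τ j) ω) ∂P := by
  have hs : 0 ≤ s := hlast ▸ hτ _
  have hts : 0 < t - s := sub_pos.2 hst
  have hp : AEMeasurable (fun ω j => WA (τ j) ω) P :=
    aemeasurable_pi_lambda _ fun j => (hWA.memLp (hτ j)).1.aemeasurable
  have hY : AEMeasurable (increment T WA s t) P := (hWA.memLp_increment hs hst.le).1.aemeasurable
  have hpY := hp.prodMk hY
  have hmap := hWA.map_prodMk_increment hT hQ hW hτ hτs hs hst.le
  set ρ : Measure (Fin (m + 1) → H) := P.map fun ω j => WA (τ j) ω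
  set μ : Measure H := P.map (WA (t - s))
  have : IsProbabilityMeasure ρ := Measure.isProbabilityMeasure_map hp
  have : IsProbabilityMeasure μ := Measure.isProbabilityMeasure_map (hWA.memLp hts.le).1.aemeasurable
  have hμ : IsCenteredGaussian μ (covOp T Q (t - s)) := hWA.isCenteredGaussian hT hQ hQker hW hts
  let h : (Fin (m + 1) → H) → H := fun z => Lam T Q (t - s) (B (T s x + z (Fin.last m)))
  have hh : Measurable h := (Lam T Q (t - s)).continuous.measurable.comp (hB.comp (by fun_prop))
  have hc : ∀ z, ‖h z‖ ≤ ‖Lam T Q (t - s)‖ * b := fun z =>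
    (Lam T Q (t - s)).le_opNorm_of_le (hBb _)
  have hproc : ∀ ω, T s x + WA (τ (Fin.last m)) ω = proc T WA x s ω := fun ω => by
    rw [hlast, proc]
  have hTt : T (t - s) (T s x) = T t x := by
    rw [← hT.apply_add hts.le hs, sub_add_cancel]
  obtain ⟨ψ, hψ, hlim⟩ := hμ.exists_pairing hh hc ρ
  have hψe := hμ.pairing_ae_eq hh hψ hlim
  have hφρ : MemLp φ 2 ρ :=
    (memLp_map_measure_iff hφ.aestronglyMeasurable hp).2 hφ2
  refine ⟨ψ, hψ, ?_, ?_, fun f hf M hM hg => ?_⟩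
  · have h1 := IsCenteredGaussian.gaussPairing_ae_eq hh hψ hp hY hmap hlim
    have h2 : (fun ω => proc T WA x t ω - T (t - s) (proc T WA x s ω)) = increment T WA s t := by
      funext ω
      rw [proc, proc, map_add, hTt, increment]
      abel
    have h3 : (fun ω => Lam T Q (t - s) (B (proc T WA x s ω)))
        = fun ω => h (fun j => WA (τ j) ω) := by
      funext ω
      rw [← hproc]
    rw [transitionPairing, h2, h3]
    exact h1
  · have h1 := hμ.memLp_mul_pairing hh hc hψ hψe hφ hφρ
    rw [← hmap] at h1
    exact (memLp_map_measure_iff ((hφ.comp measurable_fst).mul hψ).aestronglyMeasurable hpY).1 h1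
  -- This expresses `f(Z_t)` through past and increment, using `Z_t = e^{(t-s)A} Z_s + increment`.
  · let F : (Fin (m + 1) → H) × H → ℝ := fun q =>
      f (T (t - s) (T s x + q.1 (Fin.last m)) + q.2)
    have hF : Measurable F := hf.comp (by fun_prop)
    have h1 := hμ.integral_mul_pairing hh hc hψ hψe hφ hφρ hF (M := M) fun q => hM _
    have hmeas : Measurable fun q : (Fin (m + 1) → H) × H => F q * (φ q.1 * ψ q) :=
      hF.mul ((hφ.comp measurable_fst).mul hψ)
    rw [← hmap, integral_map hpY hmeas.aestronglyMeasurable] at h1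
    have hFω : ∀ ω, F ((fun j => WA (τ j) ω), increment T WA s t ω) = f (proc T WA x t ω) :=
      fun ω => by
        simp only [F, hlast, map_add, hTt, increment, proc]
        congr 1
        abel
    simp only [hFω] at h1
    rw [h1]
    -- The inner integral is the derivative formula for the semigroup, evaluated at the frozen
    -- position and direction.
    have hgrad : ∀ z : Fin (m + 1) → H, ∫ y, F (z, y) * hμ.whiteNoise (h z) y ∂μ
        = gradB (hWA.kernel hT hQ hW) B (t - s) f (T s x + z (Fin.last m)) := fun z => by
      rw [gradB, if_pos hts, hWA.semi_eq_integral hT hQ hW hts.le hf]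
      exact (hμ.fderiv_integral_apply (opSqrt_Lam_apply (hrange _ hts)) hf
        ((abs_nonneg _).trans (hM 0)) hM (T s x + z (Fin.last m))
        (B (T s x + z (Fin.last m)))).symm
    simp only [hgrad]
    have hgφ : Measurable fun z : Fin (m + 1) → H =>
        gradB (hWA.kernel hT hQ hW) B (t - s) f (T s x + z (Fin.last m)) * φ z :=
      (hg.comp (by fun_prop)).mul hφ
    rw [integral_map hp hgφ.aestronglyMeasurable]
    simp only [hproc]

/-- Writing the product as a measurable function of finitely many values of `W_A` is what allows the
independence of the next increment to be used. Square integrability propagates one factor at a time.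
-/
theorem exists_pairingProd (hT : IsC0Semigroup T) (hQ : Q.IsPositive)
    (hQker : LinearMap.ker Q.toLinearMap = ⊥)
    (hrange : ∀ t : ℝ, 0 < t → range (T t) ⊆ range (opSqrt (covOp T Q t)))
    (hW : IsCylindricalBM W P) (hWA : IsStochasticConvolution P T Q e W WA)
    (hB : Measurable B) (hBb : ∀ x, ‖B x‖ ≤ b) (x : H) (n : ℕ) :
    ∀ {t : ℝ} {r : Fin n → ℝ}, r ∈ simplex n t → ∃ φ : (Fin (n + 1) → H) → ℝ, Measurable φ ∧
      MemLp (fun ω => φ fun j => WA (times t r j.succ) ω) 2 P ∧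
      pairingProd P T Q WA B x t r =ᵐ[P] fun ω => φ fun j => WA (times t r j.succ) ω := by
  induction n with
  | zero =>
    intro t r _
    refine ⟨fun _ => 1, measurable_const, memLp_const 1, Eventually.of_forall fun ω => ?_⟩
    simp [pairingProd]
  | succ n ih =>
    intro t r hr
    obtain ⟨r, s, rfl⟩ : ∃ (r' : Fin n → ℝ) (s : ℝ), r = Fin.snoc (α := fun _ => ℝ) r' s :=
      ⟨fun i => r i.castSucc, r (Fin.last n), (Fin.snoc_init_self r).symm⟩
    obtain ⟨hr, hst⟩ := mem_simplex_snoc.1 hr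
    obtain ⟨φ, hφ, hφ2, hφe⟩ := ih hr
    obtain ⟨ψ, hψ, hψe, hmem, -⟩ := hWA.exists_transitionPairing hT hQ hQker hrange hW hB hBb x
      (τ := fun j => times s r j.succ) (fun j => times_nonneg hr _) (fun j => times_le hr _)
      (times_last s r) hst hφ hφ2
    have h1 : ∀ j : Fin (n + 1), times t (Fin.snoc (α := fun _ => ℝ) r s) j.castSucc.succ
        = times s r j.succ := fun j => by
      rw [times_snoc, Fin.succ_castSucc, Fin.snoc_castSucc]
    have h2 : times t (Fin.snoc (α := fun _ => ℝ) r s) (Fin.last (n + 1)).succ = t :=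
      times_last _ _
    have h3 : times s r (Fin.last n).succ = s := times_last _ _
    -- The new coordinate is `W_A(t)`; the increment is recovered by subtracting the propagated
    -- value at time `s`, the second to last coordinate.
    refine ⟨fun z => φ (fun j => z j.castSucc) * ψ ((fun j => z j.castSucc),
      z (Fin.last (n + 1)) - T (t - s) (z (Fin.last n).castSucc)), ?_, ?_, ?_⟩
    · exact (hφ.comp (by fun_prop)).mul (hψ.comp (by fun_prop))
    · simp only [h1, h2, h3]
      exact hmem
    · filter_upwards [hφe, hψe] with ω hω1 hω2
      simp only [h1, h2, h3]
      rw [pairingProd_snoc, hω1, hω2]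
      rfl

theorem integrable_integrand (hT : IsC0Semigroup T) (hQ : Q.IsPositive)
    (hQker : LinearMap.ker Q.toLinearMap = ⊥)
    (hrange : ∀ t : ℝ, 0 < t → range (T t) ⊆ range (opSqrt (covOp T Q t)))
    (hW : IsCylindricalBM W P) (hWA : IsStochasticConvolution P T Q e W WA)
    (hB : Measurable B) (hBb : ∀ x, ‖B x‖ ≤ b) {f : H → ℝ} (hf : Measurable f) {M : ℝ}
    (hM : ∀ y, |f y| ≤ M) (x : H) {n : ℕ} {t : ℝ} {r : Fin n → ℝ} (hr : r ∈ simplex n t) :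
    Integrable (integrand P T Q WA f B x t r) P := by
  obtain ⟨φ, hφ, hφ2, hφe⟩ := hWA.exists_pairingProd hT hQ hQker hrange hW hB hBb x n hr
  have h1 : Integrable (pairingProd P T Q WA B x t r) P :=
    (hφ2.integrable one_le_two).congr hφe.symm
  exact h1.bdd_mul (hf.comp_aemeasurable (hWA.aemeasurable_proc
    (pos_of_mem_simplex hr).le x)).aestronglyMeasurable (Eventually.of_forall fun ω => hM _)

/-- Conditioning on the history up to the last time `s` removes one pairing and replaces `f` by `⟨B,
D S_{t-s} f⟩`, which is exactly the recursion of `chain`. For this reason `f` varies in the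
induction. -/
theorem integral_integrand (hT : IsC0Semigroup T) (hQ : Q.IsPositive)
    (hQker : LinearMap.ker Q.toLinearMap = ⊥)
    (hrange : ∀ t : ℝ, 0 < t → range (T t) ⊆ range (opSqrt (covOp T Q t)))
    (hW : IsCylindricalBM W P) (hWA : IsStochasticConvolution P T Q e W WA)
    {δ : ℝ} {lam : ℝ → ℝ} (hκ : IsSmoothing (hWA.kernel hT hQ hW) δ lam)
    (hB : Measurable B) (hBb : ∀ x, ‖B x‖ ≤ b) (x : H) (n : ℕ) :
    ∀ {f : H → ℝ}, Measurable f → ∀ {M : ℝ}, (∀ y, |f y| ≤ M) →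
      ∀ {t : ℝ} {r : Fin n → ℝ}, r ∈ simplex n t →
      ∫ ω, integrand P T Q WA f B x t r ω ∂P = chain (hWA.kernel hT hQ hW) B n t f r x := by
  induction n with
  | zero =>
    intro f hf M hM t r hr
    rw [chain, ← hWA.transOp_eq_semi hT hQ hW (pos_of_mem_simplex hr).le hf]
    simp [integrand, transOp]
  | succ n ih =>
    intro f hf M hM t r hr
    obtain ⟨r, s, rfl⟩ : ∃ (r' : Fin n → ℝ) (s : ℝ), r = Fin.snoc (α := fun _ => ℝ) r' s :=
      ⟨fun i => r i.castSucc, r (Fin.last n), (Fin.snoc_init_self r).symm⟩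
    obtain ⟨hr, hst⟩ := mem_simplex_snoc.1 hr
    obtain ⟨φ, hφ, hφ2, hφe⟩ := hWA.exists_pairingProd hT hQ hQker hrange hW hB hBb x n hr
    obtain ⟨ψ, hψ, hψe, -, hint⟩ := hWA.exists_transitionPairing hT hQ hQker hrange hW hB hBb x
      (τ := fun j => times s r j.succ) (fun j => times_nonneg hr _) (fun j => times_le hr _)
      (times_last s r) hst hφ hφ2
    rw [chain_snoc, ← ih (hκ.measurable_gradB_apply hB hf hM _)
      (hκ.abs_gradB_le hBb hf ((abs_nonneg _).trans (hM 0)) hM (t - s)) hr]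
    refine Eq.trans ?_ ((hint f hf M hM (hκ.measurable_gradB_apply hB hf hM _)).trans ?_)
    · refine integral_congr_ae ?_
      filter_upwards [hφe, hψe] with ω hω1 hω2
      rw [integrand_eq, pairingProd_snoc, hω1, hω2]
    · refine integral_congr_ae ?_
      filter_upwards [hφe] with ω hω1
      rw [integrand_eq, hω1]

end IsStochasticConvolution

end Integrand

/-! ### Uniform norms -/

theorem norm_le_supNorm {α E : Type*} [Norm E] {f : α → E}
    (h : BddAbove (range fun x => ‖f x‖)) (x : α) : ‖f x‖ ≤ supNorm f :=
  le_ciSup h x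

theorem bddAbove_and_supNorm_le {α E : Type*} [Nonempty α] [Norm E] {f : α → E}
    {c : ℝ} (h : ∀ x, ‖f x‖ ≤ c) : BddAbove (range fun x => ‖f x‖) ∧ supNorm f ≤ c :=
  ⟨⟨c, forall_mem_range.2 h⟩, ciSup_le h⟩

end

end KolmogorovSeries

/-! ### The main theorem -/

theorem mainTheorem4
    {H : Type*} [NormedAddCommGroup H] [InnerProductSpace ℝ H] [CompleteSpace H]
    [SecondCountableTopology H] [MeasurableSpace H] [BorelSpace H]
    -- the semigroup `T t = e^{tA}` generated by `A`
    (A : H →ₗ.[ℝ] H) (T : ℝ → H →L[ℝ] H)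
    (hT : KolmogorovSeries.IsC0Semigroup T) (hA : KolmogorovSeries.IsGenerator A T)
    -- the covariance operator
    (Q : H →L[ℝ] H) (hQ : Q.IsPositive) (hQker : LinearMap.ker Q.toLinearMap = ⊥)
    (hQtr : ∀ t : ℝ, 0 < t → KolmogorovSeries.IsTraceClass (KolmogorovSeries.covOp T Q t))
    (hrange : ∀ t : ℝ, 0 < t →
      Set.range (T t) ⊆ Set.range (KolmogorovSeries.opSqrt (KolmogorovSeries.covOp T Q t)))
    (δ C : ℝ) (hδ0 : 0 < δ) (hδ1 : δ < 1) (hC : 0 < C)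
    (hΛ : ∀ t : ℝ, 0 < t → ‖KolmogorovSeries.Lam T Q t‖ ≤ C / t ^ δ)
    -- the noise and the stochastic convolution
    {Ω : Type*} [MeasurableSpace Ω] (P : Measure Ω) [IsProbabilityMeasure P]
    {ι : Type*} (e : HilbertBasis ι ℝ H) (W : ι → ℝ≥0 → Ω → ℝ)
    (hW : KolmogorovSeries.IsCylindricalBM W P)
    (WA : ℝ → Ω → H) (hWA : KolmogorovSeries.IsStochasticConvolution P T Q e W WA)
    -- the data
    (u₀ : H → ℝ) (hu₀ : Measurable u₀) (hu₀b : BddAbove (Set.range fun x => ‖u₀ x‖))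
    (B : H → H) (hB : Measurable B) (hBb : BddAbove (Set.range fun x => ‖B x‖))
    (n : ℕ) (hn : 1 ≤ n) (t : ℝ) (ht : 0 < t) :
    -- the representation formula, whose integrals exist
    (∀ x : H,
      (∀ r ∈ KolmogorovSeries.simplex n t,
        Integrable (KolmogorovSeries.integrand P T Q WA u₀ B x t r) P) ∧
      IntegrableOn (fun r : Fin n → ℝ => ∫ ω, KolmogorovSeries.integrand P T Q WA u₀ B x t r ω ∂P)
        (KolmogorovSeries.simplex n t) volume ∧
      KolmogorovSeries.seriesTerm P T WA u₀ B n t x =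
        KolmogorovSeries.iteratedIntegral n t
          (fun r => ∫ ω, KolmogorovSeries.integrand P T Q WA u₀ B x t r ω ∂P)) ∧
    -- the bound on `‖v^n(t)‖_∞`
    (BddAbove (Set.range fun x => ‖KolmogorovSeries.seriesTerm P T WA u₀ B n t x‖) ∧
      KolmogorovSeries.supNorm (KolmogorovSeries.seriesTerm P T WA u₀ B n t) ≤
        KolmogorovSeries.supNorm u₀ * KolmogorovSeries.supNorm B ^ n *
          KolmogorovSeries.iteratedIntegral n t
            (fun r => ∏ i : Fin n, ‖KolmogorovSeries.Lam T Q (KolmogorovSeries.gap t r i.succ)‖)) ∧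
    -- the bound on `‖D v^n(t)‖_∞`
    (Differentiable ℝ (KolmogorovSeries.seriesTerm P T WA u₀ B n t) ∧
      BddAbove (Set.range fun x => ‖fderiv ℝ (KolmogorovSeries.seriesTerm P T WA u₀ B n t) x‖) ∧
      KolmogorovSeries.supNorm (fderiv ℝ (KolmogorovSeries.seriesTerm P T WA u₀ B n t)) ≤
        KolmogorovSeries.supNorm u₀ * KolmogorovSeries.supNorm B ^ n *
          KolmogorovSeries.iteratedIntegral n t
            (fun r => ∏ i : Fin (n + 1), ‖KolmogorovSeries.Lam T Q (KolmogorovSeries.gap t r i)‖)) := by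
  open KolmogorovSeries in
  have hκ := hWA.isSmoothing hT hQ hW hQker hrange hδ0 hδ1 hC hΛ
  have hM : ∀ y, |u₀ y| ≤ supNorm u₀ := norm_le_supNorm hu₀b
  have hb : ∀ x, ‖B x‖ ≤ supNorm B := norm_le_supNorm hBb
  have hM0 : 0 ≤ supNorm u₀ := (abs_nonneg _).trans (hM 0)
  have hterm : seriesTerm P T WA u₀ B n t = term (hWA.kernel hT hQ hW) B n t u₀ :=
    hκ.seriesTerm_eq_term hB hb (fun s hs f hf x => hWA.transOp_eq_semi hT hQ hW hs hf x)
      hu₀ hM n ht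
  have hexp : ∀ x, ∀ r ∈ simplex n t, ∫ ω, integrand P T Q WA u₀ B x t r ω ∂P
      = chain (hWA.kernel hT hQ hW) B n t u₀ r x := fun x r hr =>
    hWA.integral_integrand hT hQ hQker hrange hW hκ hB hb x n hu₀ hM hr
  -- All gaps are positive on the simplex, so the extension of `‖Λ‖` by `0` to nonpositive times
  -- plays no role there.
  have hlam : ∀ r ∈ simplex n t, ∀ i, ‖Lam T Q (gap t r i)‖
      = IsStochasticConvolution.lamNorm T Q (gap t r i) := fun r hr i =>
    (IsStochasticConvolution.lamNorm_of_pos (mem_simplex_iff.1 hr i)).symm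
  have hsmooth := hκ.termSmooth hB hb n hu₀ hM0 hM ht
  refine ⟨fun x => ⟨fun r hr => ?_, ?_, ?_⟩, ?_, ?_, ?_⟩
  · exact hWA.integrable_integrand hT hQ hQker hrange hW hB hb hu₀ hM x hr
  · exact (hκ.integrableOn_chain hB hb n hu₀ hM ht x).congr_fun
      (fun r hr => (hexp x r hr).symm) (measurableSet_simplex n t)
  · rw [hterm, iteratedIntegral_congr n ht (hexp x), iteratedIntegral_chain n ht]
  · rw [hterm, iteratedIntegral_congr n ht fun r hr =>
      Finset.prod_congr rfl fun i _ => hlam r hr i.succ, iteratedIntegral_prod_gap_succ n ht]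
    exact bddAbove_and_supNorm_le (hκ.abs_term_le hB hb n hu₀ hM0 hM ht)
  · rw [hterm]
    exact hsmooth.1
  · rw [hterm, iteratedIntegral_congr n ht fun r hr =>
      Finset.prod_congr rfl fun i _ => hlam r hr i, iteratedIntegral_prod_gap n ht]
    exact bddAbove_and_supNorm_le hsmooth.2
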